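/- Let $N_6$ denote the closed non-orientable surface of genus $6$, i.e. the connected sum of six projective planes; concretely, the quotient of a $12$-gon by the boundary identification $a_1a_1a_2a_2\cdots a_6a_6$. A triangulation of $N_6$ is a (finite, abstract) two-dimensional simplicial complex $\Delta$ whose underlying space $|\Delta|$ is homeomorphic to $N_6$. A map $\psi\colon V\to\mathbb R^3$ on the vertex set $V$ of $\Delta$ induces a simplexwise linear map $\phi_\psi\colon|\Delta|\to\mathbb R^3$; it is called a polyhedral immersion if $\phi_\psi$ is locally injective. It has $2$-fold rotational symmetry if there are a rotation $\rho$ of $\mathbb R^3$ of order $2$ about an axis and a simplicial automorphism $\sigma$ of $\Delta$ such that $\rho\circ\phi_\psi=\phi_\psi\circ|\sigma|$. **Theorem.** The minimal number of vertices of a triangulation of $N_6$ is $10$, and some $10$-vertex triangulation of $N_6$ has a polyhedral immersion into $\mathbb R^3$ with $2$-fold rotational symmetry. In particular, $10$ is the minimal number of vertices of a triangulation of $N_6$ that admits a polyhedral immersion into $\mathbb R^3$. -/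

import Mathlib

noncomputable section

/-- The closed unit disc in the complex plane. -/
abbrev UnitDisc : Type := Metric.closedBall (0 : ℂ) 1

/-- The unit circle is divided into the `2 * h` arcs
`A k = {exp (2 * π * i * (k + t) / (2 * h)) | 0 ≤ t ≤ 1}` for `k = 0, …, 2 * h - 1`.
The arcs `A (2 * j)` and `A (2 * j + 1)` are identified, both traversed in the positive direction.
This is the labelling `a₁ a₁ a₂ a₂ … a_h a_h` of the boundary of a `2 * h`-gon. -/
def crossCapGluing (h : ℕ) (z w : UnitDisc) : Prop :=
  ∃ j : Fin h, ∃ t ∈ Set.Icc (0 : ℝ) 1,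
    (z : ℂ) = Complex.exp (2 * Real.pi * Complex.I * ((2 * (j : ℕ) + t) / (2 * h))) ∧
    (w : ℂ) = Complex.exp (2 * Real.pi * Complex.I * ((2 * (j : ℕ) + 1 + t) / (2 * h)))

/-- The closed non-orientable surface `N_h` of genus `h ≥ 1` (the connected sum of `h` projective
planes), as the quotient space of the `2 * h`-gon with boundary word `a₁ a₁ a₂ a₂ … a_h a_h`.
`Quot` divides by the equivalence relation generated by the gluing and carries the quotient
topology. -/
abbrev NonorientableSurface (h : ℕ) : Type := Quot (crossCapGluing h)

namespace AbstractSimplicialComplex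

variable {V : Type*} [Fintype V]

/-- The underlying space `|Δ|` of a finite simplicial complex: the points of the standard simplex
on the vertex set (in barycentric coordinates) that are supported on a face of `Δ`. It carries the
subspace topology. -/
def space (Δ : AbstractSimplicialComplex V) : Set (V → ℝ) :=
  {x | x ∈ stdSimplex ℝ V ∧ ∃ s ∈ Δ.faces, ∀ v, x v ≠ 0 → v ∈ s}

/-- `Δ` is two-dimensional: its largest faces are triangles. -/
def IsTwoDimensional (Δ : AbstractSimplicialComplex V) : Prop :=
  (∀ s ∈ Δ.faces, s.card ≤ 3) ∧ ∃ s ∈ Δ.faces, s.card = 3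

/-- `Δ` is a triangulation of the surface `S`: a two-dimensional simplicial complex whose underlying
space is homeomorphic to `S`. -/
def Triangulates (Δ : AbstractSimplicialComplex V) (S : Type*) [TopologicalSpace S] : Prop :=
  Δ.IsTwoDimensional ∧ Nonempty (Δ.space ≃ₜ S)

/-- The simplexwise linear map determined by the positions `ψ v` of the vertices, in barycentric
coordinates. Its restriction to `Δ.space` is the map `|Δ| → ℝ³` induced by `ψ`. -/
def linearMapOfVertices (ψ : V → EuclideanSpace ℝ (Fin 3)) (x : V → ℝ) :
    EuclideanSpace ℝ (Fin 3) :=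
  ∑ v, x v • ψ v

/-- `ψ` induces a polyhedral immersion of `Δ` into `ℝ³`: the induced simplexwise linear map
`|Δ| → ℝ³` is locally injective. -/
def IsPolyhedralImmersion (Δ : AbstractSimplicialComplex V)
    (ψ : V → EuclideanSpace ℝ (Fin 3)) : Prop :=
  ∀ x : Δ.space, ∃ U ∈ nhds x, Set.InjOn (fun y : Δ.space => linearMapOfVertices ψ y) U

/-- The permutation `σ` of the vertices is an automorphism of `Δ`. -/
def IsAutomorphism (Δ : AbstractSimplicialComplex V) (σ : Equiv.Perm V) : Prop :=
  ∀ s : Finset V, s ∈ Δ.faces ↔ s.map σ.toEmbedding ∈ Δ.faces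

end AbstractSimplicialComplex

/-- `ρ` is a `k`-fold rotation of `ℝ³`: an orientation-preserving isometry with a fixed point
(hence a rotation about an axis through it) that has order exactly `k`. -/
def IsRotationOfOrder (k : ℕ)
    (ρ : EuclideanSpace ℝ (Fin 3) ≃ᵃⁱ[ℝ] EuclideanSpace ℝ (Fin 3)) : Prop :=
  (∃ p, ρ p = p) ∧
  LinearMap.det
    (ρ.linearIsometryEquiv : EuclideanSpace ℝ (Fin 3) →ₗ[ℝ] EuclideanSpace ℝ (Fin 3)) = 1 ∧
  orderOf ρ = k

namespace AbstractSimplicialComplex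

variable {V : Type*} [Fintype V]

/-- The simplexwise linear map `|Δ| → ℝ³` induced by `ψ` has `k`-fold rotational symmetry: some
`k`-fold rotation `ρ` of `ℝ³` is induced by an automorphism `σ` of `Δ`. The automorphism acts
on `|Δ|` by sending the point with barycentric coordinates `x` to the one with coordinates
`x ∘ σ⁻¹`. -/
def HasRotationalSymmetry (Δ : AbstractSimplicialComplex V)
    (ψ : V → EuclideanSpace ℝ (Fin 3)) (k : ℕ) : Prop :=
  ∃ ρ : EuclideanSpace ℝ (Fin 3) ≃ᵃⁱ[ℝ] EuclideanSpace ℝ (Fin 3), IsRotationOfOrder k ρ ∧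
    ∃ σ : Equiv.Perm V, Δ.IsAutomorphism σ ∧
      ∀ x ∈ Δ.space, ρ (linearMapOfVertices ψ x) = linearMapOfVertices ψ (x ∘ σ.symm)

end AbstractSimplicialComplex

end

/-! Existence. The explicit complex with 28 triangles is recognized as the surface without the
classification theorem. A generalized bistellar move replaces a subcomplex σ * ∂τ * M by ∂σ * τ * M;
moving mass from σ to τ in barycentric coordinates is a homeomorphism between the two spaces
(`exists_homeomorph_exchange`). A list of such moves leads from the ten-vertex complex to a complex
that is a triangulated disc with 48 boundary edges, glued along its boundary. Further moves that fix
the boundary turn this disc into the cone over a 48-cycle, and the cone is the round disc by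
`exists_homeomorph_cone`. The boundary labels follow the word of the 12-gon with four edges on each
side, so the glued disc is the quotient in the definition of the surface
(`nonempty_homeomorph_surfaceFacets`). All combinatorial conditions are finite checks.

The immersion. Every point has a positive coordinate at some vertex v, so it suffices that the map
is injective on open vertex stars. There two triangles at v span cones with apex v, and the cones
meet only where they should; this is a condition on the signs of determinants of edge vectors
(`starDisjoint`). The half-turn about the third axis permutes the vertex positions.

Minimality. Let a triangulation have n vertices, e edges and t triangles. Every edge is in exactly
two triangles, so 3t = 2e. Modulo two, the kernel of the coboundary on vertices and the group of
2-cycles have dimension at most one, and the first cohomology has dimension at least six. Rank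
counting gives 6 + (n - 1) + (t - 1) ≤ e, hence e ≥ 3n + 12, whereas e ≤ n(n - 1)/2. This fails for
n ≤ 9.

The topological input is transferred from the ten-vertex complex through a homeomorphism. The two
triangles at each edge come from invariance of domain in the plane
(`isClosedAtEdges_of_homeomorph`). First cohomology modulo two is made topological by line fields: a
cocycle of signs defines a line field, its pullback has a holonomy cocycle, and cohomologous
holonomies give isomorphic line fields (`exists_cohomology_injection`). The bounds in degrees zero
and two hold because the surface stays connected when finitely many points are removed. -/

open Finset

/-! ### Generalized bistellar moves as homeomorphisms -/

namespace FacetList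

/-- The set of natural numbers in `l`, as a bit mask. -/
def mask (l : List ℕ) : ℕ := l.foldr (fun i m => 2 ^ i ||| m) 0

/-- Inclusion of bit masks. -/
def sub (s t : ℕ) : Bool := s &&& t == s

/-- Replace the star of `σ` in a complex by the join of `∂σ`, `τ` and a link. The complex is given
by a list of faces that contains all facets, and the faces are bit masks. -/
def exchange (σ τ : List ℕ) (L : List ℕ) : List ℕ :=
  L.filter (fun t => !sub (mask σ) t) ++
    ((L.filter (sub (mask σ))).flatMap fun t => σ.map fun i => (t ||| mask τ) ^^^ 2 ^ i).dedup

/-- Conditions under which `exchange σ τ` does not change the homeomorphism type, nor the points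
that are supported on one of the faces in `B`. -/
def exchangeable (N : ℕ) (B : List ℕ) (σ τ : List ℕ) (L : List ℕ) : Bool :=
  σ.Nodup && τ.Nodup && !σ.isEmpty && !τ.isEmpty && σ.all (fun i => !τ.contains i) &&
  σ.all (fun i => decide (i < N)) && τ.all (fun i => decide (i < N)) &&
  L.all (fun t => !sub (mask τ) t) && B.all (fun t => !sub (mask σ) t) &&
  (L.filter (sub (mask σ))).all fun t => τ.all fun j =>
    (L.filter (sub (mask σ))).any fun q => sub ((t ||| mask τ) ^^^ 2 ^ j) q

/-- The sequence of exchanges is admissible and leads to the complex spanned by `K`. -/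
def deforms (N : ℕ) (B K : List ℕ) : List (List ℕ × List ℕ) → List ℕ → Bool
  | [], L => L.all (fun t => K.any (sub t)) && K.all (fun t => L.any (sub t))
  | (σ, τ) :: ms, L => exchangeable N B σ τ L && deforms N B K ms (exchange σ τ L)

theorem testBit_mask (l : List ℕ) (i : ℕ) : (mask l).testBit i = decide (i ∈ l) := by
  induction l with
  | nil => simp [mask]
  | cons a l ih =>
    have : mask (a :: l) = 2 ^ a ||| mask l := rfl
    rw [this, Nat.testBit_or, ih, Nat.testBit_two_pow]
    by_cases h : i = a
    · simp [h]
    · simp [h, Ne.symm h]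

theorem sub_iff {s t : ℕ} : sub s t = true ↔ ∀ i, s.testBit i = true → t.testBit i = true := by
  rw [sub, beq_iff_eq]
  constructor
  · intro h i hi
    rw [← h, Nat.testBit_and] at hi
    exact (Bool.and_eq_true_iff.mp hi).2
  · intro h
    apply Nat.eq_of_testBit_eq
    intro i
    rw [Nat.testBit_and]
    by_cases hs : s.testBit i = true
    · simp [hs, h i hs]
    · simp [Bool.eq_false_iff.mpr hs]

theorem sub_mask_iff {l : List ℕ} {t : ℕ} : sub (mask l) t = true ↔ ∀ i ∈ l, t.testBit i = true := by
  simp [sub_iff, testBit_mask]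

theorem testBit_xor_two_pow {t i : ℕ} (h : t.testBit i = true) (j : ℕ) :
    (t ^^^ 2 ^ i).testBit j = true ↔ t.testBit j = true ∧ j ≠ i := by
  rw [Nat.testBit_xor, Nat.testBit_two_pow]
  by_cases hij : i = j
  · subst hij; simp [h]
  · simp [hij, Ne.symm hij]

/-- The function `x` vanishes outside the face `t`. -/
def SupportedOn (x : ℕ → ℝ) (t : ℕ) : Prop := ∀ i, x i ≠ 0 → t.testBit i = true

/-- The underlying space of the complex spanned by the faces in `L`, all of whose vertices are
less than `N`, in barycentric coordinates. -/
def polytope (N : ℕ) (L : List ℕ) : Set (ℕ → ℝ) :=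
  {x | (∀ i, 0 ≤ x i) ∧ ∑ i ∈ range N, x i = 1 ∧ ∃ t ∈ L, SupportedOn x t}

/-- The least value of `x` on the list. -/
def minOn : List ℕ → (ℕ → ℝ) → ℝ
  | [], _ => 0
  | [a], x => x a
  | a :: b :: l, x => min (x a) (minOn (b :: l) x)

theorem continuous_minOn (σ : List ℕ) : Continuous (minOn σ) := by
  induction σ with
  | nil => exact continuous_const
  | cons a l ih =>
    cases l with
    | nil => exact continuous_apply a
    | cons b l => exact (continuous_apply a).min ih

theorem minOn_le {σ : List ℕ} (x : ℕ → ℝ) {i : ℕ} (hi : i ∈ σ) : minOn σ x ≤ x i := by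
  induction σ with
  | nil => simp at hi
  | cons a l ih =>
    cases l with
    | nil => simp at hi; simp [minOn, hi]
    | cons b l =>
      rcases List.mem_cons.mp hi with rfl | h
      · exact min_le_left _ _
      · exact (min_le_right _ _).trans (ih h)

theorem exists_minOn_eq {σ : List ℕ} (hσ : σ ≠ []) (x : ℕ → ℝ) : ∃ i ∈ σ, x i = minOn σ x := by
  induction σ with
  | nil => simp at hσ
  | cons a l ih =>
    cases l with
    | nil => exact ⟨a, by simp, rfl⟩
    | cons b l =>
      obtain ⟨i, hi, h⟩ := ih (by simp)
      rcases le_total (x a) (minOn (b :: l) x) with h' | h'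
      · exact ⟨a, by simp, (min_eq_left h').symm⟩
      · exact ⟨i, List.mem_cons_of_mem _ hi, h.trans (min_eq_right h').symm⟩

theorem minOn_eq {σ : List ℕ} {x : ℕ → ℝ} {m : ℝ} (h : ∀ i ∈ σ, m ≤ x i) (h' : ∃ i ∈ σ, x i = m) :
    minOn σ x = m := by
  obtain ⟨i, hi, rfl⟩ := h'
  obtain ⟨j, hj, hj'⟩ := exists_minOn_eq (List.ne_nil_of_mem hi) x
  exact le_antisymm (minOn_le x hi) (hj' ▸ h j hj)

theorem minOn_eq_zero {σ : List ℕ} {x : ℕ → ℝ} (h : ∀ i, 0 ≤ x i) (h' : ∃ i ∈ σ, x i = 0) :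
    minOn σ x = 0 := minOn_eq (fun i _ => h i) h'

/-- Move as much mass as possible from the face `σ` to the face `τ`. -/
noncomputable def push (σ τ : List ℕ) (x : ℕ → ℝ) : ℕ → ℝ := fun i =>
  x i - (if i ∈ σ then minOn σ x else 0) + (if i ∈ τ then minOn σ x * σ.length / τ.length else 0)

theorem continuous_push (σ τ : List ℕ) : Continuous (push σ τ) := by
  refine continuous_pi fun i => ?_
  have h := continuous_minOn σ
  unfold push
  refine ((continuous_apply i).sub ?_).add ?_
  · split_ifs
    · exact h
    · exact continuous_const
  · split_ifs
    · exact (h.mul continuous_const).div_const _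
    · exact continuous_const

theorem push_eq_self {σ τ : List ℕ} {x : ℕ → ℝ} (h : minOn σ x = 0) : push σ τ x = x := by
  funext i; simp [push, h]

/-- The vanishing coordinate on `τ` says that `x` has no mass to push back yet. After the push the
least value on `τ` is therefore exactly the amount deposited at each vertex of `τ`, and the reverse
push returns it. -/
theorem push_push {σ τ : List ℕ} {x : ℕ → ℝ} (hσ : σ ≠ []) (hτ : τ ≠ []) (hd : ∀ i ∈ σ, i ∉ τ)
    (hx : ∀ i, 0 ≤ x i) (h : ∃ j ∈ τ, x j = 0) : push τ σ (push σ τ x) = x := by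
  have hs : (σ.length : ℝ) ≠ 0 := by simpa using hσ
  have ht : (τ.length : ℝ) ≠ 0 := by simpa using hτ
  have hd' : ∀ i ∈ τ, i ∉ σ := fun i hi hi' => hd i hi' hi
  have key : minOn τ (push σ τ x) = minOn σ x * σ.length / τ.length := by
    apply minOn_eq
    · intro i hi
      simp only [push, hd' i hi, hi, if_true, if_false]
      linarith [hx i]
    · obtain ⟨j, hj, h0⟩ := h
      exact ⟨j, hj, by simp [push, hd' j hj, hj, h0]⟩
  funext i
  simp only [push] at key ⊢
  rw [key]
  by_cases h1 : i ∈ σ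
  · have h2 := hd i h1
    simp only [h1, h2, if_true, if_false]
    field_simp
    ring
  · by_cases h2 : i ∈ τ <;> simp [h1, h2]

theorem sum_ite_mem {l : List ℕ} (hl : l.Nodup) {N : ℕ} (h : ∀ i ∈ l, i < N) (c : ℝ) :
    ∑ i ∈ range N, (if i ∈ l then c else 0) = l.length * c := by
  have : (range N).filter (· ∈ l) = l.toFinset := by
    ext i; simp only [mem_filter, mem_range, List.mem_toFinset]
    exact ⟨fun h => h.2, fun hi => ⟨h i hi, hi⟩⟩
  rw [← Finset.sum_filter, this, Finset.sum_const, List.toFinset_card_of_nodup hl, nsmul_eq_mul]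

theorem push_nonneg {σ τ : List ℕ} {x : ℕ → ℝ} (hσ : σ ≠ []) (hx : ∀ i, 0 ≤ x i) (i : ℕ) :
    0 ≤ push σ τ x i := by
  have h0 : 0 ≤ minOn σ x := by
    obtain ⟨j, -, h⟩ := exists_minOn_eq hσ x
    exact h ▸ hx j
  unfold push
  apply add_nonneg
  · split_ifs with h
    · linarith [minOn_le x h]
    · simpa using hx i
  · split_ifs <;> positivity

theorem sum_push {N : ℕ} {σ τ : List ℕ} (x : ℕ → ℝ) (hτ : τ ≠ []) (h1 : σ.Nodup) (h2 : τ.Nodup)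
    (h3 : ∀ i ∈ σ, i < N) (h4 : ∀ i ∈ τ, i < N) :
    ∑ i ∈ range N, push σ τ x i = ∑ i ∈ range N, x i := by
  have ht : (τ.length : ℝ) ≠ 0 := by simpa using hτ
  simp only [push]
  rw [Finset.sum_add_distrib, Finset.sum_sub_distrib, sum_ite_mem h1 h3, sum_ite_mem h2 h4]
  field_simp
  ring

/-- An admissible exchange does not change the homeomorphism type. -/
theorem exists_homeomorph_exchange {N : ℕ} {B σ τ L : List ℕ} (h : exchangeable N B σ τ L = true) :
    ∃ f : polytope N L ≃ₜ polytope N (exchange σ τ L),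
      ∀ x : polytope N L, (∃ t ∈ B, SupportedOn x.1 t) → (f x).1 = x.1 := by
  simp only [exchangeable, Bool.and_eq_true, decide_eq_true_eq, Bool.not_eq_true', List.all_eq_true,
    List.isEmpty_eq_false_iff, List.contains_eq_mem, decide_eq_false_iff_not, List.any_eq_true,
    List.mem_filter] at h
  obtain ⟨⟨⟨⟨⟨⟨⟨⟨⟨h1, h2⟩, h3⟩, h4⟩, h5⟩, h6⟩, h7⟩, h8⟩, h9⟩, h10⟩ := h
  have h5' : ∀ i ∈ τ, i ∉ σ := fun i hi hi' => h5 i hi' hi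
  have missing : ∀ {l : List ℕ} {t : ℕ} {x : ℕ → ℝ}, sub (mask l) t = false → SupportedOn x t →
      ∃ i ∈ l, x i = 0 := by
    intro l t x ht hx
    by_contra hcon
    push Not at hcon
    rw [← Bool.not_eq_true, sub_mask_iff] at ht
    exact ht fun i hi => hx i (hcon i hi)
  have memEx : ∀ t', t' ∈ exchange σ τ L ↔ (t' ∈ L ∧ sub (mask σ) t' = false) ∨
      ∃ t, (t ∈ L ∧ sub (mask σ) t = true) ∧ ∃ i ∈ σ, (t ||| mask τ) ^^^ 2 ^ i = t' := by
    intro t'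
    simp [exchange, and_assoc]
  have hor : ∀ t l, (t ||| mask τ).testBit l = true ↔ t.testBit l = true ∨ l ∈ τ := by
    intro t l; simp [Nat.testBit_or, testBit_mask]
  -- No face of the old complex contains τ and no face of the new one contains σ. Hence both
  -- composites of the two pushes are covered by `push_push`.
  have zeroτ : ∀ x ∈ polytope N L, ∃ j ∈ τ, x j = 0 := by
    rintro x ⟨-, -, t, ht, hx⟩
    exact missing (h8 t ht) hx
  have zeroσ : ∀ y ∈ polytope N (exchange σ τ L), ∃ j ∈ σ, y j = 0 := by
    rintro y ⟨-, -, t', ht', hy⟩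
    rcases (memEx t').mp ht' with ⟨-, hs⟩ | ⟨t, ⟨-, hs⟩, i, hi, rfl⟩
    · exact missing hs hy
    · refine ⟨i, hi, ?_⟩
      by_contra hne
      have := (testBit_xor_two_pow ((hor t i).mpr (Or.inl (sub_mask_iff.mp hs i hi))) i).mp (hy i hne)
      exact this.2 rfl
  have fwd : ∀ x ∈ polytope N L, push σ τ x ∈ polytope N (exchange σ τ L) := by
    rintro x ⟨hx0, hx1, t, ht, hx⟩
    refine ⟨push_nonneg h3 hx0, (sum_push x h4 h1 h2 h6 h7).trans hx1, ?_⟩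
    cases hs : sub (mask σ) t
    · refine ⟨t, (memEx t).mpr (Or.inl ⟨ht, hs⟩), ?_⟩
      rwa [push_eq_self (minOn_eq_zero hx0 (missing hs hx))]
    -- The push empties a vertex i of σ where the minimum is attained, so the image lies on the new
    -- face (t ∪ τ) \ {i}.
    · obtain ⟨i, hi, him⟩ := exists_minOn_eq h3 x
      refine ⟨_, (memEx _).mpr (Or.inr ⟨t, ⟨ht, hs⟩, i, hi, rfl⟩), fun l hl => ?_⟩
      have hst := sub_mask_iff.mp hs
      rw [testBit_xor_two_pow ((hor t i).mpr (Or.inl (hst i hi))), hor]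
      refine ⟨?_, ?_⟩
      · by_contra hcon
        push Not at hcon
        have hlσ : l ∉ σ := fun h' => hcon.1 (hst l h')
        have hxl : x l = 0 := by_contra fun h' => hcon.1 (hx l h')
        exact hl (by simp [push, hlσ, hcon.2, hxl])
      · rintro rfl
        exact hl (by simp [push, hi, h5 l hi, him])
  have bwd : ∀ y ∈ polytope N (exchange σ τ L), push τ σ y ∈ polytope N L := by
    rintro y ⟨hy0, hy1, t', ht', hy⟩
    refine ⟨push_nonneg h4 hy0, (sum_push y h3 h2 h1 h7 h6).trans hy1, ?_⟩
    rcases (memEx t').mp ht' with ⟨htL, hs⟩ | ⟨t, ⟨htL, hs⟩, i, hi, rfl⟩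
    · refine ⟨t', htL, ?_⟩
      rwa [push_eq_self (minOn_eq_zero hy0 (missing (h8 t' htL) hy))]
    -- Conversely a vertex j of τ is emptied. That (t ∪ τ) \ {j} is an old face is the last
    -- condition of `exchangeable`; it says that the link of σ has the form ∂τ * M.
    · obtain ⟨j, hj, hjm⟩ := exists_minOn_eq h4 y
      obtain ⟨q, ⟨hqL, -⟩, hq⟩ := h10 t ⟨htL, hs⟩ j hj
      refine ⟨q, hqL, fun l hl => sub_iff.mp hq l ?_⟩
      have hst := sub_mask_iff.mp hs
      rw [testBit_xor_two_pow ((hor t j).mpr (Or.inr hj)), hor]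
      refine ⟨?_, ?_⟩
      · by_contra hcon
        push Not at hcon
        have hlσ : l ∉ σ := fun h' => hcon.1 (hst l h')
        have hyl : y l = 0 := by
          by_contra h'
          have := (testBit_xor_two_pow ((hor t i).mpr (Or.inl (hst i hi))) l).mp (hy l h')
          rcases (hor t l).mp this.1 with h'' | h''
          · exact hcon.1 h''
          · exact hcon.2 h''
        exact hl (by simp [push, hlσ, hcon.2, hyl])
      · rintro rfl
        exact hl (by simp [push, hj, h5' l hj, hjm])
  refine ⟨⟨⟨fun x => ⟨push σ τ x.1, fwd x.1 x.2⟩, fun y => ⟨push τ σ y.1, bwd y.1 y.2⟩,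
      fun x => Subtype.ext ?_, fun y => Subtype.ext ?_⟩, ?_, ?_⟩, ?_⟩
  · exact push_push h3 h4 h5 x.2.1 (zeroτ x.1 x.2)
  · exact push_push h4 h3 h5' y.2.1 (zeroσ y.1 y.2)
  · exact ((continuous_push σ τ).comp continuous_subtype_val).subtype_mk _
  · exact ((continuous_push τ σ).comp continuous_subtype_val).subtype_mk _
  · rintro x ⟨t, ht, hx⟩
    exact push_eq_self (minOn_eq_zero x.2.1 (missing (h9 t ht) hx))

theorem polytope_subset {N : ℕ} {L K : List ℕ} (h : ∀ t ∈ L, ∃ s ∈ K, sub t s = true) :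
    polytope N L ⊆ polytope N K := by
  rintro x ⟨hx0, hx1, t, ht, hx⟩
  obtain ⟨s, hs, hts⟩ := h t ht
  exact ⟨hx0, hx1, s, hs, fun i hi => sub_iff.mp hts i (hx i hi)⟩

/-- The faces in `B` are tracked because the homeomorphism of the disc with the cone has to be the
identity on the boundary; only then is it compatible with the gluing. -/
theorem exists_homeomorph_of_deforms {N : ℕ} {B K : List ℕ} (ms : List (List ℕ × List ℕ)) :
    ∀ {L : List ℕ}, deforms N B K ms L = true →
      ∃ f : polytope N L ≃ₜ polytope N K,
        ∀ x : polytope N L, (∃ t ∈ B, SupportedOn x.1 t) → (f x).1 = x.1 := by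
  induction ms with
  | nil =>
    intro L h
    simp only [deforms, Bool.and_eq_true, List.all_eq_true, List.any_eq_true] at h
    exact ⟨Homeomorph.setCongr ((polytope_subset h.1).antisymm (polytope_subset h.2)),
      fun _ _ => rfl⟩
  | cons m ms ih =>
    obtain ⟨σ, τ⟩ := m
    intro L h
    rw [deforms, Bool.and_eq_true] at h
    obtain ⟨f, hf⟩ := exists_homeomorph_exchange h.1
    obtain ⟨g, hg⟩ := ih h.2
    refine ⟨f.trans g, fun x ⟨t, ht, hx⟩ => ?_⟩
    have h1 := hf x ⟨t, ht, hx⟩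
    exact (hg (f x) ⟨t, ht, by rwa [h1]⟩).trans h1

end FacetList

/-! ### The round disc as the cone over a subdivided circle -/

namespace FacetList

/-- The facets of the cone with apex `n` over the cycle `0, 1, …, n - 1`. -/
def coneFacets (n : ℕ) : List ℕ := (List.range n).map fun k => mask [k, (k + 1) % n, n]

/-- The point at the position `θ` of the unit circle, whose total length is taken to be `n`. -/
noncomputable def circlePoint (n : ℕ) (θ : ℝ) : ℂ := Complex.exp (2 * Real.pi * Complex.I * (θ / n))

theorem norm_circlePoint (n : ℕ) (θ : ℝ) : ‖circlePoint n θ‖ = 1 := by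
  have : (2 * Real.pi * Complex.I * (θ / n) : ℂ) = ((2 * Real.pi * (θ / n) : ℝ) : ℂ) * Complex.I := by
    push_cast; ring
  rw [circlePoint, this, Complex.norm_exp_ofReal_mul_I]

theorem re_circlePoint_mul_conj (n : ℕ) (θ η : ℝ) :
    (circlePoint n θ * (starRingEnd ℂ) (circlePoint n η)).re =
      Real.cos (2 * Real.pi * ((θ - η) / n)) := by
  have h : ∀ a : ℝ, (2 * Real.pi * Complex.I * (a / n) : ℂ) =
      ((2 * Real.pi * (a / n) : ℝ) : ℂ) * Complex.I := by intro a; push_cast; ring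
  rw [circlePoint, circlePoint, h, h, ← Complex.exp_conj, map_mul, Complex.conj_I,
    Complex.conj_ofReal, ← Complex.exp_add]
  have : ((2 * Real.pi * (θ / n) : ℝ) : ℂ) * Complex.I + ((2 * Real.pi * (η / n) : ℝ) : ℂ) * -Complex.I
      = ((2 * Real.pi * ((θ - η) / n) : ℝ) : ℂ) * Complex.I := by push_cast; ring
  rw [this, Complex.exp_ofReal_mul_I_re]

/-- The barycentric coordinates of a point of the unit disc, considered as the cone over a
subdivided circle. -/
noncomputable def coneCoord (n : ℕ) (z : ℂ) : ℕ → ℝ := fun i =>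
  if i < n then ‖z‖ * max 0 (1 - n / (2 * Real.pi) *
    Real.arccos ((z * (starRingEnd ℂ) (circlePoint n i)).re / ‖z‖))
  else if i = n then 1 - ‖z‖ else 0

theorem continuous_coneCoord (n : ℕ) : Continuous (coneCoord n) := by
  refine continuous_pi fun i => ?_
  unfold coneCoord
  split_ifs with h1 h2
  · rw [continuous_iff_continuousAt]
    intro z
    by_cases hz : z = 0
    · subst hz
      rw [ContinuousAt, norm_zero, zero_mul]
      refine squeeze_zero (fun z => by positivity) (g := fun z => ‖z‖) (fun z => ?_) ?_
      · refine mul_le_of_le_one_right (norm_nonneg _) (max_le zero_le_one ?_)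
        have := Real.arccos_nonneg ((z * (starRingEnd ℂ) (circlePoint n i)).re / ‖z‖)
        have : 0 ≤ n / (2 * Real.pi) * Real.arccos ((z * (starRingEnd ℂ) (circlePoint n i)).re / ‖z‖) := by
          positivity
        linarith
      · simpa using (continuous_norm (E := ℂ)).tendsto 0
    · have hn : ‖z‖ ≠ 0 := by simpa using hz
      have h0 : ContinuousAt (fun z : ℂ => (z * (starRingEnd ℂ) (circlePoint n i)).re / ‖z‖) z :=
        (by fun_prop : Continuous fun z : ℂ => (z * (starRingEnd ℂ) (circlePoint n i)).re).continuousAt.div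
          continuous_norm.continuousAt hn
      have h3 := Real.continuous_arccos.continuousAt.comp (f := fun z : ℂ =>
        (z * (starRingEnd ℂ) (circlePoint n i)).re / ‖z‖) h0
      exact continuous_norm.continuousAt.mul
        (continuousAt_const.max (continuousAt_const.sub (continuousAt_const.mul h3)))
  · fun_prop
  · fun_prop

/-- The point of the boundary cycle of the cone with weights `1 - s` and `s` at `k` and `k + 1`. -/
noncomputable def edgePoint (n k : ℕ) (s : ℝ) : ℕ → ℝ := fun i =>
  (if i = k then 1 - s else 0) + (if i = (k + 1) % n then s else 0)

/-- A division point at least one arc away in both directions has angular distance at least 2π/n. So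
the hat function of that point in `coneCoord` vanishes. -/
theorem arccos_cos_ge {n : ℕ} (hn : 2 ≤ n) {δ : ℝ} (h1 : 1 ≤ δ) (h2 : δ ≤ n - 1) :
    2 * Real.pi / n ≤ Real.arccos (Real.cos (2 * Real.pi * (δ / n))) := by
  have hpi := Real.pi_pos
  have hn' : (2 : ℝ) ≤ n := by exact_mod_cast hn
  have hn0 : (0 : ℝ) < n := by linarith
  rcases le_total δ (n / 2) with h | h
  · rw [Real.arccos_cos (by positivity)]
    · rw [div_eq_mul_inv, div_eq_mul_inv δ]
      have : (n : ℝ)⁻¹ ≤ δ * (n : ℝ)⁻¹ := le_mul_of_one_le_left (by positivity) h1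
      nlinarith
    · have : δ / n ≤ 1 / 2 := by rw [div_le_iff₀ hn0]; linarith
      nlinarith
  · have e : Real.cos (2 * Real.pi * (δ / n)) = Real.cos (2 * Real.pi * ((n - δ) / n)) := by
      rw [← Real.cos_two_pi_sub]; congr 1; field_simp
    have h3 : (1 : ℝ) ≤ n - δ := by linarith
    rw [e, Real.arccos_cos (by have : 0 ≤ (n - δ) / n := by positivity
                               positivity)]
    · rw [div_eq_mul_inv, div_eq_mul_inv (_ - δ)]
      have : (n : ℝ)⁻¹ ≤ (n - δ) * (n : ℝ)⁻¹ := le_mul_of_one_le_left (by positivity) h3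
      nlinarith
    · have : (n - δ) / n ≤ 1 / 2 := by rw [div_le_iff₀ hn0]; linarith
      nlinarith

theorem arccos_cos_eq {n : ℕ} (hn : 2 ≤ n) {δ : ℝ} (h1 : 0 ≤ δ) (h2 : δ ≤ 1) :
    n / (2 * Real.pi) * Real.arccos (Real.cos (2 * Real.pi * (δ / n))) = δ := by
  have hpi := Real.pi_pos
  have hn' : (2 : ℝ) ≤ n := by exact_mod_cast hn
  have hn0 : (0 : ℝ) < n := by linarith
  rw [Real.arccos_cos (by positivity)]
  · field_simp
  · have : δ / n ≤ 1 / 2 := by rw [div_le_iff₀ hn0]; linarith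
    nlinarith

/-- The hat functions are piecewise linear in the angle, with the arc length 2π/n as unit. On the
arc from k to k + 1 only the hats of its two ends are nonzero, and they are 1 - s and s; the radius
scales them and the apex receives the rest. -/
theorem coneCoord_circlePoint {n : ℕ} (hn : 3 ≤ n) {k : ℕ} (hk : k < n) {r s : ℝ} (hr : 0 ≤ r)
    (hs0 : 0 ≤ s) (hs1 : s ≤ 1) :
    coneCoord n (r * circlePoint n (k + s)) =
      fun i => if i = n then 1 - r else r * edgePoint n k s i := by
  have hpi := Real.pi_pos
  have hn0 : (n : ℝ) ≠ 0 := by positivity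
  have hnorm : ‖(r : ℂ) * circlePoint n (k + s)‖ = r := by
    rw [norm_mul, norm_circlePoint, mul_one, Complex.norm_real, Real.norm_of_nonneg hr]
  have hmod : (k + 1) % n < n := Nat.mod_lt _ (by omega)
  have hkne : (k + 1) % n ≠ k := by
    rcases Nat.lt_or_ge (k + 1) n with h | h
    · rw [Nat.mod_eq_of_lt h]; omega
    · have : k + 1 = n := by omega
      rw [this, Nat.mod_self]; omega
  funext i
  rw [coneCoord, hnorm]
  by_cases hin : i < n
  swap
  · rw [if_neg hin]
    by_cases h : i = n
    · simp [h]
    · rw [if_neg h, if_neg h, edgePoint, if_neg (by omega), if_neg (by omega)]; simp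
  rw [if_pos hin, if_neg (by omega)]
  rcases hr.eq_or_lt with rfl | hr
  · simp
  congr 1
  have e1 : ((r : ℂ) * circlePoint n (k + s) * (starRingEnd ℂ) (circlePoint n i)).re / r =
      Real.cos (2 * Real.pi * ((k + s - i) / n)) := by
    rw [mul_assoc, Complex.re_ofReal_mul, mul_div_cancel_left₀ _ hr.ne', ← re_circlePoint_mul_conj]
  rw [e1, edgePoint]
  by_cases h1 : i = k
  · subst h1
    rw [if_pos rfl, if_neg hkne.symm, show (i + s - i : ℝ) = s by ring, arccos_cos_eq (by omega) hs0 hs1,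
      max_eq_right (by linarith), add_zero]
  rw [if_neg h1]
  have vanish : ∀ δ : ℝ, 1 ≤ δ → δ ≤ n - 1 → max 0 (1 - n / (2 * Real.pi) *
      Real.arccos (Real.cos (2 * Real.pi * (δ / n)))) = 0 := by
    intro δ hδ1 hδ2
    have := arccos_cos_ge (by omega : 2 ≤ n) hδ1 hδ2
    apply max_eq_left
    have h2 : n / (2 * Real.pi) * (2 * Real.pi / n) = 1 := by field_simp
    have h3 : n / (2 * Real.pi) * (2 * Real.pi / n) ≤ n / (2 * Real.pi) *
      Real.arccos (Real.cos (2 * Real.pi * (δ / n))) := by gcongr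
    linarith
  by_cases h2 : i = (k + 1) % n
  · rw [if_pos h2, zero_add]
    have e2 : Real.cos (2 * Real.pi * ((k + s - i) / n)) = Real.cos (2 * Real.pi * ((1 - s) / n)) := by
      rcases Nat.lt_or_ge (k + 1) n with h | h
      · rw [Nat.mod_eq_of_lt h] at h2
        rw [← Real.cos_neg]; congr 1; rw [h2]; push_cast; ring
      · have hkn : k + 1 = n := by omega
        rw [hkn, Nat.mod_self] at h2
        have : (k : ℝ) = n - 1 := by rw [← hkn]; push_cast; ring
        rw [← Real.cos_two_pi_sub]; congr 1; rw [h2, this]; push_cast; field_simp; ring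
    rw [e2, arccos_cos_eq (by omega) (by linarith) (by linarith), max_eq_right (by linarith)]
    ring
  · rw [if_neg h2, add_zero]
    rcases Nat.lt_or_ge i k with h | h
    · apply vanish
      · have : (i : ℝ) + 1 ≤ k := by exact_mod_cast h
        linarith
      · have h4 : k + 2 ≤ n + i := by
          by_contra hcon
          have : i = 0 ∧ k + 1 = n := by omega
          apply h2; rw [this.2, Nat.mod_self]; exact this.1
        have : (k : ℝ) + 2 ≤ n + i := by exact_mod_cast h4
        linarith
    · have hlt : k + 1 < n := by omega
      rw [Nat.mod_eq_of_lt hlt] at h2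
      rw [← Real.cos_neg, show -(2 * Real.pi * ((k + s - i) / n)) = 2 * Real.pi * ((i - k - s) / n) by ring]
      apply vanish
      · have : (k : ℝ) + 2 ≤ i := by exact_mod_cast (by omega : k + 2 ≤ i)
        linarith
      · have : (i : ℝ) + 1 ≤ n := by exact_mod_cast hin
        have : (0 : ℝ) ≤ k := by positivity
        linarith

theorem exists_eq_circlePoint {n : ℕ} (hn : 0 < n) (z : ℂ) :
    ∃ k < n, ∃ s : ℝ, 0 ≤ s ∧ s < 1 ∧ z = ‖z‖ * circlePoint n (k + s) := by
  have hpi := Real.pi_pos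
  have hn0 : (0 : ℝ) < n := by exact_mod_cast hn
  obtain ⟨α, h0, h1, hz⟩ : ∃ α : ℝ, 0 ≤ α ∧ α < 2 * Real.pi ∧ z = ‖z‖ * Complex.exp (α * Complex.I) := by
    have h1 := Complex.arg_le_pi z
    have h2 := Complex.neg_pi_lt_arg z
    rcases le_or_gt 0 z.arg with h | h
    · exact ⟨z.arg, h, by linarith, (Complex.norm_mul_exp_arg_mul_I z).symm⟩
    · refine ⟨z.arg + 2 * Real.pi, by linarith, by linarith, ?_⟩
      rw [show ((z.arg + 2 * Real.pi : ℝ) : ℂ) * Complex.I = z.arg * Complex.I + 2 * Real.pi * Complex.I by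
        push_cast; ring, Complex.exp_add, Complex.exp_two_pi_mul_I, mul_one]
      exact (Complex.norm_mul_exp_arg_mul_I z).symm
  set θ : ℝ := n * α / (2 * Real.pi) with hθ
  have hθ0 : 0 ≤ θ := by positivity
  have hθn : θ < n := by
    rw [hθ, div_lt_iff₀ (by positivity)]
    nlinarith
  refine ⟨⌊θ⌋₊, (Nat.floor_lt hθ0).mpr hθn, θ - ⌊θ⌋₊, ?_, ?_, ?_⟩
  · linarith [Nat.floor_le hθ0]
  · linarith [Nat.lt_floor_add_one θ]
  · rw [add_sub_cancel, circlePoint, hθ]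
    conv_lhs => rw [hz]
    congr 2
    push_cast
    have : (n : ℂ) ≠ 0 := by exact_mod_cast hn.ne'
    have : (Real.pi : ℂ) ≠ 0 := by exact_mod_cast hpi.ne'
    field_simp

theorem edgePoint_nonneg {n k : ℕ} {s : ℝ} (hs0 : 0 ≤ s) (hs1 : s ≤ 1) (i : ℕ) :
    0 ≤ edgePoint n k s i := by
  unfold edgePoint
  split_ifs <;> linarith

theorem sum_edgePoint {n k N : ℕ} (hk : k < n) (hN : n ≤ N) (s : ℝ) :
    ∑ i ∈ range N, edgePoint n k s i = 1 := by
  have : (k + 1) % n < N := (Nat.mod_lt _ (by omega)).trans_le hN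
  simp only [edgePoint]
  rw [Finset.sum_add_distrib, Finset.sum_ite_eq', Finset.sum_ite_eq', if_pos (by simp; omega),
    if_pos (by simpa using this)]
  ring

theorem coneCoord_mem_polytope {n N : ℕ} (hn : 3 ≤ n) (hN : n < N) {z : ℂ} (hz : ‖z‖ ≤ 1) :
    coneCoord n z ∈ polytope N (coneFacets n) := by
  obtain ⟨k, hk, s, hs0, hs1, h⟩ := exists_eq_circlePoint (by omega : 0 < n) z
  have hmod : (k + 1) % n < n := Nat.mod_lt _ (by omega)
  rw [h, coneCoord_circlePoint hn hk (norm_nonneg z) hs0 hs1.le]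
  refine ⟨fun i => ?_, ?_, mask [k, (k + 1) % n, n], ?_, fun i hi => ?_⟩
  · beta_reduce
    split_ifs
    · linarith
    · exact mul_nonneg (norm_nonneg _) (edgePoint_nonneg hs0 hs1.le i)
  · have e : ∀ i, (if i = n then 1 - ‖z‖ else ‖z‖ * edgePoint n k s i) =
        (if i = n then 1 - ‖z‖ else 0) + ‖z‖ * edgePoint n k s i := by
      intro i
      split_ifs with h'
      · rw [edgePoint, if_neg (by omega), if_neg (by omega)]; simp
      · simp
    rw [Finset.sum_congr rfl fun i _ => e i, Finset.sum_add_distrib, ← Finset.mul_sum,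
      sum_edgePoint hk hN.le, Finset.sum_ite_eq', if_pos (by simpa using hN)]
    ring
  · exact List.mem_map_of_mem (List.mem_range.mpr hk)
  · rw [testBit_mask, decide_eq_true_eq]
    by_contra hcon
    simp only [List.mem_cons, List.not_mem_nil, or_false, not_or] at hcon
    exact hi (by simp [edgePoint, hcon])

/-- The unit disc is homeomorphic to the cone over a cycle. -/
theorem exists_homeomorph_cone {n N : ℕ} (hn : 3 ≤ n) (hN : n < N) :
    ∃ f : UnitDisc ≃ₜ polytope N (coneFacets n), ∀ z, (f z).1 = coneCoord n z.1 := by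
  have hmem : ∀ z : UnitDisc, ‖z.1‖ ≤ 1 := fun z => mem_closedBall_zero_iff.mp z.2
  let f : UnitDisc → polytope N (coneFacets n) := fun z =>
    ⟨coneCoord n z.1, coneCoord_mem_polytope hn hN (hmem z)⟩
  have hf : Continuous f := ((continuous_coneCoord n).comp continuous_subtype_val).subtype_mk _
  have hinj : Function.Injective f := by
    intro z w h
    have h := congrArg Subtype.val h
    simp only [f] at h
    obtain ⟨k, hk, s, hs0, hs1, hz⟩ := exists_eq_circlePoint (by omega : 0 < n) z.1
    obtain ⟨l, hl, t, ht0, ht1, hw⟩ := exists_eq_circlePoint (by omega : 0 < n) w.1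
    rw [hz, hw, coneCoord_circlePoint hn hk (norm_nonneg _) hs0 hs1.le,
      coneCoord_circlePoint hn hl (norm_nonneg _) ht0 ht1.le] at h
    have hr : ‖z.1‖ = ‖w.1‖ := by
      have := congrFun h n
      simp only [if_true] at this
      linarith
    apply Subtype.ext
    rcases (norm_nonneg z.1).eq_or_lt with h0 | h0
    · have h1 : z.1 = 0 := norm_eq_zero.mp h0.symm
      have h2 : w.1 = 0 := norm_eq_zero.mp (hr ▸ h0.symm)
      rw [h1, h2]
    have hE : ∀ i < n, edgePoint n k s i = edgePoint n l t i := by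
      intro i hi
      have := congrFun h i
      simp only [if_neg hi.ne, hr] at this
      exact mul_left_cancel₀ (hr ▸ h0.ne') this
    -- As s and t are less than 1, the weights at k and at l are positive. If k ≠ l, each of the two
    -- would be the cyclic successor of the other, which is impossible for n ≥ 3.
    have hkl : k = l := by
      by_contra hne
      have ne1 : (k + 1) % n ≠ k := by
        rcases Nat.lt_or_ge (k + 1) n with h | h
        · rw [Nat.mod_eq_of_lt h]; omega
        · rw [show k + 1 = n by omega, Nat.mod_self]; omega
      have ne2 : (l + 1) % n ≠ l := by
        rcases Nat.lt_or_ge (l + 1) n with h | h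
        · rw [Nat.mod_eq_of_lt h]; omega
        · rw [show l + 1 = n by omega, Nat.mod_self]; omega
      have h1 := hE k hk
      have h2 := hE l hl
      simp only [edgePoint, if_true, if_neg hne, if_neg (Ne.symm hne), if_neg ne1.symm, if_neg ne2.symm] at h1 h2
      have h3 : k = (l + 1) % n := by
        by_contra h'
        rw [if_neg h'] at h1; linarith
      have h4 : l = (k + 1) % n := by
        by_contra h'
        rw [if_neg h'] at h2; linarith
      rcases Nat.lt_or_ge (k + 1) n with h | h
      · rw [Nat.mod_eq_of_lt h] at h4
        rcases Nat.lt_or_ge (l + 1) n with h' | h'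
        · rw [Nat.mod_eq_of_lt h'] at h3; omega
        · rw [show l + 1 = n by omega, Nat.mod_self] at h3; omega
      · rw [show k + 1 = n by omega, Nat.mod_self] at h4
        rw [h4, Nat.mod_eq_of_lt (by omega)] at h3; omega
    subst hkl
    have hst : s = t := by
      have h1 := hE k hk
      have ne1 : (k + 1) % n ≠ k := by
        rcases Nat.lt_or_ge (k + 1) n with h | h
        · rw [Nat.mod_eq_of_lt h]; omega
        · rw [show k + 1 = n by omega, Nat.mod_self]; omega
      simp only [edgePoint, if_true, if_neg ne1.symm] at h1
      linarith
    rw [hz, hw, hr, hst]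
  have hsurj : Function.Surjective f := by
    rintro ⟨x, hx0, hx1, t, ht, hx⟩
    obtain ⟨k, hk, rfl⟩ := List.mem_map.mp ht
    rw [List.mem_range] at hk
    have hmod : (k + 1) % n < n := Nat.mod_lt _ (by omega)
    have ne1 : (k + 1) % n ≠ k := by
      rcases Nat.lt_or_ge (k + 1) n with h | h
      · rw [Nat.mod_eq_of_lt h]; omega
      · rw [show k + 1 = n by omega, Nat.mod_self]; omega
    have hz : ∀ i, i ≠ k → i ≠ (k + 1) % n → i ≠ n → x i = 0 := by
      intro i h1 h2 h3
      by_contra h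
      have := hx i h
      rw [testBit_mask, decide_eq_true_eq] at this
      simp [h1, h2, h3] at this
    have hsum : x k + x ((k + 1) % n) + x n = 1 := by
      rw [← hx1, ← Finset.sum_subset (s₁ := {k, (k + 1) % n, n})]
      · rw [Finset.sum_insert, Finset.sum_insert, Finset.sum_singleton, add_assoc]
        · simp; omega
        · simp; omega
      · intro i; simp; omega
      · intro i _ hi
        simp only [Finset.mem_insert, Finset.mem_singleton, not_or] at hi
        exact hz i hi.1 hi.2.1 hi.2.2
    -- The mass outside the apex is the radius, and the share of the second end is the position on
    -- the arc. For r = 0 the quotient takes the default value 0 and the point is the centre.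
    set r := x k + x ((k + 1) % n) with hr
    have hr0 : 0 ≤ r := add_nonneg (hx0 _) (hx0 _)
    have hr1 : r ≤ 1 := by linarith [hx0 n]
    have hs1 : x ((k + 1) % n) / r ≤ 1 := div_le_one_of_le₀ (by linarith [hx0 k]) hr0
    have hs0 : 0 ≤ x ((k + 1) % n) / r := div_nonneg (hx0 _) hr0
    refine ⟨⟨r * circlePoint n (k + x ((k + 1) % n) / r), ?_⟩, Subtype.ext ?_⟩
    · rw [mem_closedBall_zero_iff, norm_mul, norm_circlePoint, mul_one, Complex.norm_real,
        Real.norm_of_nonneg hr0]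
      exact hr1
    · simp only [f]
      rw [coneCoord_circlePoint hn hk hr0 hs0 hs1]
      funext i
      rcases hr0.eq_or_lt with h0 | h0
      · have hk0 : x k = 0 := by linarith [hx0 k, hx0 ((k + 1) % n)]
        have hk1 : x ((k + 1) % n) = 0 := by linarith [hx0 k, hx0 ((k + 1) % n)]
        by_cases h3 : i = n
        · rw [if_pos h3, h3]; linarith
        · rw [if_neg h3, ← h0, zero_mul]
          by_cases h1 : i = k
          · rw [h1, hk0]
          by_cases h2 : i = (k + 1) % n
          · rw [h2, hk1]
          · rw [hz i h1 h2 h3]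
      · by_cases h3 : i = n
        · rw [if_pos h3, h3]; linarith
        rw [if_neg h3, edgePoint]
        by_cases h1 : i = k
        · rw [if_pos h1, h1, if_neg ne1.symm]; field_simp; linarith
        by_cases h2 : i = (k + 1) % n
        · rw [if_neg h1, if_pos h2, h2]; field_simp; linarith
        · rw [if_neg h1, if_neg h2, hz i h1 h2 h3]; simp
  have : CompactSpace UnitDisc := isCompact_iff_compactSpace.mp (isCompact_closedBall _ _)
  exact ⟨Continuous.homeoOfEquivCompactToT2 (f := Equiv.ofBijective f ⟨hinj, hsurj⟩) hf, fun z => rfl⟩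

end FacetList

/-! ### The triangulation, the cut-open disc and the certificates -/

namespace FacetList

/-- The triangles of a triangulation of `N_6` with ten vertices. -/
def triangles : List (List ℕ) :=
  [[0, 1, 6], [0, 1, 7], [0, 2, 5], [0, 2, 6], [0, 3, 5], [0, 3, 8], [0, 4, 8], [0, 4, 9], [0, 7,
   9], [1, 2, 4], [1, 2, 9], [1, 3, 4], [1, 3, 7], [1, 5, 8], [1, 5, 9], [1, 6, 8], [2, 4, 7],
   [2, 5, 8], [2, 6, 9], [2, 7, 8], [3, 4, 9], [3, 5, 6], [3, 6, 9], [3, 7, 8], [4, 5, 6], [4, 5,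
   7], [4, 6, 8], [5, 7, 9]]

/-- Exchanges that lead from `triangles` to a triangulation that contains six one-sided cycles of
length four which have a vertex in common and cut the surface into a disc. -/
def surfaceMoves : List (List ℕ × List ℕ) :=
  [([0, 3], [10]), ([1, 8], [11]), ([4, 6], [12]), ([4, 8], [13]), ([7, 8], [14]), ([3, 8],
   [15]), ([3, 10], [16]), ([6, 12], [17]), ([3, 4], [18]), ([4, 12], [19]), ([3, 16], [20]),
   ([8, 12], [21]), ([1, 6], [22]), ([0, 8], [23]), ([8, 15], [24]), ([1, 9], [25]), ([2, 8],
   [26]), ([10, 15], [27]), ([6, 8], [28]), ([3, 9], [29]), ([3, 15], [30]), ([8, 11], [31]),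
   ([0, 1], [32]), ([2, 4], [33]), ([1, 2], [34]), ([0, 4], [35]), ([0, 10], [36]), ([8, 14],
   [37]), ([1, 11], [38]), ([3, 14], [39]), ([4, 13], [40]), ([0, 9], [41]), ([1, 4], [42]), ([0,
   6], [43]), ([8, 13], [44]), ([2, 9], [45]), ([10, 16], [46]), ([2, 6], [47]), ([6, 9], [48]),
   ([1, 33], [49]), ([1, 42], [50]), ([9, 48], [51]), ([9, 25], [52]), ([4, 19], [53]), ([4, 35],
   [54]), ([9, 35], [55]), ([9, 41], [56]), ([2, 33], [57]), ([2, 34], [58]), ([2, 25], [59]),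
   ([2, 45], [60]), ([0, 7], [61]), ([13, 40], [62]), ([4, 53], [5, 40]), ([53], [5, 19, 40]),
   ([1, 50], [18, 49]), ([50], [18, 42, 49]), ([41, 56], [7, 55]), ([56], [7, 9, 55]), ([9, 51],
   [29, 45]), ([51], [29, 45, 48]), ([48], [6, 29, 45]), ([0, 61], [32, 41]), ([61], [7, 32,
   41]), ([2, 60], [47, 59]), ([60], [45, 47, 59]), ([9, 52], [5, 45]), ([52], [5, 25, 45]),
   ([13, 62], [19, 35]), ([62], [19, 35, 40]), ([5, 31], [8, 11]), ([31], [8, 11, 28]), ([17,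
   28], [6, 8]), ([28], [6, 8, 11]), ([27, 46], [10, 16]), ([46], [5, 10, 16]), ([8, 44], [21,
   23]), ([44], [13, 21, 23]), ([5, 38], [1, 11]), ([38], [1, 11, 22]), ([15, 27], [16, 24]),
   ([27], [10, 16, 24]), ([5, 36], [0, 10]), ([36], [0, 10, 23]), ([14, 37], [24, 26]), ([37],
   [8, 24, 26]), ([14, 39], [7, 30]), ([39], [3, 7, 30]), ([4, 42], [18, 33]), ([42], [18, 33,
   49]), ([1, 49], [18, 34]), ([49], [18, 33, 34]), ([10, 16], [5, 24]), ([16, 24], [5, 15]),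
   ([16], [5, 15, 20]), ([3, 20], [5, 30]), ([20], [5, 15, 30]), ([15, 24], [5, 14]), ([15], [5,
   14, 30]), ([5, 30], [3, 14]), ([30], [3, 7, 14]), ([7, 41], [32, 55]), ([41, 55], [32, 35]),
   ([41], [0, 32, 35]), ([33, 57], [7, 34]), ([34, 57], [7, 58]), ([57], [2, 7, 58]), ([33, 34],
   [7, 18]), ([33], [4, 7, 18]), ([12, 21], [13, 17]), ([12, 17], [5, 13]), ([12], [5, 13, 19]),
   ([13, 19], [5, 35]), ([19], [5, 35, 40]), ([35, 40], [5, 54]), ([40], [4, 5, 54]), ([21, 23],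
   [8, 13]), ([21], [8, 13, 17]), ([8, 23], [10, 13]), ([23], [0, 10, 13]), ([5, 17], [6, 13]),
   ([17], [6, 8, 13]), ([25, 59], [45, 58]), ([45, 59], [47, 58]), ([59], [2, 47, 58]), ([1, 25],
   [5, 34]), ([25, 58], [34, 45]), ([25], [5, 34, 45]), ([9, 29], [18, 45]), ([6, 29], [3, 45]),
   ([29], [3, 18, 45]), ([45, 58], [34, 47]), ([34, 58], [7, 47]), ([58], [2, 7, 47]), ([6, 43],
   [22, 47]), ([0, 43], [2, 22]), ([43], [2, 22, 47]), ([35, 55], [32, 54]), ([32, 55], [7, 54]),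
   ([55], [7, 9, 54]), ([0, 35], [13, 32]), ([13, 35], [5, 32]), ([35], [5, 32, 54]), ([2, 47],
   [7, 22]), ([34, 47], [7, 45]), ([45, 47], [6, 7]), ([47], [6, 7, 22]), ([0, 22], [2, 32]),
   ([0, 32], [2, 13]), ([0, 5], [2, 10]), ([0], [2, 10, 13]), ([1, 7], [3, 32]), ([11, 22], [1,
   6]), ([1, 22], [6, 32]), ([5, 26], [2, 8]), ([7, 32], [3, 54]), ([6, 22], [7, 32]), ([22], [2,
   7, 32]), ([1, 34], [5, 18]), ([6, 8], [11, 13]), ([8, 24], [10, 26]), ([14, 24], [5, 26]),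
   ([1, 6], [11, 32]), ([10, 26], [8, 24]), ([3, 7], [14, 54]), ([3, 32], [1, 54]), ([6, 45], [3,
   7]), ([6, 7], [3, 32]), ([6, 32], [3, 11]), ([5, 6], [3, 13]), ([6], [3, 11, 13]), ([5, 18],
   [1, 34]), ([3, 7], [32, 45]), ([3, 32], [11, 45]), ([11, 45], [3, 32]), ([9, 18], [4, 45]),
   ([11, 13], [3, 8]), ([14, 54], [3, 7]), ([8, 24], [10, 26]), ([3, 8], [11, 13]), ([2, 26], [8,
   14]), ([3, 32], [11, 45]), ([8, 14], [2, 26]), ([32, 45], [7, 11]), ([3, 18], [1, 45]), ([7,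
   11], [32, 45]), ([7, 14], [2, 3]), ([5, 26], [14, 24]), ([14, 26], [2, 24]), ([7, 18], [4,
   34]), ([8, 13], [10, 11]), ([2, 24], [14, 26]), ([3, 7], [2, 54]), ([10, 26], [8, 24]), ([11,
   13], [3, 10]), ([14, 26], [2, 24]), ([7, 45], [32, 34]), ([3, 10], [11, 13]), ([2, 54], [3,
   7]), ([2, 8], [5, 26]), ([32, 45], [11, 34]), ([3, 54], [1, 7]), ([2, 7], [3, 32]), ([32, 34],
   [7, 11]), ([11, 13], [3, 10]), ([3, 32], [2, 7]), ([7, 34], [4, 11]), ([10, 11], [3, 8]), ([7,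
   11], [4, 32]), ([1, 32], [11, 54]), ([24, 26], [2, 8]), ([11, 54], [1, 32]), ([2, 8], [24,
   26]), ([2, 24], [14, 26]), ([1, 45], [3, 18]), ([1, 32], [11, 54]), ([24, 26], [8, 14]), ([3,
   18], [1, 45]), ([1, 34], [5, 18]), ([1, 45], [3, 18]), ([4, 32], [7, 11]), ([7, 11], [4, 32]),
   ([4, 11], [32, 34]), ([8, 24], [10, 14]), ([3, 10], [8, 13]), ([5, 26], [2, 8]), ([8, 13], [3,
   10]), ([2, 3], [7, 14]), ([2, 32], [7, 13]), ([7, 13], [2, 32]), ([32, 34], [4, 11]), ([5, 8],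
   [63]), ([4, 5], [64])]

/-- The disc that is left when the surface is cut open. Its boundary is the cycle `0, …, 47`. -/
def discTriangles : List (List ℕ) :=
  [[18, 45, 46], [38, 41, 42], [43, 44, 45], [38, 40, 41], [18, 19, 45], [19, 43, 45], [3, 4,
   10], [4, 5, 10], [13, 14, 18], [14, 17, 18], [6, 10, 48], [5, 6, 10], [3, 10, 11], [14, 15,
   17], [9, 10, 48], [11, 12, 46], [12, 13, 46], [13, 18, 46], [2, 3, 46], [2, 46, 47], [3, 11,
   46], [37, 42, 43], [37, 38, 42], [21, 22, 30], [22, 29, 30], [30, 31, 33], [23, 26, 27], [21,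
   30, 43], [30, 35, 43], [30, 34, 35], [30, 33, 34], [23, 25, 26], [22, 27, 28], [22, 28, 29],
   [31, 32, 33], [7, 8, 49], [0, 1, 47], [15, 16, 17], [8, 9, 49], [38, 39, 40], [19, 20, 21],
   [35, 36, 37], [23, 24, 25], [22, 23, 27], [6, 7, 9], [1, 2, 47], [6, 9, 48], [7, 9, 49], [19,
   21, 43], [35, 37, 43]]

/-- Exchanges that lead from the disc to the cone with apex `48` over its boundary. -/
def discMoves : List (List ℕ × List ℕ) :=
  [([6, 10], [5, 48]), ([5, 10], [4, 48]), ([4, 10], [3, 48]), ([3, 10], [11, 48]), ([3, 11],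
   [46, 48]), ([3, 46], [2, 48]), ([2, 46], [47, 48]), ([2, 47], [1, 48]), ([1, 47], [0, 48]),
   ([6, 9], [7, 48]), ([7, 9], [48, 49]), ([7, 49], [8, 48]), ([49], [8, 9, 48]), ([11, 46], [12,
   48]), ([12, 46], [13, 48]), ([13, 46], [18, 48]), ([13, 18], [14, 48]), ([14, 18], [17, 48]),
   ([14, 17], [15, 48]), ([15, 17], [16, 48]), ([18, 46], [45, 48]), ([18, 45], [19, 48]), ([19,
   45], [43, 48]), ([19, 43], [21, 48]), ([19, 21], [20, 48]), ([21, 43], [30, 48]), ([21, 30],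
   [22, 48]), ([22, 30], [29, 48]), ([22, 29], [28, 48]), ([22, 28], [27, 48]), ([22, 27], [23,
   48]), ([23, 27], [26, 48]), ([23, 26], [25, 48]), ([23, 25], [24, 48]), ([30, 43], [35, 48]),
   ([30, 35], [34, 48]), ([30, 34], [33, 48]), ([30, 33], [31, 48]), ([31, 33], [32, 48]), ([35,
   43], [37, 48]), ([35, 37], [36, 48]), ([37, 43], [42, 48]), ([37, 42], [38, 48]), ([38, 42],
   [41, 48]), ([38, 41], [40, 48]), ([38, 40], [39, 48]), ([43, 45], [44, 48])]

/-- The vertices of the surface that correspond to the vertices of the disc. -/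
def discLabels : List ℕ :=
  [5, 63, 8, 10, 5, 63, 8, 10, 5, 14, 2, 13, 5, 14, 2, 13, 5, 32, 7, 54, 5, 32, 7, 54, 5, 64, 4,
   9, 5, 64, 4, 9, 5, 45, 18, 34, 5, 45, 18, 34, 5, 1, 3, 11, 5, 1, 3, 11, 26, 24]

/-- The vertex of the surface that corresponds to the vertex `i` of the disc. -/
def discLabel (i : ℕ) : ℕ := discLabels.getD i 0

/-- The facets of the surface that is cut open. -/
def surfaceFacets : List ℕ := discTriangles.map fun t => mask (t.map discLabel)

/-- The boundary edges of the disc. -/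
def discBoundary : List ℕ := (List.range 48).map fun k => mask [k, (k + 1) % 48]

/-- The moves are edge subdivisions with new vertices numbered from 10, edge flips, and removals of
vertices of degree three. No point has to stay fixed, so the list of protected faces is empty. -/
theorem deforms_surfaceMoves :
    deforms 65 [] surfaceFacets surfaceMoves (triangles.map mask) = true := by decide +kernel

/-- Flips gradually enlarge the star of vertex 48 and the second interior vertex 49 is removed. The
boundary edges are protected, so the resulting homeomorphism fixes the boundary pointwise. -/
theorem deforms_discMoves :
    deforms 50 discBoundary (coneFacets 48) discMoves (discTriangles.map mask) = true := by
  decide +kernel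

theorem discTriangles_nodup : ∀ t ∈ discTriangles, t.Nodup ∧ (t.map discLabel).Nodup ∧
    ∀ i ∈ t, i < 50 := by decide +kernel

theorem discLabel_lt : ∀ i < 50, discLabel i < 65 := by decide +kernel

/-- Each side of the 12-gon has four edges. The condition `k % 8 < 4` selects edges on the first of
two equally labelled sides; the partner on the second side is four steps further. Only the partner
can end at 48 and wrap around to 0. -/
theorem discLabel_shift : ∀ k < 48, k % 8 < 4 → discLabel (k + 4) = discLabel k ∧
    discLabel ((k + 4 + 1) % 48) = discLabel (k + 1) := by decide +kernel

/-- Boundary labels coincide only as the gluing dictates: all twelve corners form one class, and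
every other boundary vertex is paired with the one four steps away. This keeps the glued complex
from having further identifications. -/
theorem discLabel_eq_iff : ∀ a ∈ List.range 48, ∀ b ∈ List.range 48, discLabel a = discLabel b →
    a = b ∨ (a % 4 = 0 ∧ b % 4 = 0) ∨ (a % 8 < 4 ∧ b = a + 4) ∨ (b % 8 < 4 ∧ a = b + 4) := by
  decide +kernel

/-- Vertices of two triangles of the disc with the same label are equal, or belong to two boundary
edges that are glued, or there is just one pair of them, and it belongs to the boundary. -/
theorem discLabel_eq_cases : ∀ t ∈ discTriangles, ∀ u ∈ discTriangles,
    (∀ i ∈ t, ∀ j ∈ u, discLabel i = discLabel j → i = j) ∨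
    (∃ a ∈ t, ∃ b ∈ u, a < 48 ∧ b < 48 ∧ ∀ i ∈ t, ∀ j ∈ u, discLabel i = discLabel j → i = a ∧ j = b) ∨
    (∃ k ∈ t, k < 48 ∧ k % 8 < 4 ∧ ∀ i ∈ t, ∀ j ∈ u, discLabel i = discLabel j →
      (i = k ∧ j = k + 4) ∨ (i = (k + 1) % 48 ∧ j = (k + 4 + 1) % 48)) ∨
    (∃ k ∈ u, k < 48 ∧ k % 8 < 4 ∧ ∀ i ∈ t, ∀ j ∈ u, discLabel i = discLabel j →
      (j = k ∧ i = k + 4) ∨ (j = (k + 1) % 48 ∧ i = (k + 4 + 1) % 48)) := by decide +kernel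

end FacetList

/-! ### Gluing the boundary of the disc -/

namespace FacetList

theorem circlePoint_mem (n : ℕ) (θ : ℝ) : circlePoint n θ ∈ Metric.closedBall (0 : ℂ) 1 := by
  rw [mem_closedBall_zero_iff, norm_circlePoint]

/-- A point of the boundary of the disc. -/
noncomputable def rimPoint (θ : ℝ) : UnitDisc := ⟨circlePoint 48 θ, circlePoint_mem 48 θ⟩

theorem crossCapGluing_rimPoint {k : ℕ} (hk : k < 48) (hk' : k % 8 < 4) {s : ℝ} (hs0 : 0 ≤ s)
    (hs1 : s ≤ 1) : crossCapGluing 6 (rimPoint (k + s)) (rimPoint ((k + 4 : ℕ) + s)) := by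
  have hdiv : (k : ℝ) = 8 * (k / 8 : ℕ) + (k % 8 : ℕ) := by exact_mod_cast (Nat.div_add_mod k 8).symm
  have hlt : ((k % 8 : ℕ) : ℝ) ≤ 3 := by exact_mod_cast (by omega : k % 8 ≤ 3)
  refine ⟨⟨k / 8, by omega⟩, ((k % 8 : ℕ) + s) / 4, ⟨by positivity, by linarith⟩, ?_, ?_⟩
  · simp only [rimPoint, circlePoint, hdiv]
    congr 1; push_cast; ring
  · simp only [rimPoint, circlePoint]
    rw [Nat.cast_add, hdiv]
    congr 1; push_cast; ring

theorem exists_rimPoint_of_crossCapGluing {z w : UnitDisc} (h : crossCapGluing 6 z w) :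
    ∃ k : ℕ, k < 48 ∧ k % 8 < 4 ∧ ∃ s : ℝ, 0 ≤ s ∧ s ≤ 1 ∧ z = rimPoint (k + s) ∧
      w = rimPoint ((k + 4 : ℕ) + s) := by
  obtain ⟨⟨j, hj⟩, t, ⟨ht0, ht1⟩, hz, hw⟩ := h
  obtain ⟨i, hi, s, hs0, hs1, hts⟩ : ∃ i : ℕ, i < 4 ∧ ∃ s : ℝ, 0 ≤ s ∧ s ≤ 1 ∧ t = (i + s) / 4 := by
    rcases ht1.eq_or_lt with rfl | ht1
    · exact ⟨3, by norm_num, 1, by norm_num, by norm_num, by norm_num⟩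
    · refine ⟨⌊4 * t⌋₊, ?_, 4 * t - ⌊4 * t⌋₊, ?_, ?_, by ring⟩
      · rw [Nat.floor_lt (by positivity)]; push_cast; linarith
      · linarith [Nat.floor_le (by positivity : 0 ≤ 4 * t)]
      · linarith [Nat.lt_floor_add_one (4 * t)]
  refine ⟨8 * j + i, by omega, by omega, s, hs0, hs1, Subtype.ext ?_, Subtype.ext ?_⟩
  · rw [hz, hts]
    simp only [rimPoint, circlePoint]
    congr 1; push_cast; ring
  · rw [hw, hts]
    simp only [rimPoint, circlePoint]
    congr 1; push_cast; ring

/-- The corners of the polygon are glued to one point. -/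
theorem mk_rimPoint_corner (c : ℕ) (hc : c < 12) :
    (Quot.mk (crossCapGluing 6) (rimPoint (4 * c : ℕ)) : NonorientableSurface 6) =
      Quot.mk (crossCapGluing 6) (rimPoint 0) := by
  induction c with
  | zero => simp
  | succ c ih =>
    rw [← ih (by omega)]
    symm
    -- For even c the corners c and c + 1 are the initial points of two glued sides, for odd c they
    -- are the terminal points of two glued sides. Terminal points are reached with k = 4c - 1 and s
    -- = 1.
    rcases Nat.even_or_odd c with ⟨d, hd⟩ | ⟨d, hd⟩
    · have h := crossCapGluing_rimPoint (k := 4 * c) (by omega) (by omega) le_rfl zero_le_one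
      rw [add_zero, add_zero] at h
      exact Quot.sound h
    · have h := crossCapGluing_rimPoint (k := 4 * c - 1) (by omega) (by omega) zero_le_one le_rfl
      have e : ((4 * c - 1 : ℕ) : ℝ) + 1 = (4 * c : ℕ) := by
        rw [Nat.cast_sub (by omega)]; simp
      have e' : ((4 * c - 1 + 4 : ℕ) : ℝ) + 1 = (4 * (c + 1) : ℕ) := by
        rw [show 4 * c - 1 + 4 = 4 * (c + 1) - 1 by omega, Nat.cast_sub (by omega)]; simp
      rw [e, e'] at h
      exact Quot.sound h

theorem supportedOn_edgePoint {n k : ℕ} (s : ℝ) :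
    SupportedOn (edgePoint n k s) (mask [k, (k + 1) % n]) := by
  intro i hi
  rw [testBit_mask, decide_eq_true_eq]
  by_contra hcon
  simp only [List.mem_cons, List.not_mem_nil, or_false, not_or] at hcon
  exact hi (by simp [edgePoint, hcon])

theorem coneCoord_rimPoint {k : ℕ} (hk : k < 48) {s : ℝ} (hs0 : 0 ≤ s) (hs1 : s ≤ 1) :
    coneCoord 48 (rimPoint (k + s)).1 = edgePoint 48 k s := by
  have h := coneCoord_circlePoint (n := 48) (by norm_num) hk zero_le_one hs0 hs1
  rw [Complex.ofReal_one, one_mul] at h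
  have hmod : (k + 1) % 48 < 48 := Nat.mod_lt _ (by omega)
  rw [rimPoint, h]
  funext i
  split_ifs with hi
  · rw [edgePoint, if_neg (by omega), if_neg (by omega)]; simp
  · rw [one_mul]

/-- The map of barycentric coordinates induced by the labelling of the vertices of the disc. -/
noncomputable def relabel (x : ℕ → ℝ) : ℕ → ℝ := fun v =>
  ∑ i ∈ (range 50).filter (fun i => discLabel i = v), x i

theorem continuous_relabel : Continuous relabel :=
  continuous_pi fun _ => continuous_finsetSum _ fun i _ => continuous_apply i

theorem relabel_discLabel {t : List ℕ} (ht : t ∈ discTriangles) {x : ℕ → ℝ}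
    (hx : ∀ i, x i ≠ 0 → i ∈ t) {i : ℕ} (hi : i ∈ t) : relabel x (discLabel i) = x i := by
  obtain ⟨-, h1, h2⟩ := discTriangles_nodup t ht
  rw [relabel, Finset.sum_eq_single_of_mem i (by simp [h2 i hi])]
  intro j hj hne
  rw [mem_filter] at hj
  by_contra h0
  exact hne (List.inj_on_of_nodup_map h1 (hx j h0) hi hj.2)

theorem relabel_eq_zero {t : List ℕ} {x : ℕ → ℝ} (hx : ∀ i, x i ≠ 0 → i ∈ t) {v : ℕ}
    (hv : v ∉ t.map discLabel) : relabel x v = 0 := by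
  apply Finset.sum_eq_zero
  intro i hi
  by_contra h0
  exact hv (List.mem_map.mpr ⟨i, hx i h0, (mem_filter.mp hi).2⟩)

theorem sum_relabel (x : ℕ → ℝ) : ∑ v ∈ range 65, relabel x v = ∑ i ∈ range 50, x i :=
  Finset.sum_fiberwise_of_maps_to
    (fun i hi => mem_range.mpr (discLabel_lt i (mem_range.mp hi))) x

theorem mem_polytope_map_mask {N : ℕ} {T : List (List ℕ)} {x : ℕ → ℝ} :
    x ∈ polytope N (T.map mask) ↔ (∀ i, 0 ≤ x i) ∧ ∑ i ∈ range N, x i = 1 ∧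
      ∃ t ∈ T, ∀ i, x i ≠ 0 → i ∈ t := by
  simp [polytope, SupportedOn, testBit_mask]

theorem surfaceFacets_eq : surfaceFacets = (discTriangles.map (List.map discLabel)).map mask := by
  rw [surfaceFacets, List.map_map]; rfl

theorem relabel_mem {x : ℕ → ℝ} (hx : x ∈ polytope 50 (discTriangles.map mask)) :
    relabel x ∈ polytope 65 surfaceFacets := by
  rw [mem_polytope_map_mask] at hx
  obtain ⟨h0, h1, t, ht, hxt⟩ := hx
  rw [surfaceFacets_eq, mem_polytope_map_mask]
  refine ⟨fun v => Finset.sum_nonneg fun i _ => h0 i, (sum_relabel x).trans h1, t.map discLabel,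
    List.mem_map_of_mem ht, fun v hv => ?_⟩
  by_contra hcon
  exact hv (relabel_eq_zero hxt hcon)

theorem exists_relabel_eq {y : ℕ → ℝ} (hy : y ∈ polytope 65 surfaceFacets) :
    ∃ x ∈ polytope 50 (discTriangles.map mask), relabel x = y := by
  rw [surfaceFacets_eq, mem_polytope_map_mask] at hy
  obtain ⟨h0, h1, u, hu, hyu⟩ := hy
  obtain ⟨t, ht, rfl⟩ := List.mem_map.mp hu
  let x : ℕ → ℝ := fun i => if i ∈ t then y (discLabel i) else 0
  have hx : ∀ i, x i ≠ 0 → i ∈ t := by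
    intro i hi
    by_contra h
    exact hi (if_neg h)
  have e : relabel x = y := by
    funext v
    by_cases hv : v ∈ t.map discLabel
    · obtain ⟨i, hi, rfl⟩ := List.mem_map.mp hv
      rw [relabel_discLabel ht hx hi]
      exact if_pos hi
    · rw [relabel_eq_zero hx hv]
      by_contra h
      exact hv (hyu v (Ne.symm h))
  refine ⟨x, mem_polytope_map_mask.mpr ⟨fun i => ?_, ?_, t, ht, hx⟩, e⟩
  · simp only [x]; split_ifs
    · exact h0 _
    · exact le_rfl
  · rw [← sum_relabel, e, h1]

theorem eq_edgePoint {x : ℕ → ℝ} {k : ℕ} (hk : k < 48) (h1 : ∑ i ∈ range 50, x i = 1)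
    (hx : ∀ i, x i ≠ 0 → i = k ∨ i = (k + 1) % 48) : x = edgePoint 48 k (x ((k + 1) % 48)) := by
  have hne : (k + 1) % 48 ≠ k := by omega
  have hsum : x k + x ((k + 1) % 48) = 1 := by
    rw [← h1, ← Finset.sum_subset (s₁ := {k, (k + 1) % 48}), Finset.sum_pair hne.symm]
    · intro i; simp; omega
    · intro i _ hi
      simp only [Finset.mem_insert, Finset.mem_singleton] at hi
      by_contra h
      exact hi (hx i h)
  funext i
  rw [edgePoint]
  by_cases h1 : i = k
  · rw [if_pos h1, h1, if_neg hne.symm]; linarith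
  by_cases h2 : i = (k + 1) % 48
  · rw [if_neg h1, if_pos h2, ← h2]; simp
  · rw [if_neg h1, if_neg h2]
    by_contra h
    rcases hx i (by simpa using h) with h' | h'
    · exact h1 h'
    · exact h2 h'

/-- Glued points of the disc have the same image in the surface. -/
theorem relabel_edgePoint {k : ℕ} (hk : k < 48) (hk' : k % 8 < 4) (s : ℝ) :
    relabel (edgePoint 48 (k + 4) s) = relabel (edgePoint 48 k s) := by
  have hrel : ∀ j < 48, relabel (edgePoint 48 j s) = fun v =>
      (if discLabel j = v then 1 - s else 0) + (if discLabel ((j + 1) % 48) = v then s else 0) := by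
    intro j hj
    funext v
    simp only [relabel, edgePoint]
    have h48 : (j + 1) % 48 < 48 := Nat.mod_lt _ (by omega)
    rw [Finset.sum_add_distrib, Finset.sum_ite_eq', Finset.sum_ite_eq']
    have h1 : j < 50 := by omega
    have h2 : (j + 1) % 48 < 50 := by omega
    simp [h1, h2]
  obtain ⟨h1, h2⟩ := discLabel_shift k hk hk'
  have h3 : k + 1 = (k + 1) % 48 := by omega
  rw [hrel k hk, hrel (k + 4) (by omega), h1, h2, ← h3]

theorem rimPoint_mk_eq_of_discLabel_eq {a b : ℕ} (ha : a < 48) (hb : b < 48)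
    (h : discLabel a = discLabel b) :
    (Quot.mk (crossCapGluing 6) (rimPoint a) : NonorientableSurface 6) =
      Quot.mk (crossCapGluing 6) (rimPoint b) := by
  have shift : ∀ k : ℕ, k < 48 → k % 8 < 4 →
      (Quot.mk (crossCapGluing 6) (rimPoint k) : NonorientableSurface 6) =
      Quot.mk (crossCapGluing 6) (rimPoint (k + 4 : ℕ)) := by
    intro k hk hk'
    have := crossCapGluing_rimPoint hk hk' le_rfl zero_le_one
    rw [add_zero, add_zero] at this
    exact Quot.sound this
  rcases discLabel_eq_iff a (List.mem_range.mpr ha) b (List.mem_range.mpr hb) h with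
    rfl | ⟨h1, h2⟩ | ⟨h1, rfl⟩ | ⟨h1, rfl⟩
  · rfl
  · obtain ⟨c, rfl⟩ : ∃ c, a = 4 * c := ⟨a / 4, by omega⟩
    obtain ⟨d, rfl⟩ : ∃ d, b = 4 * d := ⟨b / 4, by omega⟩
    rw [mk_rimPoint_corner c (by omega), mk_rimPoint_corner d (by omega)]
  · exact shift a ha h1
  · exact (shift b hb h1).symm

/-- The surface `N_6` is homeomorphic to the simplicial complex with facets `surfaceFacets`. -/
theorem nonempty_homeomorph_surfaceFacets :
    Nonempty (NonorientableSurface 6 ≃ₜ polytope 65 surfaceFacets) := by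
  obtain ⟨G, hG⟩ := exists_homeomorph_cone (n := 48) (N := 50) (by norm_num) (by norm_num)
  obtain ⟨Ψ, hΨ⟩ := exists_homeomorph_of_deforms _ deforms_discMoves
  let g : UnitDisc ≃ₜ polytope 50 (discTriangles.map mask) := G.trans Ψ.symm
  let f : UnitDisc → polytope 65 surfaceFacets := fun z => ⟨relabel (g z).1, relabel_mem (g z).2⟩
  have hf : Continuous f :=
    (continuous_relabel.comp (continuous_subtype_val.comp g.continuous)).subtype_mk _
  -- The moves fix all points supported on boundary edges, so on the rim the parametrization g of
  -- the triangulated disc agrees with the cone coordinates.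
  have rim : ∀ k : ℕ, k < 48 → ∀ s : ℝ, 0 ≤ s → s ≤ 1 → (g (rimPoint (k + s))).1 = edgePoint 48 k s := by
    intro k hk s hs0 hs1
    have h1 : (G (rimPoint (k + s))).1 = edgePoint 48 k s := by
      rw [hG, coneCoord_rimPoint hk hs0 hs1]
    have hmem : edgePoint 48 k s ∈ polytope 50 (discTriangles.map mask) := by
      refine ⟨edgePoint_nonneg hs0 hs1, sum_edgePoint hk (by norm_num) s, ?_⟩
      obtain ⟨t, ht, hsub⟩ : ∃ t ∈ discTriangles, ∀ i ∈ [k, (k + 1) % 48], i ∈ t := by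
        have : ∀ k < 48, ∃ t ∈ discTriangles, ∀ i ∈ [k, (k + 1) % 48], i ∈ t := by decide +kernel
        exact this k hk
      refine ⟨mask t, List.mem_map_of_mem ht, fun i hi => ?_⟩
      have := supportedOn_edgePoint s i hi
      rw [testBit_mask, decide_eq_true_eq] at this ⊢
      exact hsub i this
    have h2 : Ψ ⟨_, hmem⟩ = G (rimPoint (k + s)) := by
      apply Subtype.ext
      rw [hΨ _ ⟨_, List.mem_map_of_mem (List.mem_range.mpr hk), supportedOn_edgePoint s⟩, h1]
    change (Ψ.symm (G (rimPoint (k + s)))).1 = _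
    rw [← h2, Homeomorph.symm_apply_apply]
  have rim' : ∀ z : UnitDisc, ∀ k < 48, (∀ i, (g z).1 i ≠ 0 → i = k ∨ i = (k + 1) % 48) →
      z = rimPoint (k + (g z).1 ((k + 1) % 48)) := by
    intro z k hk hz
    have hs0 := (g z).2.1 ((k + 1) % 48)
    have hs1 : (g z).1 ((k + 1) % 48) ≤ 1 :=
      (Finset.single_le_sum (fun i _ => (g z).2.1 i) (mem_range.mpr (by omega))).trans_eq (g z).2.2.1
    apply g.injective
    apply Subtype.ext
    rw [rim k hk _ hs0 hs1]
    exact eq_edgePoint hk (g z).2.2.1 hz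
  have compat : ∀ z w, crossCapGluing 6 z w → f z = f w := by
    intro z w h
    obtain ⟨k, hk, hk', s, hs0, hs1, rfl, rfl⟩ := exists_rimPoint_of_crossCapGluing h
    apply Subtype.ext
    change relabel _ = relabel _
    rw [rim k hk s hs0 hs1, rim (k + 4) (by omega) s hs0 hs1, relabel_edgePoint hk hk']
  -- Labels are distinct within each triangle, so `relabel` loses no coordinate there. Equal images
  -- therefore force the nonzero coordinates of the two points to match label by label.
  have fibre : ∀ z w, f z = f w → (Quot.mk (crossCapGluing 6) z : NonorientableSurface 6) =
      Quot.mk (crossCapGluing 6) w := by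
    intro z w h
    have h : relabel (g z).1 = relabel (g w).1 := congrArg Subtype.val h
    obtain ⟨hx0, hx1, t, ht, hxt⟩ := mem_polytope_map_mask.mp (g z).2
    obtain ⟨hy0, hy1, u, hu, hyu⟩ := mem_polytope_map_mask.mp (g w).2
    have match1 : ∀ i, (g z).1 i ≠ 0 → ∃ j ∈ u, discLabel i = discLabel j ∧ (g w).1 j = (g z).1 i := by
      intro i hi
      have h1 := relabel_discLabel ht hxt (hxt i hi)
      rw [h] at h1
      have h2 : discLabel i ∈ u.map discLabel := by
        by_contra hcon
        rw [relabel_eq_zero hyu hcon] at h1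
        exact hi h1.symm
      obtain ⟨j, hj, hji⟩ := List.mem_map.mp h2
      exact ⟨j, hj, hji.symm, by rw [← relabel_discLabel hu hyu hj, hji, h1]⟩
    have match2 : ∀ j, (g w).1 j ≠ 0 → ∃ i ∈ t, discLabel i = discLabel j ∧ (g z).1 i = (g w).1 j := by
      intro j hj
      have h1 := relabel_discLabel hu hyu (hyu j hj)
      rw [← h] at h1
      have h2 : discLabel j ∈ t.map discLabel := by
        by_contra hcon
        rw [relabel_eq_zero hxt hcon] at h1
        exact hj h1.symm
      obtain ⟨i, hi, hij⟩ := List.mem_map.mp h2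
      exact ⟨i, hi, hij, by rw [← relabel_discLabel ht hxt hi, hij, h1]⟩
    have glued : ∀ z w : UnitDisc, ∀ k < 48, k % 8 < 4 →
        (∀ i, (g z).1 i ≠ 0 → ∃ j, (g w).1 j = (g z).1 i ∧
          ((i = k ∧ j = k + 4) ∨ (i = (k + 1) % 48 ∧ j = (k + 4 + 1) % 48))) →
        (∀ j, (g w).1 j ≠ 0 → ∃ i, (g z).1 i = (g w).1 j ∧
          ((i = k ∧ j = k + 4) ∨ (i = (k + 1) % 48 ∧ j = (k + 4 + 1) % 48))) →
        (Quot.mk (crossCapGluing 6) z : NonorientableSurface 6) = Quot.mk (crossCapGluing 6) w := by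
      intro z w k hk hk' hz hw
      have e1 := rim' z k hk fun i hi => by obtain ⟨j, -, h⟩ := hz i hi; omega
      have e2 := rim' w (k + 4) (by omega) fun j hj => by obtain ⟨i, -, h⟩ := hw j hj; omega
      have e3 : (g w).1 ((k + 4 + 1) % 48) = (g z).1 ((k + 1) % 48) := by
        by_cases h0 : (g z).1 ((k + 1) % 48) = 0
        · rw [h0]
          by_contra h1
          obtain ⟨i, hi, h⟩ := hw _ h1
          have : i = (k + 1) % 48 := by omega
          rw [this, h0] at hi
          exact h1 hi.symm
        · obtain ⟨j, hj, h⟩ := hz _ h0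
          have : j = (k + 4 + 1) % 48 := by omega
          rw [← this, hj]
      rw [e3] at e2
      rw [e1, e2]
      have hs0 := (g z).2.1 ((k + 1) % 48)
      have hs1 : (g z).1 ((k + 1) % 48) ≤ 1 :=
        (Finset.single_le_sum (fun i _ => (g z).2.1 i) (mem_range.mpr (by omega))).trans_eq (g z).2.2.1
      exact Quot.sound (crossCapGluing_rimPoint hk hk' hs0 hs1)
    -- Either matching labels mean equal vertices and the points coincide, or there is one common
    -- label and both points are boundary vertices, or both points lie on glued boundary edges at
    -- the same parameter; the last case occurs in either order.
    rcases discLabel_eq_cases t ht u hu with H | ⟨a, -, b, -, ha, hb, H⟩ | ⟨k, -, hk, hk', H⟩ |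
      ⟨k, -, hk, hk', H⟩
    · have : g z = g w := by
        apply Subtype.ext
        funext i
        by_cases h0 : (g z).1 i = 0
        · rw [h0]
          by_contra h1
          obtain ⟨j, hj, hl, he⟩ := match2 i (Ne.symm h1)
          rw [H j hj i (hyu i (Ne.symm h1)) hl, h0] at he
          exact h1 he
        · obtain ⟨j, hj, hl, he⟩ := match1 i h0
          rw [← he, H i (hxt i h0) j hj hl]
      rw [g.injective this]
    · have hz1 : ∀ i, (g z).1 i ≠ 0 → i = a := by
        intro i hi
        obtain ⟨j, hj, hl, he⟩ := match1 i hi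
        exact (H i (hxt i hi) j hj hl).1
      have hw1 : ∀ i, (g w).1 i ≠ 0 → i = b := by
        intro i hi
        obtain ⟨j, hj, hl, he⟩ := match2 i hi
        exact (H j hj i (hyu i hi) hl).2
      have key : ∀ z : UnitDisc, ∀ a : ℕ, a < 48 → (∀ i, (g z).1 i ≠ 0 → i = a) →
          z = rimPoint a ∧ (g z).1 a ≠ 0 := by
        intro z a ha hz
        have h0 : (g z).1 ((a + 1) % 48) = 0 := by
          by_contra h0
          have := hz _ h0
          omega
        have := rim' z a ha fun i hi => Or.inl (hz i hi)
        rw [h0, add_zero] at this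
        refine ⟨this, fun h1 => ?_⟩
        have h2 := (g z).2.2.1
        rw [Finset.sum_eq_zero] at h2
        · exact zero_ne_one h2
        · intro i _
          by_contra h3
          rw [hz i h3] at h3
          exact h3 h1
      obtain ⟨ez, nz⟩ := key z a ha hz1
      obtain ⟨ew, -⟩ := key w b hb hw1
      obtain ⟨j, hj, hl, he⟩ := match1 a nz
      rw [(H a (hxt a nz) j hj hl).2] at hl
      rw [ez, ew, rimPoint_mk_eq_of_discLabel_eq ha hb hl]
    · exact glued z w k hk hk'
        (fun i hi => by
          obtain ⟨j, hj, hl, he⟩ := match1 i hi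
          exact ⟨j, he, H i (hxt i hi) j hj hl⟩)
        (fun j hj => by
          obtain ⟨i, hi, hl, he⟩ := match2 j hj
          exact ⟨i, he, H i hi j (hyu j hj) hl⟩)
    · exact (glued w z k hk hk'
        (fun j hj => by
          obtain ⟨i, hi, hl, he⟩ := match2 j hj
          exact ⟨i, he, H i hi j (hyu j hj) hl⟩)
        (fun i hi => by
          obtain ⟨j, hj, hl, he⟩ := match1 i hi
          exact ⟨j, he, H i (hxt i hi) j hj hl⟩)).symm
  let F : NonorientableSurface 6 → polytope 65 surfaceFacets := Quot.lift f compat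
  have hF : Continuous F := continuous_quot_lift _ hf
  have hFinj : Function.Injective F := by
    rintro ⟨z⟩ ⟨w⟩ h
    exact fibre z w h
  have hFsurj : Function.Surjective F := by
    intro y
    obtain ⟨x, hx, hxy⟩ := exists_relabel_eq y.2
    refine ⟨Quot.mk _ (g.symm ⟨x, hx⟩), Subtype.ext ?_⟩
    change relabel (g (g.symm ⟨x, hx⟩)).1 = y.1
    rw [Homeomorph.apply_symm_apply, hxy]
  have : CompactSpace UnitDisc := isCompact_iff_compactSpace.mp (isCompact_closedBall _ _)
  have : CompactSpace (NonorientableSurface 6) := Quot.compactSpace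
  exact ⟨Continuous.homeoOfEquivCompactToT2 (f := Equiv.ofBijective F ⟨hFinj, hFsurj⟩) hF⟩

end FacetList

/-! ### The ten-vertex complex -/

namespace FacetList

/-- A simplicial complex with ten vertices whose facets are `triangles`. -/
def tenVertexComplex : AbstractSimplicialComplex (Fin 10) where
  faces := {s | s.Nonempty ∧ ∃ t ∈ triangles, ∀ i ∈ s, (i : ℕ) ∈ t}
  isRelLowerSet_faces := by
    rintro s ⟨hs, t, ht, h⟩
    exact ⟨hs, fun u hu hne => ⟨hne, t, ht, fun i hi => h i (hu hi)⟩⟩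
  singleton_mem := by
    intro v
    refine ⟨singleton_nonempty v, ?_⟩
    have : ∀ v : Fin 10, ∃ t ∈ triangles, (v : ℕ) ∈ t := by decide
    obtain ⟨t, ht, h⟩ := this v
    exact ⟨t, ht, fun i hi => by rwa [mem_singleton.mp hi]⟩

theorem triangles_spec : ∀ t ∈ triangles, t.length = 3 ∧ t.Nodup ∧ ∀ i ∈ t, i < 10 := by decide

theorem mem_space_tenVertexComplex {x : Fin 10 → ℝ} :
    x ∈ tenVertexComplex.space ↔ x ∈ stdSimplex ℝ (Fin 10) ∧
      ∃ t ∈ triangles, ∀ v, x v ≠ 0 → (v : ℕ) ∈ t := by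
  refine and_congr_right fun _ => ⟨?_, ?_⟩
  · rintro ⟨s, ⟨-, t, ht, hs⟩, h⟩
    exact ⟨t, ht, fun v hv => hs v (h v hv)⟩
  · rintro ⟨t, ht, h⟩
    refine ⟨univ.filter fun v => (v : ℕ) ∈ t, ⟨?_, t, ht, fun i hi => (mem_filter.mp hi).2⟩,
      fun v hv => mem_filter.mpr ⟨mem_univ v, h v hv⟩⟩
    obtain ⟨h3, -, h10⟩ := triangles_spec t ht
    obtain ⟨a, ha⟩ := List.exists_mem_of_length_pos (by omega : 0 < t.length)
    exact ⟨⟨a, h10 a ha⟩, by simpa using ha⟩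

theorem isTwoDimensional_tenVertexComplex : tenVertexComplex.IsTwoDimensional := by
  constructor
  · rintro s ⟨-, t, ht, hs⟩
    obtain ⟨h3, hn, -⟩ := triangles_spec t ht
    rw [← h3, ← List.toFinset_card_of_nodup hn, ← Finset.card_map Fin.valEmbedding]
    refine Finset.card_le_card fun i hi => ?_
    obtain ⟨j, hj, rfl⟩ := Finset.mem_map.mp hi
    exact List.mem_toFinset.mpr (hs j hj)
  · exact ⟨{0, 1, 6}, ⟨⟨0, by simp⟩, [0, 1, 6], by decide, by decide⟩, by decide⟩

/-- Extension by zero. -/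
def extend (x : Fin 10 → ℝ) : ℕ → ℝ := fun i => if h : i < 10 then x ⟨i, h⟩ else 0

theorem extend_val (x : Fin 10 → ℝ) (i : Fin 10) : extend x i = x i := dif_pos i.2

theorem sum_extend_mul (x : Fin 10 → ℝ) (c : ℕ → ℝ) :
    ∑ i ∈ range 10, extend x i * c i = ∑ i : Fin 10, x i * c i := by
  rw [Finset.sum_range]
  exact Finset.sum_congr rfl fun i _ => by rw [extend_val]

theorem extend_ne_zero {x : Fin 10 → ℝ} {i : ℕ} (h : extend x i ≠ 0) : ∃ h : i < 10, x ⟨i, h⟩ ≠ 0 := by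
  by_cases hi : i < 10
  · exact ⟨hi, by rwa [extend, dif_pos hi] at h⟩
  · exact absurd (dif_neg hi) h

theorem nonempty_homeomorph_triangles :
    Nonempty (tenVertexComplex.space ≃ₜ polytope 65 (triangles.map mask)) := by
  have fwd : ∀ x ∈ tenVertexComplex.space, extend x ∈ polytope 65 (triangles.map mask) := by
    intro x hx
    obtain ⟨⟨h0, h1⟩, t, ht, h⟩ := mem_space_tenVertexComplex.mp hx
    refine mem_polytope_map_mask.mpr ⟨fun i => ?_, ?_, t, ht, fun i hi => ?_⟩
    · unfold extend; split_ifs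
      · exact h0 _
      · exact le_rfl
    · rw [← h1, ← Finset.sum_subset (s₁ := range 10) (by intro i; simp; omega)]
      · simpa using sum_extend_mul x 1
      · intro i _ hi
        exact dif_neg (by simpa using hi)
    · obtain ⟨hi', h'⟩ := extend_ne_zero hi
      exact h _ h'
  have bwd : ∀ y ∈ polytope 65 (triangles.map mask), (fun i : Fin 10 => y i) ∈ tenVertexComplex.space ∧
      extend (fun i : Fin 10 => y i) = y := by
    intro y hy
    obtain ⟨h0, h1, t, ht, h⟩ := mem_polytope_map_mask.mp hy
    obtain ⟨-, -, h10⟩ := triangles_spec t ht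
    have e : extend (fun i : Fin 10 => y i) = y := by
      funext i
      unfold extend
      split_ifs with hi
      · rfl
      · by_contra hne
        exact hi (h10 i (h i (Ne.symm hne)))
    refine ⟨mem_space_tenVertexComplex.mpr ⟨⟨fun i => h0 i, ?_⟩, t, ht, fun v hv => h v hv⟩, e⟩
    rw [← h1, ← Finset.sum_subset (s₁ := range 10) (by intro i; simp; omega), Finset.sum_range]
    intro i _ hi
    by_contra hne
    exact hi (mem_range.mpr (h10 i (h i hne)))
  refine ⟨⟨⟨fun x => ⟨extend x.1, fwd x.1 x.2⟩, fun y => ⟨fun i => y.1 i, (bwd y.1 y.2).1⟩,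
    fun x => Subtype.ext (funext fun i => extend_val x.1 i), fun y => Subtype.ext (bwd y.1 y.2).2⟩, ?_, ?_⟩⟩
  · refine Continuous.subtype_mk (continuous_pi fun i => ?_) _
    simp only [extend]
    split_ifs
    · exact (continuous_apply _).comp continuous_subtype_val
    · exact continuous_const
  · refine Continuous.subtype_mk (continuous_pi fun i => ?_) _
    exact (continuous_apply (i : ℕ)).comp (f := fun y : polytope 65 (triangles.map mask) => y.1)
      continuous_subtype_val

theorem nonempty_homeomorph_tenVertexComplex :
    Nonempty (tenVertexComplex.space ≃ₜ NonorientableSurface 6) := by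
  obtain ⟨f⟩ := nonempty_homeomorph_triangles
  obtain ⟨g, -⟩ := exists_homeomorph_of_deforms _ deforms_surfaceMoves
  obtain ⟨h⟩ := nonempty_homeomorph_surfaceFacets
  exact ⟨(f.trans g).trans h.symm⟩

theorem triangulates_tenVertexComplex : tenVertexComplex.Triangulates (NonorientableSurface 6) :=
  ⟨isTwoDimensional_tenVertexComplex, nonempty_homeomorph_tenVertexComplex⟩

/-! ### The polyhedral immersion -/

/-- The coordinates of the vertices. -/
def positions : List (List ℤ) :=
  [[-2, -3, -1], [2, 3, -1], [-3, 3, 1], [3, -3, 1], [3, 2, -3], [-3, -2, -3], [1, -2, 0],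
    [-1, 2, 0], [-1, -2, -1], [1, 2, -1]]

/-- The coordinate `k` of the vertex `i`. -/
def coord (i k : ℕ) : ℤ := (positions.getD i []).getD k 0

/-- The determinant of three vectors. -/
def det3 {R : Type*} [Ring R] (a b c : ℕ → R) : R :=
  a 0 * (b 1 * c 2 - b 2 * c 1) - a 1 * (b 0 * c 2 - b 2 * c 0) + a 2 * (b 0 * c 1 - b 1 * c 0)

/-- The edge vector from `v` to `a`. -/
def edgeVec (v a k : ℕ) : ℤ := coord a k - coord v k

/-- The determinant of the edge vectors from `v` to `a`, `b` and `c`. -/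
def vertexDet (v a b c : ℕ) : ℤ := det3 (edgeVec v a) (edgeVec v b) (edgeVec v c)

/-- The triangles `v a b` and `v c d` have no other points in common than they should. -/
def starDisjoint (v a b c d : ℕ) : Prop :=
  if a = c ∧ b = d then ∃ e ∈ List.range 10, vertexDet v a b e ≠ 0
  else if a = c ∨ b = c then vertexDet v a b d ≠ 0
  else if a = d ∨ b = d then vertexDet v a b c ≠ 0
  else vertexDet v b c d ≠ 0 ∧ vertexDet v a c d ≠ 0 ∧ vertexDet v a b d ≠ 0 ∧ vertexDet v a b c ≠ 0 ∧
    (0 < vertexDet v b c d ∨ vertexDet v a c d < 0 ∨ vertexDet v a b d < 0 ∨ 0 < vertexDet v a b c) ∧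
    (vertexDet v b c d < 0 ∨ 0 < vertexDet v a c d ∨ 0 < vertexDet v a b d ∨ vertexDet v a b c < 0)

instance (v a b c d : ℕ) : Decidable (starDisjoint v a b c d) := by
  unfold starDisjoint; infer_instance

/-- All pairs of triangles with a common vertex are checked. Erasing v from a triangle leaves two
entries, so the default 0 of `getD` is never used. -/
theorem starDisjoint_of_mem : ∀ t ∈ triangles, ∀ u ∈ triangles, ∀ v ∈ t, v ∈ u →
    starDisjoint v ((t.erase v).getD 0 0) ((t.erase v).getD 1 0)
      ((u.erase v).getD 0 0) ((u.erase v).getD 1 0) := by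
  decide +kernel

theorem det3_eq_of_eq {α β γ δ : ℝ} {A B C D : ℕ → ℝ}
    (h : ∀ k < 3, α * A k + β * B k = γ * C k + δ * D k) (E F : ℕ → ℝ) :
    α * det3 A E F + β * det3 B E F = γ * det3 C E F + δ * det3 D E F := by
  have h0 := h 0 (by norm_num)
  have h1 := h 1 (by norm_num)
  have h2 := h 2 (by norm_num)
  unfold det3
  linear_combination (E 1 * F 2 - E 2 * F 1) * h0 - (E 0 * F 2 - E 2 * F 0) * h1 +
    (E 0 * F 1 - E 1 * F 0) * h2

theorem vertexDet_cast (v a b c : ℕ) : (vertexDet v a b c : ℝ) =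
    det3 (fun k => (edgeVec v a k : ℝ)) (fun k => (edgeVec v b k : ℝ))
      (fun k => (edgeVec v c k : ℝ)) := by
  simp only [vertexDet, det3]; push_cast; ring

/-- Four vectors A, B, C, D in space satisfy [BCD] A - [ACD] B + [ABD] C - [ABC] D = 0, and this is
their only relation up to scale when the determinants are nonzero. A common point of the cones over
A, B and C, D gives a relation with coefficients Y a, Y b, -Z c, -Z d, so it exists away from the
apex only for the two sign patterns that `starDisjoint` excludes. If the triangles share an edge,
three independent edge vectors suffice; if they are equal, nondegeneracy does. -/
theorem eq_of_starDisjoint {v a b c d : ℕ} (h : starDisjoint v a b c d) {Y Z : ℕ → ℝ}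
    (hY0 : ∀ i, 0 ≤ Y i) (hZ0 : ∀ i, 0 ≤ Z i)
    (hY : ∀ i, i ≠ v → i ≠ a → i ≠ b → Y i = 0) (hZ : ∀ i, i ≠ v → i ≠ c → i ≠ d → Z i = 0)
    (hab : a ≠ b) (hcd : c ≠ d) (hav : a ≠ v) (hbv : b ≠ v) (hcv : c ≠ v) (hdv : d ≠ v)
    (heq : ∀ k < 3, Y a * (edgeVec v a k : ℝ) + Y b * (edgeVec v b k : ℝ) =
      Z c * (edgeVec v c k : ℝ) + Z d * (edgeVec v d k : ℝ)) :
    ∀ i, i ≠ v → Y i = Z i := by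
  set V : ℕ → ℕ → ℝ := fun a k => (edgeVec v a k : ℝ) with hV
  have hdet : ∀ a b c, (vertexDet v a b c : ℝ) = det3 (V a) (V b) (V c) := vertexDet_cast v
  -- Taking e and f among a, b, c, d eliminates those two coefficients from the vector equation.
  have rel : ∀ e f, Y a * vertexDet v a e f + Y b * vertexDet v b e f =
      Z c * vertexDet v c e f + Z d * vertexDet v d e f := by
    intro e f
    simp only [hdet]
    exact det3_eq_of_eq heq (V e) (V f)
  have swap : ∀ a b c, vertexDet v b a c = - vertexDet v a b c := by
    intro a b c; simp only [vertexDet, det3]; ring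
  have cyc : ∀ a b c, vertexDet v b c a = vertexDet v a b c := by
    intro a b c; simp only [vertexDet, det3]; ring
  have rep : ∀ a b, vertexDet v a a b = 0 := by
    intro a b; simp only [vertexDet, det3]; ring
  have rep'' : ∀ a b, vertexDet v a b a = 0 := by
    intro a b; simp only [vertexDet, det3]; ring
  unfold starDisjoint at h
  split_ifs at h with h1 h2 h3
  · obtain ⟨rfl, rfl⟩ := h1
    obtain ⟨e, -, he⟩ := h
    have he' : (vertexDet v a b e : ℝ) ≠ 0 := by exact_mod_cast he
    have r1 := rel b e
    have r2 := rel a e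
    simp only [rep, swap a b, Int.cast_neg, Int.cast_zero, mul_zero, add_zero, zero_add] at r1 r2
    have e1 : Y a = Z a := mul_right_cancel₀ he' r1
    have e2 : Y b = Z b := mul_right_cancel₀ (neg_ne_zero.mpr he') r2
    intro i hi
    by_cases hia : i = a
    · rw [hia, e1]
    by_cases hib : i = b
    · rw [hib, e2]
    rw [hY i hi hia hib, hZ i hi hia hib]
  · have h' : (vertexDet v a b d : ℝ) ≠ 0 := by exact_mod_cast h
    have r1 := rel b d
    have r2 := rel a d
    have r3 := rel a b
    rcases h2 with rfl | rfl
    · simp only [rep, rep'', swap a b, Int.cast_neg, Int.cast_zero, mul_zero, add_zero,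
        zero_add] at r1 r2 r3
      have r3 : Z d * vertexDet v a b d = 0 := by rw [cyc]; exact r3.symm
      have e1 : Y a = Z a := mul_right_cancel₀ h' r1
      have e2 : Y b = 0 := by simpa [h'] using r2
      have e3 : Z d = 0 := by simpa [h'] using r3
      have hbd : b ≠ d := fun hbd => h1 ⟨rfl, hbd⟩
      intro i hi
      by_cases hia : i = a
      · rw [hia, e1]
      by_cases hib : i = b
      · rw [hib, e2, hZ b hbv hab.symm hbd]
      by_cases hid : i = d
      · rw [hid, e3, hY d hdv hcd.symm hbd.symm]
      rw [hY i hi hia hib, hZ i hi hia hid]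
    · simp only [rep, rep'', swap a b, Int.cast_neg, Int.cast_zero, mul_zero, add_zero,
        zero_add] at r1 r2 r3
      have r3 : Z d * vertexDet v a b d = 0 := by rw [cyc]; exact r3.symm
      have e1 : Y a = 0 := by simpa [h'] using r1
      have e2 : Y b = Z b := mul_right_cancel₀ (neg_ne_zero.mpr h') r2
      have e3 : Z d = 0 := by simpa [h'] using r3
      have had : a ≠ d := by rintro rfl; exact h (rep'' _ _)
      intro i hi
      by_cases hia : i = a
      · rw [hia, e1, hZ a hav hab had]
      by_cases hib : i = b
      · rw [hib, e2]
      by_cases hid : i = d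
      · rw [hid, e3, hY d hdv had.symm hcd.symm]
      rw [hY i hi hia hib, hZ i hi hib hid]
  · have h' : (vertexDet v a b c : ℝ) ≠ 0 := by exact_mod_cast h
    have r1 := rel b c
    have r2 := rel a c
    have r3 := rel a b
    push Not at h2
    rcases h3 with rfl | rfl
    · simp only [rep, rep'', swap a b, Int.cast_neg, Int.cast_zero, mul_zero, add_zero,
        zero_add] at r1 r2 r3
      have r3 : Z c * vertexDet v a b c = 0 := by rw [cyc]; exact r3.symm
      have e1 : Y a = Z a := mul_right_cancel₀ h' r1
      have e2 : Y b = 0 := by simpa [h'] using r2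
      have e3 : Z c = 0 := by simpa [h'] using r3
      intro i hi
      by_cases hia : i = a
      · rw [hia, e1]
      by_cases hib : i = b
      · rw [hib, e2, hZ b hbv h2.2 hab.symm]
      by_cases hic : i = c
      · rw [hic, e3, hY c hcv hcd h2.2.symm]
      rw [hY i hi hia hib, hZ i hi hic hia]
    · simp only [rep, rep'', swap a b, Int.cast_neg, Int.cast_zero, mul_zero, add_zero,
        zero_add] at r1 r2 r3
      have r3 : Z c * vertexDet v a b c = 0 := by rw [cyc]; exact r3.symm
      have e1 : Y a = 0 := by simpa [h'] using r1
      have e2 : Y b = Z b := mul_right_cancel₀ (neg_ne_zero.mpr h') r2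
      have e3 : Z c = 0 := by simpa [h'] using r3
      intro i hi
      by_cases hia : i = a
      · rw [hia, e1, hZ a hav h2.1 hab]
      by_cases hib : i = b
      · rw [hib, e2]
      by_cases hic : i = c
      · rw [hic, e3, hY c hcv h2.1.symm hcd]
      rw [hY i hi hia hib, hZ i hi hic hib]
  · obtain ⟨np, nq, nr, ns, hpos, hneg⟩ := h
    push Not at h2 h3
    set p := vertexDet v b c d
    set q := vertexDet v a c d
    set r := vertexDet v a b d
    set s := vertexDet v a b c
    have np' : (p : ℝ) ≠ 0 := by exact_mod_cast np
    have nq' : (q : ℝ) ≠ 0 := by exact_mod_cast nq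
    have nr' : (r : ℝ) ≠ 0 := by exact_mod_cast nr
    have ns' : (s : ℝ) ≠ 0 := by exact_mod_cast ns
    have r1 := rel c d
    have r2 := rel b d
    have r3 := rel b c
    simp only [rep, rep'', swap b c, Int.cast_neg, Int.cast_zero, mul_zero,
      add_zero, zero_add] at r1 r2 r3
    have cyc1 : vertexDet v d b c = p := (cyc d b c).symm
    rw [cyc1] at r3
    change Y a * (q : ℝ) + Y b * (p : ℝ) = 0 at r1
    change Y a * (r : ℝ) = Z c * -(p : ℝ) at r2
    change Y a * (s : ℝ) = Z d * (p : ℝ) at r3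
    have ha0 : Y a = 0 := by
      by_contra hne
      have hpa : 0 < Y a := lt_of_le_of_ne (hY0 a) (Ne.symm hne)
      -- If Y a is positive, the relations `r1`, `r2`, `r3` together with the nonnegativity of Y b,
      -- Z c, Z d fix the signs of q, r, s in terms of the sign of p.
      have fact : (0 < (p : ℝ) ∧ (q : ℝ) < 0 ∧ (r : ℝ) < 0 ∧ 0 < (s : ℝ)) ∨
          ((p : ℝ) < 0 ∧ 0 < (q : ℝ) ∧ 0 < (r : ℝ) ∧ (s : ℝ) < 0) := by
        rcases lt_or_gt_of_ne np' with hp | hp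
        · right
          refine ⟨hp, lt_of_le_of_ne ?_ nq'.symm, lt_of_le_of_ne ?_ nr'.symm, lt_of_le_of_ne ?_ ns'⟩
          · nlinarith [hY0 b]
          · nlinarith [hZ0 c]
          · nlinarith [hZ0 d]
        · left
          refine ⟨hp, lt_of_le_of_ne ?_ nq', lt_of_le_of_ne ?_ nr', lt_of_le_of_ne ?_ ns'.symm⟩
          · nlinarith [hY0 b]
          · nlinarith [hZ0 c]
          · nlinarith [hZ0 d]
      norm_cast at fact
      omega
    rw [ha0] at r1 r2 r3
    have hb0 : Y b = 0 := by simpa [np'] using r1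
    have hc0 : Z c = 0 := by simpa [np'] using r2
    have hd0 : Z d = 0 := by simpa [np'] using r3
    intro i hi
    have e1 : Y i = 0 := by
      by_cases hia : i = a
      · rw [hia, ha0]
      by_cases hib : i = b
      · rw [hib, hb0]
      exact hY i hi hia hib
    have e2 : Z i = 0 := by
      by_cases hic : i = c
      · rw [hic, hc0]
      by_cases hid : i = d
      · rw [hid, hd0]
      exact hZ i hi hic hid
    rw [e1, e2]

theorem sum_range_eq_of_support {t : List ℕ} (ht : t ∈ triangles) {v : ℕ} (hv : v ∈ t) {Y : ℕ → ℝ}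
    (hY : ∀ i, Y i ≠ 0 → i ∈ t) :
    (∀ c : ℕ → ℝ, ∑ i ∈ range 10, Y i * c i = Y v * c v +
      (Y ((t.erase v).getD 0 0) * c ((t.erase v).getD 0 0) +
        Y ((t.erase v).getD 1 0) * c ((t.erase v).getD 1 0))) ∧
    (∀ i, i ≠ v → i ≠ (t.erase v).getD 0 0 → i ≠ (t.erase v).getD 1 0 → Y i = 0) ∧
    (t.erase v).getD 0 0 ≠ (t.erase v).getD 1 0 ∧ (t.erase v).getD 0 0 ≠ v ∧
    (t.erase v).getD 1 0 ≠ v := by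
  obtain ⟨h3, hn, h10⟩ := triangles_spec t ht
  have hlen : (t.erase v).length = 2 := by rw [List.length_erase_of_mem hv]; omega
  have hperm := List.perm_cons_erase hv
  obtain ⟨a, b, hab⟩ := List.length_eq_two.mp hlen
  rw [hab] at hperm ⊢
  have hnd := hperm.nodup_iff.mp hn
  simp only [List.nodup_cons, List.mem_cons, List.not_mem_nil, or_false, not_or, not_false_eq_true,
    and_true, List.nodup_nil] at hnd
  obtain ⟨⟨hva, hvb⟩, hne⟩ := hnd
  have hmem : ∀ i, i ∈ t ↔ i = v ∨ i = a ∨ i = b := by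
    intro i; rw [hperm.mem_iff]; simp
  simp only [List.getD_cons_zero, List.getD_cons_succ]
  refine ⟨fun c => ?_, fun i h1 h2 h3 => ?_, hne, Ne.symm hva, Ne.symm hvb⟩
  · rw [← Finset.sum_subset (s₁ := {v, a, b})]
    · rw [Finset.sum_insert (by simp [hva, hvb]), Finset.sum_insert (by simp [hne]), Finset.sum_singleton]
    · intro i hi
      simp only [Finset.mem_insert, Finset.mem_singleton] at hi
      exact mem_range.mpr (h10 i ((hmem i).mpr hi))
    · intro i _ hi
      simp only [Finset.mem_insert, Finset.mem_singleton] at hi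
      rw [← hmem] at hi
      have : Y i = 0 := by_contra fun h => hi (hY i h)
      rw [this, zero_mul]
  · by_contra h
    have := (hmem i).mp (hY i h)
    tauto

/-- The positions of the vertices in space. -/
noncomputable def position (v : Fin 10) : EuclideanSpace ℝ (Fin 3) :=
  WithLp.toLp 2 fun k => (coord v k : ℝ)

theorem linearMapOfVertices_position (x : Fin 10 → ℝ) (k : Fin 3) :
    AbstractSimplicialComplex.linearMapOfVertices position x k =
      ∑ i ∈ range 10, extend x i * (coord i k : ℝ) := by
  rw [sum_extend_mul x fun i => (coord i k : ℝ)]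
  simp [AbstractSimplicialComplex.linearMapOfVertices, position]

/-- The open star of a vertex v with positive coordinate is a neighbourhood on which the map is
injective. Subtracting the position of v, which is possible since the coordinates sum to 1, turns
equality of images into an equation between edge vectors. The coordinate at v is recovered from the
sum. -/
theorem isPolyhedralImmersion_position : tenVertexComplex.IsPolyhedralImmersion position := by
  intro x
  obtain ⟨v, hv⟩ : ∃ v, 0 < x.1 v := by
    by_contra hcon
    push Not at hcon
    have h1 := x.2.1.2
    have : ∑ i, x.1 i ≤ 0 := Finset.sum_nonpos fun i _ => hcon i
    linarith
  refine ⟨{y | 0 < y.1 v}, ?_, ?_⟩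
  · exact (isOpen_lt continuous_const ((continuous_apply v).comp continuous_subtype_val)).mem_nhds hv
  · intro y hy z hz h
    obtain ⟨⟨hy0, hy1⟩, t, ht, hyt⟩ := mem_space_tenVertexComplex.mp y.2
    obtain ⟨⟨hz0, hz1⟩, u, hu, hzu⟩ := mem_space_tenVertexComplex.mp z.2
    have hvt : (v : ℕ) ∈ t := hyt v (ne_of_gt hy)
    have hvu : (v : ℕ) ∈ u := hzu v (ne_of_gt hz)
    have hnn : ∀ {x : Fin 10 → ℝ}, (∀ i, 0 ≤ x i) → ∀ i, 0 ≤ extend x i := by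
      intro x hx i
      unfold extend; split_ifs
      · exact hx _
      · exact le_rfl
    have hsupp : ∀ {x : Fin 10 → ℝ} {t : List ℕ}, (∀ v, x v ≠ 0 → (v : ℕ) ∈ t) →
        ∀ i, extend x i ≠ 0 → i ∈ t := by
      intro x t hx i hi
      obtain ⟨hi', h'⟩ := extend_ne_zero hi
      exact hx _ h'
    obtain ⟨sY, zY, hab, hav, hbv⟩ := sum_range_eq_of_support ht hvt (hsupp hyt)
    obtain ⟨sZ, zZ, hcd, hcv, hdv⟩ := sum_range_eq_of_support hu hvu (hsupp hzu)
    have oneY := sY 1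
    have oneZ := sZ 1
    rw [sum_extend_mul y.1 1] at oneY
    rw [sum_extend_mul z.1 1] at oneZ
    simp only [Pi.one_apply, mul_one] at oneY oneZ
    rw [hy1] at oneY
    rw [hz1] at oneZ
    have key := eq_of_starDisjoint (starDisjoint_of_mem t ht u hu v hvt hvu) (hnn hy0) (hnn hz0) zY zZ
      hab hcd hav hbv hcv hdv (fun k hk => by
        have hk' := congrFun (congrArg (fun w : EuclideanSpace ℝ (Fin 3) => (w : Fin 3 → ℝ)) h) ⟨k, hk⟩
        simp only [linearMapOfVertices_position] at hk'
        rw [sY, sZ] at hk'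
        simp only [edgeVec, Int.cast_sub]
        linear_combination hk' - (coord v k : ℝ) * (oneZ.symm.trans oneY).symm)
    apply Subtype.ext
    have hne : ∀ i : Fin 10, i ≠ v → y.1 i = z.1 i := by
      intro i hi
      have := key i (fun h => hi (Fin.ext h))
      rwa [extend_val, extend_val] at this
    funext i
    by_cases hi : i = v
    · rw [hi]
      have e1 := Finset.add_sum_erase univ y.1 (mem_univ v)
      have e2 := Finset.add_sum_erase univ z.1 (mem_univ v)
      have e3 : ∑ i ∈ univ.erase v, y.1 i = ∑ i ∈ univ.erase v, z.1 i :=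
        Finset.sum_congr rfl fun i hi => hne i (Finset.ne_of_mem_erase hi)
      rw [hy1] at e1
      rw [hz1] at e2
      linarith
    · exact hne i hi

end FacetList

/-! ### The half-turn symmetry -/

namespace FacetList

/-- The involution of the vertices that exchanges `2 * i` and `2 * i + 1`. -/
def swapVertices : Equiv.Perm (Fin 10) :=
  Function.Involutive.toPerm ![1, 0, 3, 2, 5, 4, 7, 6, 9, 8] (fun x => by revert x; decide)

/-- The half-turn about the third coordinate axis. -/
noncomputable def halfTurn : EuclideanSpace ℝ (Fin 3) ≃ₗᵢ[ℝ] EuclideanSpace ℝ (Fin 3) :=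
  LinearIsometryEquiv.piLpCongrRight 2 fun i =>
    if i = 2 then LinearIsometryEquiv.refl ℝ ℝ else LinearIsometryEquiv.neg ℝ

theorem halfTurn_apply (x : EuclideanSpace ℝ (Fin 3)) (i : Fin 3) :
    halfTurn x i = if i = 2 then x i else - x i := by
  simp only [halfTurn, LinearIsometryEquiv.piLpCongrRight_apply]
  split_ifs <;> simp_all

theorem det_halfTurn :
    LinearMap.det (halfTurn : EuclideanSpace ℝ (Fin 3) →ₗ[ℝ] EuclideanSpace ℝ (Fin 3)) = 1 := by
  rw [← LinearMap.det_toMatrix (EuclideanSpace.basisFun (Fin 3) ℝ).toBasis, Matrix.det_fin_three]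
  simp [LinearMap.toMatrix_apply, halfTurn_apply]

theorem isRotationOfOrder_halfTurn : IsRotationOfOrder 2 halfTurn.toAffineIsometryEquiv := by
  refine ⟨⟨0, by simp⟩, ?_, ?_⟩
  · simpa using det_halfTurn
  · refine orderOf_eq_prime ?_ fun h => ?_
    · ext x i
      simp only [sq, AffineIsometryEquiv.coe_mul, Function.comp_apply,
        LinearIsometryEquiv.coe_toAffineIsometryEquiv, halfTurn_apply, AffineIsometryEquiv.coe_one, id]
      split_ifs <;> simp
    · have h' := congrArg (fun f : EuclideanSpace ℝ (Fin 3) ≃ᵃⁱ[ℝ] EuclideanSpace ℝ (Fin 3) =>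
        f (EuclideanSpace.single 0 1) 0) h
      simp only [LinearIsometryEquiv.coe_toAffineIsometryEquiv, halfTurn_apply] at h'
      norm_num at h'
      exact absurd h' (by decide)

theorem isAutomorphism_swapVertices : tenVertexComplex.IsAutomorphism swapVertices := by
  have key : ∀ t ∈ triangles, ∃ u ∈ triangles, ∀ i : Fin 10, (i : ℕ) ∈ t →
      ((swapVertices i : Fin 10) : ℕ) ∈ u := by decide +kernel
  have inv : ∀ i, swapVertices (swapVertices i) = i := by decide
  intro s
  constructor
  · rintro ⟨hs, t, ht, h⟩
    obtain ⟨u, hu, htu⟩ := key t ht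
    refine ⟨hs.map, u, hu, fun i hi => ?_⟩
    obtain ⟨j, hj, rfl⟩ := Finset.mem_map.mp hi
    exact htu j (h j hj)
  · rintro ⟨hs, t, ht, h⟩
    obtain ⟨u, hu, htu⟩ := key t ht
    refine ⟨Finset.map_nonempty.mp hs, u, hu, fun i hi => ?_⟩
    have := htu _ (h _ (Finset.mem_map_of_mem _ hi))
    rwa [Equiv.coe_toEmbedding, inv] at this

theorem halfTurn_position (v : Fin 10) : halfTurn (position v) = position (swapVertices v) := by
  have key : ∀ v : Fin 10, ∀ k : Fin 3, coord (swapVertices v : Fin 10) k =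
      if k = 2 then coord v k else - coord v k := by decide
  ext k
  rw [halfTurn_apply]
  simp only [position]
  rw [key]
  split_ifs <;> simp

theorem hasRotationalSymmetry_position : tenVertexComplex.HasRotationalSymmetry position 2 := by
  refine ⟨_, isRotationOfOrder_halfTurn, swapVertices, isAutomorphism_swapVertices, fun x _ => ?_⟩
  simp only [AbstractSimplicialComplex.linearMapOfVertices,
    LinearIsometryEquiv.coe_toAffineIsometryEquiv, map_sum, map_smul, halfTurn_position]
  exact Fintype.sum_equiv swapVertices _ _ fun v => by simp

end FacetList

/-! ### Invariance of domain in the plane -/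

namespace PlaneTopology

open unitInterval

/-- The exponential map is a covering of the punctured plane, so a logarithm at time 0 extends by
homotopy lifting. -/
theorem exists_log_of_homotopy {A : Type*} [TopologicalSpace A] {H : I × A → ℂ} (hH : Continuous H)
    (h0 : ∀ p, H p ≠ 0) {g : A → ℂ} (hg : Continuous g) (hlog : ∀ a, Complex.exp (g a) = H (0, a)) :
    ∃ g' : A → ℂ, Continuous g' ∧ ∀ a, Complex.exp (g' a) = H (1, a) := by
  let H' : C(I × A, {z : ℂ // z ≠ 0}) := ⟨fun p => ⟨H p, h0 p⟩, by fun_prop⟩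
  have h0' : ∀ a, H' (0, a) = (⟨_, (g a).exp_ne_zero⟩ : {z : ℂ // z ≠ 0}) := fun a =>
    Subtype.ext (hlog a).symm
  let L := Complex.isCoveringMap_exp.liftHomotopy H' ⟨g, hg⟩ h0'
  refine ⟨fun a => L (1, a), by fun_prop, fun a => ?_⟩
  have := congrFun (Complex.isCoveringMap_exp.liftHomotopy_lifts H' ⟨g, hg⟩ h0') (1, a)
  exact congrArg Subtype.val this

/-- The difference of the logarithm at antipodal points is a logarithm of -1, so its imaginary part
never vanishes. Half a turn further the difference changes its sign by periodicity, against the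
intermediate value theorem. -/
theorem not_exists_log_of_odd {f g : ℝ → ℂ} (hg : Continuous g) (hfg : ∀ t, Complex.exp (g t) = f t)
    (hf : ∀ t, f (t + Real.pi) = - f t) (hper : ∀ t, g (t + 2 * Real.pi) = g t) : False := by
  set d : ℝ → ℂ := fun t => g (t + Real.pi) - g t with hd
  have hdexp : ∀ t, Complex.exp (d t) = -1 := by
    intro t
    have : f t ≠ 0 := by rw [← hfg]; exact Complex.exp_ne_zero _
    rw [hd]
    simp only
    rw [Complex.exp_sub, hfg, hfg, hf, neg_div, div_self this]
  have hdim : ∀ t, (d t).im ≠ 0 := by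
    intro t h
    have h1 : d t = ((d t).re : ℂ) := Complex.ext rfl h
    have h2 := hdexp t
    rw [h1, ← Complex.ofReal_exp] at h2
    have h3 : Real.exp (d t).re = -1 := by exact_mod_cast h2
    linarith [Real.exp_pos (d t).re]
  have hanti : d Real.pi = - d 0 := by
    simp only [hd, zero_add]
    rw [show Real.pi + Real.pi = 0 + 2 * Real.pi by ring, hper]
    ring
  have hc : Continuous fun t => (d t).im := by fun_prop
  have hz : (0 : ℝ) ∈ Set.uIcc (d 0).im (d Real.pi).im := by
    rw [hanti, Complex.neg_im, Set.mem_uIcc]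
    rcases le_total 0 (d 0).im with h | h
    · right; constructor <;> linarith
    · left; constructor <;> linarith
  obtain ⟨t, -, ht⟩ := intermediate_value_uIcc hc.continuousOn hz
  exact hdim t ht

/-- A continuous injective map of a plane disc is open at the centre. -/
theorem image_closedBall_mem_nhds {f : ℂ → ℂ} {z₀ : ℂ} {r : ℝ} (hr : 0 < r)
    (hf : ContinuousOn f (Metric.closedBall z₀ r)) (hinj : Set.InjOn f (Metric.closedBall z₀ r)) :
    f '' Metric.closedBall z₀ r ∈ nhds (f z₀) := by
  by_contra hcon
  set K := Metric.closedBall z₀ r with hK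
  have hz₀ : z₀ ∈ K := Metric.mem_closedBall_self hr.le
  have hS : IsCompact (f '' Metric.sphere z₀ r) :=
    (isCompact_sphere z₀ r).image_of_continuousOn (hf.mono Metric.sphere_subset_closedBall)
  have hnot : f z₀ ∉ f '' Metric.sphere z₀ r := by
    rintro ⟨z, hz, h⟩
    have := hinj (Metric.sphere_subset_closedBall hz) hz₀ h
    rw [this] at hz
    simp at hz
    exact hr.ne hz
  obtain ⟨δ, hδ, hball⟩ := Metric.mem_nhds_iff.mp (hS.isClosed.isOpen_compl.mem_nhds hnot)
  obtain ⟨b, hbδ, hb⟩ : ∃ b ∈ Metric.ball (f z₀) δ, b ∉ f '' K := by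
    by_contra h
    push Not at h
    exact hcon (Filter.mem_of_superset (Metric.ball_mem_nhds _ hδ) h)
  have hb' : ∀ z ∈ K, f z - b ≠ 0 := fun z hz h => hb ⟨z, hz, sub_eq_zero.mp h⟩
  have hmem : ∀ (s : ℝ), |s| ≤ 1 → ∀ u : Circle, z₀ + s * r * (u : ℂ) ∈ K := by
    intro s hs u
    rw [hK, Metric.mem_closedBall, dist_eq_norm]
    simp only [add_sub_cancel_left, norm_mul, Circle.norm_coe, mul_one, Complex.norm_real,
      Real.norm_eq_abs, abs_of_pos hr]
    nlinarith
  have hI : ∀ s : I, |(s : ℝ)| ≤ 1 := fun s => by rw [abs_of_nonneg s.2.1]; exact s.2.2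
  have hI' : ∀ s : I, |(-(s : ℝ))| ≤ 1 := fun s => by rw [abs_neg]; exact hI s
  have hone : ∀ u : Circle, z₀ + r * (u : ℂ) ∈ K := fun u => by simpa using hmem 1 (by simp) u
  have hsph : ∀ u : Circle, f (z₀ + r * (u : ℂ)) ∈ f '' Metric.sphere z₀ r := fun u =>
    ⟨_, by
      rw [mem_sphere_iff_norm, add_sub_cancel_left, norm_mul, Circle.norm_coe, mul_one,
        Complex.norm_real, Real.norm_eq_abs, abs_of_pos hr], rfl⟩
  have c1 : Continuous fun p : I × Circle => f (z₀ + (p.1 : ℝ) * r * (p.2 : ℂ)) :=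
    hf.comp_continuous (by fun_prop) fun p => hmem _ (hI p.1) p.2
  have c2 : Continuous fun u : Circle => f (z₀ + r * (u : ℂ)) :=
    hf.comp_continuous (by fun_prop) hone
  have c3 : Continuous fun p : I × Circle => f (z₀ + (-(p.1 : ℝ) : ℝ) * r * (p.2 : ℂ)) :=
    hf.comp_continuous (by fun_prop) fun p => hmem _ (hI' p.1) p.2
  -- The value b close to f z₀ is omitted by f. Shrinking the circle to the centre shows that f - b
  -- has a logarithm on the boundary circle.
  obtain ⟨g₁, hg₁, hlog₁⟩ := exists_log_of_homotopy
    (H := fun p : I × Circle => f (z₀ + (p.1 : ℝ) * r * (p.2 : ℂ)) - b) (c1.sub continuous_const)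
    (fun p => hb' _ (hmem _ (hI p.1) p.2)) (g := fun _ => Complex.log (f z₀ - b)) continuous_const
    (fun a => by simp [Complex.exp_log (hb' z₀ hz₀)])
  -- Now b moves to f z₀ on a segment inside a ball that misses the image of the boundary circle, so
  -- the logarithm persists.
  obtain ⟨g₂, hg₂, hlog₂⟩ := exists_log_of_homotopy
    (H := fun p : I × Circle => f (z₀ + r * (p.2 : ℂ)) - (b + (p.1 : ℝ) * (f z₀ - b)))
    ((c2.comp continuous_snd).sub (by fun_prop))
    (fun p h => by
      refine hball (a := f (z₀ + r * (p.2 : ℂ))) ?_ (hsph p.2)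
      rw [Metric.mem_ball, dist_eq_norm, sub_eq_zero.mp h,
        show b + (p.1 : ℝ) * (f z₀ - b) - f z₀ = ((1 - (p.1 : ℝ) : ℝ) : ℂ) * (b - f z₀) by
          push_cast; ring, norm_mul, Complex.norm_real, Real.norm_eq_abs,
        abs_of_nonneg (by linarith [p.1.2.2])]
      have h1 : ‖b - f z₀‖ < δ := by rwa [← dist_eq_norm]
      nlinarith [p.1.2.1, p.1.2.2, norm_nonneg (b - f z₀)])
    hg₁ (fun a => by rw [hlog₁]; simp)
  -- Finally f z₀ is replaced by the value of f at points moving from the centre to the antipode;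
  -- injectivity keeps the difference nonzero. The final map is odd in u and still has a logarithm,
  -- which is impossible.
  obtain ⟨g₃, hg₃, hlog₃⟩ := exists_log_of_homotopy
    (H := fun p : I × Circle => f (z₀ + r * (p.2 : ℂ)) - f (z₀ + (-(p.1 : ℝ) : ℝ) * r * (p.2 : ℂ)))
    ((c2.comp continuous_snd).sub c3)
    (fun p h => by
      have h1 := hinj (hone p.2) (hmem _ (hI' p.1) p.2) (sub_eq_zero.mp h)
      have h2 : ((1 + (p.1 : ℝ) : ℝ) : ℂ) * (r * (p.2 : ℂ)) = 0 := by
        push_cast at h1 ⊢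
        linear_combination h1
      have h3 : (1 + (p.1 : ℝ) : ℝ) ≠ 0 := by linarith [p.1.2.1]
      have h4 : (r : ℂ) * (p.2 : ℂ) ≠ 0 :=
        mul_ne_zero (by exact_mod_cast hr.ne') p.2.coe_ne_zero
      rcases mul_eq_zero.mp h2 with h5 | h5
      · exact h3 (by exact_mod_cast h5)
      · exact h4 h5)
    hg₂ (fun a => by rw [hlog₂]; simp)
  refine not_exists_log_of_odd (g := fun t => g₃ (Circle.exp t)) (hg₃.comp Circle.exp.continuous)
    (fun t => hlog₃ _) (fun t => ?_) (fun t => ?_)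
  · simp [Circle.exp_add, Circle.coe_exp, Complex.exp_pi_mul_I]
  · simp [Circle.exp_add]

end PlaneTopology

theorem PlaneTopology.image_mem_nhds {f : ℂ → ℂ} {z₀ : ℂ} {D : Set ℂ} (hD : D ∈ nhds z₀)
    (hf : ContinuousOn f D) (hinj : Set.InjOn f D) : f '' D ∈ nhds (f z₀) := by
  obtain ⟨r, hr, hrD⟩ := Metric.nhds_basis_closedBall.mem_iff.mp hD
  exact Filter.mem_of_superset (image_closedBall_mem_nhds hr (hf.mono hrD) (hinj.mono hrD))
    (Set.image_mono hrD)

/-- Total functions on the ambient spaces are easier to compose with charts and coordinate functions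
than maps between subtypes. -/
theorem Homeomorph.exists_invOn {E F : Type*} [TopologicalSpace E] [TopologicalSpace F] [Nonempty E]
    [Nonempty F] {A : Set E} {B : Set F} (h : A ≃ₜ B) :
    ∃ (f : E → F) (g : F → E), ContinuousOn f A ∧ ContinuousOn g B ∧ Set.MapsTo f A B ∧
      Set.MapsTo g B A ∧ Set.LeftInvOn g f A ∧ Set.LeftInvOn f g B := by
  classical
  set f : E → F := fun x => if hx : x ∈ A then (h ⟨x, hx⟩ : F) else Classical.arbitrary F with hfdef
  set g : F → E := fun y => if hy : y ∈ B then (h.symm ⟨y, hy⟩ : E) else Classical.arbitrary E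
    with hgdef
  have hf : ∀ x : A, f x = h x := fun x => dif_pos x.2
  have hg : ∀ y : B, g y = h.symm y := fun y => dif_pos y.2
  refine ⟨f, g, ?_, ?_, fun x hx => ?_, fun y hy => ?_, fun x hx => ?_, fun y hy => ?_⟩
  · rw [continuousOn_iff_continuous_domRestrict]
    convert continuous_subtype_val.comp h.continuous using 1
    exact funext hf
  · rw [continuousOn_iff_continuous_domRestrict]
    convert continuous_subtype_val.comp h.symm.continuous using 1
    exact funext hg
  · exact hf ⟨x, hx⟩ ▸ Subtype.coe_prop _
  · exact hg ⟨y, hy⟩ ▸ Subtype.coe_prop _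
  · rw [hf ⟨x, hx⟩, hg, h.symm_apply_apply]
  · rw [hg ⟨y, hy⟩, hf, h.apply_symm_apply]

/-! ### Every edge of a closed triangulated surface is in two triangles -/

namespace AbstractSimplicialComplex

section

variable {V : Type*}

theorem mem_faces_of_subset (Δ : AbstractSimplicialComplex V) {s t : Finset V} (hs : s ∈ Δ.faces)
    (hts : t ⊆ s) (ht : t.Nonempty) : t ∈ Δ.faces :=
  (Δ.isRelLowerSet_faces hs).2 hts ht

theorem nonempty_of_mem_faces (Δ : AbstractSimplicialComplex V) {s : Finset V} (hs : s ∈ Δ.faces) :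
    s.Nonempty :=
  (Δ.isRelLowerSet_faces hs).1

/-- A chart of the union of two triangles with the common edge `u v` and the apices `w` and `x`. -/
def edgeChart (u v w x : V) (y : V → ℝ) : ℂ := ⟨y u - y v, y w - y x⟩

theorem continuous_edgeChart (u v w x : V) : Continuous (edgeChart u v w x) := by
  have : edgeChart u v w x = fun y => ((y u - y v : ℝ) : ℂ) + ((y w - y x : ℝ) : ℂ) * Complex.I := by
    funext y
    apply Complex.ext <;> simp [edgeChart]
  rw [this]
  fun_prop

theorem isOpen_star (u v : V) : IsOpen {y : V → ℝ | 0 < y u ∧ 0 < y v} :=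
  (isOpen_lt continuous_const (continuous_apply u)).inter
    (isOpen_lt continuous_const (continuous_apply v))

end

section

variable {V : Type*} [DecidableEq V]

/-- Every edge is in exactly two triangles. -/
def IsClosedAtEdges (Δ : AbstractSimplicialComplex V) : Prop :=
  ∀ u v, u ≠ v → {u, v} ∈ Δ.faces → ∃ w x, w ≠ x ∧ w ≠ u ∧ w ≠ v ∧ x ≠ u ∧ x ≠ v ∧
    ∀ z, z ≠ u → z ≠ v → ({u, v, z} ∈ Δ.faces ↔ z = w ∨ z = x)

/-- A parametrization of two triangles with the common edge `u v` and the apices `w` and `x`. -/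
noncomputable def page (u v w x : V) (z : ℂ) : V → ℝ :=
  Pi.single u ((1 - |z.im| + z.re) / 2) + Pi.single v ((1 - |z.im| - z.re) / 2) +
    Pi.single w (max z.im 0) + Pi.single x (max (-z.im) 0)

theorem continuous_page (u v w x : V) : Continuous (page u v w x) := by
  refine continuous_pi fun i => ?_
  simp only [page, Pi.add_apply, Pi.single_apply]
  have := Complex.continuous_re
  have := Complex.continuous_im
  refine Continuous.add (Continuous.add (Continuous.add ?_ ?_) ?_) ?_ <;> split_ifs <;> fun_prop

theorem edgeChart_page {u v w x : V} (huv : u ≠ v) (hwx : w ≠ x) (hwu : w ≠ u) (hwv : w ≠ v)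
    (hxu : x ≠ u) (hxv : x ≠ v) (z : ℂ) : edgeChart u v w x (page u v w x z) = z := by
  apply Complex.ext
  · simp [edgeChart, page, Pi.single_apply, huv, huv.symm, hwu.symm, hwv.symm, hxu.symm,
      hxv.symm]
    ring
  · simp [edgeChart, page, Pi.single_apply, hwx, hwx.symm, hwu, hwv, hxu, hxv]

theorem page_apply_of_ne {u v w x i : V} (hu : i ≠ u) (hv : i ≠ v) (hw : i ≠ w) (hx : i ≠ x)
    (z : ℂ) : page u v w x z i = 0 := by
  simp [page, hu, hv, hw, hx]

end

variable {V : Type*} [Fintype V] [DecidableEq V]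

theorem page_mem_space (Δ : AbstractSimplicialComplex V) {u v w x : V} (hw : {u, v, w} ∈ Δ.faces)
    (hx : {u, v, x} ∈ Δ.faces) {z : ℂ} (hz : |z.re| + |z.im| < 1) : page u v w x z ∈ Δ.space := by
  have h1 := abs_le.mp (le_refl |z.re|)
  refine ⟨⟨fun i => ?_, ?_⟩, ?_⟩
  · simp only [page, Pi.add_apply, Pi.single_apply]
    refine add_nonneg (add_nonneg (add_nonneg ?_ ?_) ?_) ?_ <;> split_ifs <;>
      first | exact le_rfl | exact le_max_right _ _ | linarith [h1.1, h1.2]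
  · simp only [page, Pi.add_apply, Finset.sum_add_distrib, Finset.sum_pi_single', Finset.mem_univ,
      if_true]
    rcases le_total 0 z.im with h | h
    · rw [max_eq_left h, max_eq_right (by linarith), abs_of_nonneg h]; ring
    · rw [max_eq_right h, max_eq_left (by linarith), abs_of_nonpos h]; ring
  · rcases le_total 0 z.im with h | h
    · refine ⟨_, hw, fun i hi => ?_⟩
      by_contra hcon
      simp only [mem_insert, mem_singleton, not_or] at hcon
      refine hi ?_
      simp [page, hcon, max_eq_right (neg_nonpos.mpr h)]
    · refine ⟨_, hx, fun i hi => ?_⟩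
      by_contra hcon
      simp only [mem_insert, mem_singleton, not_or] at hcon
      refine hi ?_
      simp [page, hcon, max_eq_right h]

theorem mem_star_cases (Δ : AbstractSimplicialComplex V) (hΔ : ∀ s ∈ Δ.faces, s.card ≤ 3) {u v : V}
    (huv : u ≠ v) {y : V → ℝ} (hy : y ∈ Δ.space) (hu : 0 < y u) (hv : 0 < y v) :
    (∃ m, m ≠ u ∧ m ≠ v ∧ {u, v, m} ∈ Δ.faces ∧ (∀ i, i ≠ u → i ≠ v → i ≠ m → y i = 0) ∧
      y u + y v + y m = 1) ∨ (∀ i, i ≠ u → i ≠ v → y i = 0) ∧ y u + y v = 1 := by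
  obtain ⟨⟨-, h1⟩, s, hs, hsupp⟩ := hy
  have hus := hsupp u hu.ne'
  have hvs := hsupp v hv.ne'
  by_cases hm : ∃ m ∈ s, m ≠ u ∧ m ≠ v
  · left
    obtain ⟨m, hms, hmu, hmv⟩ := hm
    have hcard : ({u, v, m} : Finset V).card = 3 :=
      Finset.card_eq_three.mpr ⟨u, v, m, huv, hmu.symm, hmv.symm, rfl⟩
    have hsub : ({u, v, m} : Finset V) ⊆ s := by
      intro i hi
      simp only [mem_insert, mem_singleton] at hi
      rcases hi with rfl | rfl | rfl <;> assumption
    have hseq := Finset.eq_of_subset_of_card_le hsub (by rw [hcard]; exact hΔ s hs)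
    have hzero : ∀ i, i ≠ u → i ≠ v → i ≠ m → y i = 0 := by
      intro i h1 h2 h3
      by_contra hne
      have := hsupp i hne
      rw [← hseq] at this
      simp [h1, h2, h3] at this
    refine ⟨m, hmu, hmv, hseq ▸ hs, hzero, ?_⟩
    rw [← h1, ← Finset.sum_subset (Finset.subset_univ {u, v, m}),
      Finset.sum_insert (by simp [huv, hmu.symm]), Finset.sum_insert (by simp [hmv.symm]),
      Finset.sum_singleton, add_assoc]
    intro i _ hi
    simp only [mem_insert, mem_singleton, not_or] at hi
    exact hzero i hi.1 hi.2.1 hi.2.2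
  · right
    push Not at hm
    have hzero : ∀ i, i ≠ u → i ≠ v → y i = 0 := by
      intro i h1 h2
      by_contra hne
      exact h2 (hm i (hsupp i hne) h1)
    refine ⟨hzero, ?_⟩
    rw [← h1, ← Finset.sum_subset (Finset.subset_univ {u, v}), Finset.sum_pair huv]
    intro i _ hi
    simp only [mem_insert, mem_singleton, not_or] at hi
    exact hzero i hi.1 hi.2

/-- With at most the two apices `w` and `x`, the open star of the edge is flattened onto the diamond
|re| + |im| < 1, one triangle above the real axis and one below. At least one apex coordinate
vanishes, so their difference determines both. -/
theorem page_edgeChart (Δ : AbstractSimplicialComplex V) (hΔ : ∀ s ∈ Δ.faces, s.card ≤ 3)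
    {u v w x : V} (huv : u ≠ v) (hwx : w ≠ x) (hwu : w ≠ u) (hwv : w ≠ v) (hxu : x ≠ u) (hxv : x ≠ v)
    (hlink : ∀ z, z ≠ u → z ≠ v → {u, v, z} ∈ Δ.faces → z = w ∨ z = x)
    {y : V → ℝ} (hy : y ∈ Δ.space) (hu : 0 < y u) (hv : 0 < y v) :
    page u v w x (edgeChart u v w x y) = y ∧
      |(edgeChart u v w x y).re| + |(edgeChart u v w x y).im| < 1 := by
  have h0 := hy.1.1
  have key : (∀ i, i ≠ u → i ≠ v → i ≠ w → i ≠ x → y i = 0) ∧ y u + y v + y w + y x = 1 ∧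
      (y w = 0 ∨ y x = 0) := by
    rcases mem_star_cases Δ hΔ huv hy hu hv with ⟨m, hmu, hmv, hm, hzero, hsum⟩ | ⟨hzero, hsum⟩
    · rcases hlink m hmu hmv hm with rfl | rfl
      · have hx0 := hzero x hxu hxv hwx.symm
        exact ⟨fun i h1 h2 h3 _ => hzero i h1 h2 h3, by rw [hx0, add_zero, hsum], Or.inr hx0⟩
      · have hw0 := hzero w hwu hwv hwx
        exact ⟨fun i h1 h2 _ h4 => hzero i h1 h2 h4, by rw [hw0, add_zero, hsum], Or.inl hw0⟩
    · have hw0 := hzero w hwu hwv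
      have hx0 := hzero x hxu hxv
      exact ⟨fun i h1 h2 _ _ => hzero i h1 h2, by rw [hw0, hx0, add_zero, add_zero, hsum], Or.inl hw0⟩
  obtain ⟨hzero, hsum, hwx0⟩ := key
  have hw0 := h0 w
  have hx0 := h0 x
  have habs : |y w - y x| = y w + y x := by
    rcases hwx0 with h | h <;> rw [h]
    · rw [zero_sub, abs_neg, abs_of_nonneg hx0, zero_add]
    · rw [sub_zero, abs_of_nonneg hw0, add_zero]
  constructor
  · funext i
    by_cases hiu : i = u
    · subst hiu
      simp [page, edgeChart, huv, hwu.symm, hxu.symm, habs]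
      linarith
    by_cases hiv : i = v
    · subst hiv
      simp [page, edgeChart, huv.symm, hwv.symm, hxv.symm, habs]
      linarith
    by_cases hiw : i = w
    · subst hiw
      simp only [page, edgeChart, Pi.add_apply, Pi.single_apply, hwu, hwv, hwx, if_false, if_true,
        zero_add, add_zero]
      rcases hwx0 with h | h <;> rw [h] <;> simp [hw0, hx0]
    by_cases hix : i = x
    · subst hix
      simp only [page, edgeChart, Pi.add_apply, Pi.single_apply, hxu, hxv, hwx.symm, if_false, if_true,
        zero_add, add_zero]
      rcases hwx0 with h | h <;> rw [h] <;> simp [hw0, hx0]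
    rw [page_apply_of_ne hiu hiv hiw hix, hzero i hiu hiv hiw hix]
  · simp only [edgeChart]
    rw [habs]
    have : |y u - y v| < y u + y v := abs_lt.mpr ⟨by linarith, by linarith⟩
    linarith

theorem isOpen_diamond : IsOpen {z : ℂ | |z.re| + |z.im| < 1} :=
  isOpen_lt (by have := Complex.continuous_re; have := Complex.continuous_im; fun_prop)
    continuous_const

/-- The point of the edge `u v` with the parameter `s`. -/
def edgePoint (u v : V) (s : ℝ) : V → ℝ := Pi.single u (1 - s) + Pi.single v s

theorem edgePoint_mem_space (Δ : AbstractSimplicialComplex V) {u v : V} (h : {u, v} ∈ Δ.faces)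
    {s : ℝ} (h0 : 0 ≤ s) (h1 : s ≤ 1) : edgePoint u v s ∈ Δ.space := by
  refine ⟨⟨fun i => ?_, ?_⟩, _, h, fun i hi => ?_⟩
  · simp only [edgePoint, Pi.add_apply, Pi.single_apply]
    refine add_nonneg ?_ ?_ <;> split_ifs <;> linarith
  · simp [edgePoint, Finset.sum_add_distrib]
  · by_contra hcon
    simp only [mem_insert, mem_singleton, not_or] at hcon
    exact hi (by simp [edgePoint, hcon])

section

variable {W : Type*} [Fintype W] [DecidableEq W] {Δ : AbstractSimplicialComplex V}
  {Γ : AbstractSimplicialComplex W} {f : (V → ℝ) → W → ℝ} {g : (W → ℝ) → V → ℝ}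

/-- All but finitely many points of an edge are mapped to interior points of triangles or edges. -/
theorem exists_edgePoint_map_pos (hf : Set.MapsTo f Δ.space Γ.space)
    (hinj : Set.InjOn f Δ.space) {u v : V} (huv : u ≠ v) (he : {u, v} ∈ Δ.faces) :
    ∃ s : ℝ, 0 < s ∧ s < 1 ∧ ∃ a b : W, a ≠ b ∧ 0 < f (edgePoint u v s) a ∧
      0 < f (edgePoint u v s) b := by
  by_contra hcon
  push Not at hcon
  have hmem : ∀ s ∈ Set.Ioo (0 : ℝ) 1, edgePoint u v s ∈ Δ.space := fun s hs =>
    edgePoint_mem_space Δ he hs.1.le hs.2.le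
  -- A point with only one positive coordinate is a vertex. Infinitely many points of the edge
  -- cannot be mapped injectively to the finitely many vertices.
  have hvertex : ∀ s ∈ Set.Ioo (0 : ℝ) 1, ∃ a : W, f (edgePoint u v s) = Pi.single a 1 := by
    intro s hs
    obtain ⟨⟨h0, h1⟩, -⟩ := hf (hmem s hs)
    obtain ⟨a, ha⟩ : ∃ a, 0 < f (edgePoint u v s) a := by
      by_contra hc
      push Not at hc
      have : ∑ i, f (edgePoint u v s) i ≤ 0 := Finset.sum_nonpos fun i _ => hc i
      linarith
    have hz : ∀ b, b ≠ a → f (edgePoint u v s) b = 0 := fun b hb =>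
      le_antisymm (hcon s hs.1 hs.2 a b hb.symm ha) (h0 b)
    refine ⟨a, funext fun b => ?_⟩
    by_cases hb : b = a
    · subst hb
      rw [Pi.single_eq_same, ← h1]
      exact (Finset.sum_eq_single b (fun i _ hi => hz i hi) (by simp)).symm
    · rw [hz b hb, Pi.single_eq_of_ne hb]
  have hinj' : Set.InjOn (fun s => f (edgePoint u v s)) (Set.Ioo (0 : ℝ) 1) := by
    intro s hs t ht hst
    have := congrFun (hinj (hmem s hs) (hmem t ht) hst) v
    simpa [edgePoint, huv] using this
  have hfin : (Set.Ioo (0 : ℝ) 1).Finite := by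
    refine Set.Finite.of_finite_image ?_ hinj'
    refine (Set.finite_range fun a : W => (Pi.single a 1 : W → ℝ)).subset ?_
    rintro - ⟨s, hs, rfl⟩
    obtain ⟨a, ha⟩ := hvertex s hs
    exact ⟨a, ha.symm⟩
  exact (Set.Ioo_infinite (by norm_num : (0 : ℝ) < 1)) hfin

/-- An edge with three triangles is not in the interior of a surface. -/
theorem not_three_triangles (hΓ : ∀ s ∈ Γ.faces, s.card ≤ 3) (hΓc : Γ.IsClosedAtEdges)
    (hf : Set.MapsTo f Δ.space Γ.space) (hinj : Set.InjOn f Δ.space)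
    (hfc : ContinuousOn f Δ.space) {u v w x m : V} (huv : u ≠ v) (hwx : w ≠ x) (hwu : w ≠ u)
    (hwv : w ≠ v) (hxu : x ≠ u) (hxv : x ≠ v) (hmu : m ≠ u) (hmv : m ≠ v) (hmw : m ≠ w) (hmx : m ≠ x)
    (hw : {u, v, w} ∈ Δ.faces) (hx : {u, v, x} ∈ Δ.faces) (hm : {u, v, m} ∈ Δ.faces) : False := by
  have he : {u, v} ∈ Δ.faces := Δ.mem_faces_of_subset hw (by grind) (by simp)
  obtain ⟨s, hs0, hs1, a, b, hab, ha, hb⟩ := exists_edgePoint_map_pos hf hinj huv he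
  set p := edgePoint u v s with hp
  have hpS : p ∈ Δ.space := edgePoint_mem_space Δ he hs0.le hs1.le
  have hab_face : {a, b} ∈ Γ.faces := by
    obtain ⟨-, t, ht, hsupp⟩ := hf hpS
    refine Γ.mem_faces_of_subset ht ?_ (by simp)
    intro i hi
    simp only [mem_insert, mem_singleton] at hi
    rcases hi with rfl | rfl
    · exact hsupp _ ha.ne'
    · exact hsupp _ hb.ne'
  obtain ⟨c, d, hcd, hca, hcb, hda, hdb, hlink⟩ := hΓc a b hab hab_face
  have hchart : Set.InjOn (edgeChart a b c d) (Γ.space ∩ {y | 0 < y a ∧ 0 < y b}) := by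
    intro y hy y' hy' h
    have h1 := (page_edgeChart Γ hΓ hab hcd hca hcb hda hdb (fun z h1 h2 => (hlink z h1 h2).mp)
      hy.1 hy.2.1 hy.2.2).1
    have h2 := (page_edgeChart Γ hΓ hab hcd hca hcb hda hdb (fun z h1 h2 => (hlink z h1 h2).mp)
      hy'.1 hy'.2.1 hy'.2.2).1
    rw [← h1, ← h2, h]
  set z₀ : ℂ := ⟨1 - 2 * s, 0⟩ with hz₀
  have hpz : page u v w x z₀ = p := by
    funext i
    simp only [page, hp, edgePoint, hz₀, abs_zero, neg_zero, max_self, Pi.single_zero, add_zero,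
      sub_zero]
    ring_nf
  have hz₀D : z₀ ∈ {z : ℂ | |z.re| + |z.im| < 1} := by
    simp only [Set.mem_ofPred_eq, hz₀, abs_zero, add_zero]
    exact abs_lt.mpr ⟨by linarith, by linarith⟩
  have hcont : ContinuousOn (fun z => f (page u v w x z)) {z : ℂ | |z.re| + |z.im| < 1} :=
    hfc.comp (continuous_page u v w x).continuousOn fun z hz => page_mem_space Δ hw hx hz
  set D := {z : ℂ | |z.re| + |z.im| < 1} ∩ (fun z => f (page u v w x z)) ⁻¹' {y | 0 < y a ∧ 0 < y b}
    with hD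
  have hDn : D ∈ nhds z₀ := by
    refine (hcont.isOpen_inter_preimage isOpen_diamond (isOpen_star a b)).mem_nhds ⟨hz₀D, ?_⟩
    simp only [Set.mem_preimage, hpz]
    exact ⟨ha, hb⟩
  -- In the chart of Γ at the edge a b, the image of the two pages with apices w and x already fills
  -- a neighbourhood.
  have hnhds := PlaneTopology.image_mem_nhds
    (f := fun z => edgeChart a b c d (f (page u v w x z))) hDn
    ((continuous_edgeChart a b c d).comp_continuousOn (hcont.mono Set.inter_subset_left)) (by
      intro z hz z' hz' h
      have h1 := hchart ⟨hf (page_mem_space Δ hw hx hz.1), hz.2⟩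
        ⟨hf (page_mem_space Δ hw hx hz'.1), hz'.2⟩ h
      have h2 := hinj (page_mem_space Δ hw hx hz.1) (page_mem_space Δ hw hx hz'.1) h1
      rw [← edgeChart_page huv hwx hwu hwv hxu hxv z, h2,
        edgeChart_page huv hwx hwu hwv hxu hxv])
  simp only [hpz] at hnhds
  -- The path enters the third triangle from p. For small t > 0 its image lies in that
  -- neighbourhood, so by injectivity q t would be on the first two pages, where the coordinate at m
  -- is zero; but it equals t.
  set q : ℝ → V → ℝ := fun t => (1 - t) • p + t • Pi.single m 1 with hq
  have hqc : Continuous q := by fun_prop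
  have hqS : ∀ t ∈ Set.Icc (0 : ℝ) 1, q t ∈ Δ.space := by
    intro t ht
    refine ⟨?_, _, hm, fun i hi => ?_⟩
    · exact (convex_stdSimplex ℝ V) hpS.1 (single_mem_stdSimplex ℝ m) (by linarith [ht.2]) ht.1
        (by ring)
    · by_contra hcon
      simp only [mem_insert, mem_singleton, not_or] at hcon
      exact hi (by simp [hq, hp, edgePoint, hcon])
  have hq0 : q 0 = p := by simp [hq]
  have hfq : ContinuousOn (fun t => f (q t)) (Set.Icc (0 : ℝ) 1) :=
    hfc.comp hqc.continuousOn hqS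
  have hfq0 : ContinuousWithinAt (fun t => f (q t)) (Set.Icc (0 : ℝ) 1) 0 := hfq 0 (by simp)
  have e1 := hfq0.preimage_mem_nhdsWithin (t := {y | 0 < y a ∧ 0 < y b})
    ((isOpen_star a b).mem_nhds (by simp only [hq0]; exact ⟨ha, hb⟩))
  have e2 := ((continuous_edgeChart a b c d).continuousAt.comp_continuousWithinAt
    hfq0).preimage_mem_nhdsWithin (by simpa only [Function.comp_apply, hq0] using hnhds)
  have e3 := Filter.inter_mem e1 e2
  rw [mem_nhdsWithin_iff_exists_mem_nhds_inter] at e3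
  obtain ⟨N, hN, hNsub⟩ := e3
  obtain ⟨ε, hε, hεN⟩ := Metric.mem_nhds_iff.mp hN
  have hpos : 0 < min (ε / 2) 1 := by positivity
  have ht01 : min (ε / 2) 1 ∈ Set.Icc (0 : ℝ) 1 := ⟨hpos.le, min_le_right _ _⟩
  obtain ⟨hU, z, hz, hzeq⟩ := hNsub ⟨hεN (a := min (ε / 2) 1) (by
    rw [Metric.mem_ball, Real.dist_eq, sub_zero, abs_of_pos hpos]
    linarith [min_le_left (ε / 2) 1]), ht01⟩
  have h1 := hchart ⟨hf (page_mem_space Δ hw hx hz.1), hz.2⟩ ⟨hf (hqS _ ht01), hU⟩ hzeq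
  have h2 := congrFun (hinj (page_mem_space Δ hw hx hz.1) (hqS _ ht01) h1) m
  rw [page_apply_of_ne hmu hmv hmw hmx] at h2
  simp [hq, hp, edgePoint, hmu, hmv] at h2
  rw [← h2] at hpos
  exact lt_irrefl _ hpos

/-- An edge with at most one triangle is not in the interior of a surface. -/
theorem exists_two_triangles (hΔ : ∀ s ∈ Δ.faces, s.card ≤ 3) (hΓ : ∀ s ∈ Γ.faces, s.card ≤ 3)
    (hΓc : Γ.IsClosedAtEdges)
    (hf : Set.MapsTo f Δ.space Γ.space) (hg : Set.MapsTo g Γ.space Δ.space)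
    (hgf : Set.LeftInvOn g f Δ.space) (hginj : Set.InjOn g Γ.space) (hgc : ContinuousOn g Γ.space)
    {u v : V} (huv : u ≠ v) (he : {u, v} ∈ Δ.faces) :
    ∃ w x, w ≠ x ∧ w ≠ u ∧ w ≠ v ∧ x ≠ u ∧ x ≠ v ∧ {u, v, w} ∈ Δ.faces ∧ {u, v, x} ∈ Δ.faces := by
  by_contra hcon
  push Not at hcon
  obtain ⟨s, hs0, hs1, a, b, hab, ha, hb⟩ := exists_edgePoint_map_pos hf hgf.injOn huv he
  set p := edgePoint u v s with hp
  have hpS : p ∈ Δ.space := edgePoint_mem_space Δ he hs0.le hs1.le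
  have hab_face : {a, b} ∈ Γ.faces := by
    obtain ⟨-, t, ht, hsupp⟩ := hf hpS
    refine Γ.mem_faces_of_subset ht ?_ (by simp)
    intro i hi
    simp only [mem_insert, mem_singleton] at hi
    rcases hi with rfl | rfl
    · exact hsupp _ ha.ne'
    · exact hsupp _ hb.ne'
  obtain ⟨c, d, hcd, hca, hcb, hda, hdb, hlink⟩ := hΓc a b hab hab_face
  have hcΓ := (hlink c hca hcb).mpr (Or.inl rfl)
  have hdΓ := (hlink d hda hdb).mpr (Or.inr rfl)
  obtain ⟨hpz, hz₀D⟩ := page_edgeChart Γ hΓ hab hcd hca hcb hda hdb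
    (fun z h1 h2 => (hlink z h1 h2).mp) (hf hpS) ha hb
  set z₀ := edgeChart a b c d (f p) with hz₀
  have hcont : ContinuousOn (fun z => g (page a b c d z)) {z : ℂ | |z.re| + |z.im| < 1} :=
    hgc.comp (continuous_page a b c d).continuousOn fun z hz => page_mem_space Γ hcΓ hdΓ hz
  have hgz₀ : g (page a b c d z₀) = p := by rw [hpz, hgf hpS]
  have hpu : p u = 1 - s := by simp [hp, edgePoint, huv]
  have hpv : p v = s := by simp [hp, edgePoint, huv.symm]
  set D := {z : ℂ | |z.re| + |z.im| < 1} ∩ (fun z => g (page a b c d z)) ⁻¹' {y | 0 < y u ∧ 0 < y v}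
    with hD
  have hDn : D ∈ nhds z₀ := by
    refine (hcont.isOpen_inter_preimage isOpen_diamond (isOpen_star u v)).mem_nhds ⟨hz₀D, ?_⟩
    simp only [Set.mem_preimage, hgz₀, Set.mem_ofPred_eq, hpu, hpv]
    exact ⟨by linarith, hs0⟩
  -- With at most one triangle at the edge, χ is injective on the open star and maps it into the
  -- closed upper half-plane, with p on the real axis.
  set χ : (V → ℝ) → ℂ := fun y => ((y u - y v : ℝ) : ℂ) + ((1 - y u - y v : ℝ) : ℂ) * Complex.I with hχ
  have hχc : Continuous χ := by fun_prop
  have hχre : ∀ y, (χ y).re = y u - y v := fun y => by simp [hχ]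
  have hχim : ∀ y, (χ y).im = 1 - y u - y v := fun y => by simp [hχ]
  have hχinj : Set.InjOn χ (Δ.space ∩ {y | 0 < y u ∧ 0 < y v}) := by
    intro y hy y' hy' h
    have h1 : y u - y v = y' u - y' v := by rw [← hχre, ← hχre, h]
    have h2 : 1 - y u - y v = 1 - y' u - y' v := by rw [← hχim, ← hχim, h]
    have hu : y u = y' u := by linarith
    have hv : y v = y' v := by linarith
    funext i
    by_cases hiu : i = u
    · rw [hiu, hu]
    by_cases hiv : i = v
    · rw [hiv, hv]
    rcases mem_star_cases Δ hΔ huv hy.1 hy.2.1 hy.2.2 with ⟨m, hmu, hmv, hm, hzero, hsum⟩ | ⟨hzero, hsum⟩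
    · rcases mem_star_cases Δ hΔ huv hy'.1 hy'.2.1 hy'.2.2 with
        ⟨m', hmu', hmv', hm', hzero', hsum'⟩ | ⟨hzero', hsum'⟩
      · have hmm : m = m' := by
          by_contra hne
          exact hcon m m' hne hmu hmv hmu' hmv' hm hm'
        subst hmm
        by_cases him : i = m
        · rw [him]; linarith
        · rw [hzero i hiu hiv him, hzero' i hiu hiv him]
      · by_cases him : i = m
        · rw [him, hzero' m hmu hmv]; linarith
        · rw [hzero i hiu hiv him, hzero' i hiu hiv]
    · rcases mem_star_cases Δ hΔ huv hy'.1 hy'.2.1 hy'.2.2 with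
        ⟨m', hmu', hmv', hm', hzero', hsum'⟩ | ⟨hzero', hsum'⟩
      · by_cases him : i = m'
        · rw [him, hzero m' hmu' hmv']; linarith
        · rw [hzero i hiu hiv, hzero' i hiu hiv him]
      · rw [hzero i hiu hiv, hzero' i hiu hiv]
  have hnhds := PlaneTopology.image_mem_nhds (f := fun z => χ (g (page a b c d z))) hDn
    (hχc.comp_continuousOn (hcont.mono Set.inter_subset_left)) (by
      intro z hz z' hz' h
      have h1 := hχinj ⟨hg (page_mem_space Γ hcΓ hdΓ hz.1), hz.2⟩
        ⟨hg (page_mem_space Γ hcΓ hdΓ hz'.1), hz'.2⟩ h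
      have h2 := hginj (page_mem_space Γ hcΓ hdΓ hz.1) (page_mem_space Γ hcΓ hdΓ hz'.1) h1
      rw [← edgeChart_page hab hcd hca hcb hda hdb z, h2, edgeChart_page hab hcd hca hcb hda hdb])
  simp only [hgz₀] at hnhds
  obtain ⟨ε, hε, hεN⟩ := Metric.mem_nhds_iff.mp hnhds
  -- By invariance of domain the image would contain a point just below the real axis.
  obtain ⟨z, hz, hzeq⟩ := hεN (a := χ p - ((ε / 2 : ℝ) : ℂ) * Complex.I) (by
    rw [Metric.mem_ball, dist_eq_norm, sub_sub_cancel_left, norm_neg, norm_mul, Complex.norm_I, mul_one,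
      Complex.norm_real, Real.norm_eq_abs, abs_of_pos (by linarith)]
    linarith)
  have him := congrArg Complex.im hzeq
  simp only [hχim, Complex.sub_im, hpu, hpv, Complex.im_ofReal_mul, Complex.I_im,
    mul_one] at him
  have hmem := hg (page_mem_space Γ hcΓ hdΓ hz.1)
  have hnn := hmem.1.1
  rcases mem_star_cases Δ hΔ huv hmem hz.2.1 hz.2.2 with ⟨m, -, -, -, -, hsum⟩ | ⟨-, hsum⟩
  · linarith [hnn m]
  · linarith

/-- Two triangles at an edge exist because a half-plane is not locally a plane at its boundary, and
a third one cannot exist because two pages already form an open piece of the surface. -/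
theorem isClosedAtEdges_of_homeomorph (hΔ : ∀ s ∈ Δ.faces, s.card ≤ 3)
    (hΓ : ∀ s ∈ Γ.faces, s.card ≤ 3) (hΓc : Γ.IsClosedAtEdges) (h : Δ.space ≃ₜ Γ.space) :
    Δ.IsClosedAtEdges := by
  obtain ⟨f, g, hfc, hgc, hf, hg, hgf, hfg⟩ := h.exists_invOn
  intro u v huv he
  obtain ⟨w, x, hwx, hwu, hwv, hxu, hxv, hw, hx⟩ :=
    exists_two_triangles hΔ hΓ hΓc hf hg hgf hfg.injOn hgc huv he
  refine ⟨w, x, hwx, hwu, hwv, hxu, hxv, fun z hzu hzv => ⟨fun hz => ?_, ?_⟩⟩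
  · by_contra hne
    push Not at hne
    exact not_three_triangles hΓ hΓc hf hgf.injOn hfc huv hwx hwu hwv hxu hxv hzu hzv hne.1 hne.2
      hw hx hz
  · rintro (rfl | rfl) <;> assumption

end

end AbstractSimplicialComplex

/-! ### Line fields and their continuous sections -/

/-- A field of lines on `K`, represented by a non-vanishing vector field that is continuous up to
sign. -/
def IsLineField {E ι : Type*} [TopologicalSpace E] (K : Set E) (v : E → ι → ℝ) : Prop :=
  (∀ x ∈ K, v x ≠ 0) ∧ ∀ i j, ContinuousOn (fun x => v x i * v x j) K

namespace IsLineField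

variable {E ι κ : Type*} [Fintype ι] [Fintype κ]

theorem sum_sq_pos {v : ι → ℝ} (hv : v ≠ 0) : 0 < ∑ i, v i * v i := by
  obtain ⟨i, hi⟩ := Function.ne_iff.mp hv
  exact Finset.sum_pos' (fun j _ => mul_self_nonneg _) ⟨i, mem_univ i, mul_self_pos.mpr hi⟩

/-- Products of the signs that make line fields continuous are constant on connected sets. -/
theorem sign_const [TopologicalSpace E] {K : Set E} (hK : IsPreconnected K) {v : E → ι → ℝ}
    {v' : E → κ → ℝ} (hv : ∀ x ∈ K, v x ≠ 0) (hv' : ∀ x ∈ K, v' x ≠ 0) {η ε ε' : E → ℤˣ}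
    (hη : ∀ i j, ContinuousOn (fun x => ((η x : ℤ) : ℝ) * v x i * v' x j) K)
    (hε : ∀ i, ContinuousOn (fun x => ((ε x : ℤ) : ℝ) * v x i) K)
    (hε' : ∀ i, ContinuousOn (fun x => ((ε' x : ℤ) : ℝ) * v' x i) K) {x y : E} (hx : x ∈ K)
    (hy : y ∈ K) : η x * ε x * ε' x = η y * ε y * ε' y := by
  -- F is the inner product of two continuous multiples of the tensor v ⊗ v'. It equals the product
  -- of the signs times |v|²|v'|², so it never vanishes and its sign is constant.
  set F : E → ℝ := fun x => ∑ i, ∑ j, (((η x : ℤ) : ℝ) * v x i * v' x j) *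
    ((((ε x : ℤ) : ℝ) * v x i) * (((ε' x : ℤ) : ℝ) * v' x j)) with hF
  have hFc : ContinuousOn F K := by
    refine continuousOn_finsetSum _ fun i _ => continuousOn_finsetSum _ fun j _ => ?_
    exact (hη i j).mul ((hε i).mul (hε' j))
  have hFe : ∀ x, F x = (((η x * ε x * ε' x : ℤˣ) : ℤ) : ℝ) *
      ((∑ i, v x i * v x i) * ∑ j, v' x j * v' x j) := by
    intro x
    rw [Finset.sum_mul_sum, Finset.mul_sum]
    refine Finset.sum_congr rfl fun i _ => ?_
    rw [Finset.mul_sum]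
    refine Finset.sum_congr rfl fun j _ => ?_
    push_cast
    ring
  have hpos : ∀ x ∈ K, 0 < (∑ i, v x i * v x i) * ∑ j, v' x j * v' x j := fun x hx =>
    mul_pos (sum_sq_pos (hv x hx)) (sum_sq_pos (hv' x hx))
  have hne : ∀ x ∈ K, F x ≠ 0 := by
    intro x hx
    rw [hFe]
    exact mul_ne_zero (by exact_mod_cast (η x * ε x * ε' x).ne_zero) (hpos x hx).ne'
  by_contra hcon
  have key : ∀ x ∈ K, ∀ y ∈ K, η x * ε x * ε' x = 1 → η y * ε y * ε' y = -1 → False := by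
    intro x hx y hy h1 h2
    have hx' : 0 ≤ F x := by rw [hFe, h1]; simpa using (hpos x hx).le
    have hy' : F y ≤ 0 := by rw [hFe, h2]; simpa using (hpos y hy).le
    obtain ⟨z, hz, hz0⟩ := hK.intermediate_value hy hx hFc ⟨hy', hx'⟩
    exact hne z hz hz0
  rcases Int.units_eq_one_or (η x * ε x * ε' x) with h1 | h1 <;>
    rcases Int.units_eq_one_or (η y * ε y * ε' y) with h2 | h2
  · exact hcon (h1.trans h2.symm)
  · exact key x hx y hy h1 h2
  · exact key y hy x hx h2 h1
  · exact hcon (h1.trans h2.symm)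

/-- Nearby lines are not orthogonal. -/
theorem exists_inner_ne_zero [PseudoMetricSpace E] {K : Set E} {v : E → ι → ℝ} (hK : IsCompact K)
    (hv : IsLineField K v) :
    ∃ δ > 0, ∀ x ∈ K, ∀ y ∈ K, dist x y < δ → ∑ i, v x i * v y i ≠ 0 := by
  have : CompactSpace K := isCompact_iff_compactSpace.mp hK
  -- The inner product is continuous only up to sign, but its square is a polynomial in the
  -- continuous products v i * v j. It is positive on the diagonal, hence nonzero on a uniform
  -- neighbourhood by compactness.
  have hG : ∀ x y : E, (∑ i, v x i * v y i) ^ 2 =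
      ∑ i, ∑ j, (v x i * v x j) * (v y i * v y j) := by
    intro x y
    rw [sq, Finset.sum_mul_sum]
    exact Finset.sum_congr rfl fun i _ => Finset.sum_congr rfl fun j _ => by ring
  have hc : Continuous fun p : K × K => (∑ i, v p.1 i * v p.2 i) ^ 2 := by
    simp only [hG]
    refine continuous_finsetSum _ fun i _ => continuous_finsetSum _ fun j _ => ?_
    have h := continuousOn_iff_continuous_domRestrict.mp (hv.2 i j)
    exact (h.comp continuous_fst).mul (h.comp continuous_snd)
  have hopen : IsOpen {p : K × K | (∑ i, v p.1 i * v p.2 i) ^ 2 ≠ 0} :=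
    isOpen_ne_fun hc continuous_const
  have hmem : {p : K × K | (∑ i, v p.1 i * v p.2 i) ^ 2 ≠ 0} ∈ uniformity K := by
    rw [← nhdsSet_diagonal_eq_uniformity, hopen.mem_nhdsSet]
    rintro ⟨x, y⟩ hxy
    obtain rfl : x = y := hxy
    exact pow_ne_zero 2 (sum_sq_pos (hv.1 x x.2)).ne'
  obtain ⟨δ, hδ, h⟩ := Metric.mem_uniformity_dist.mp hmem
  refine ⟨δ, hδ, fun x hx y hy hxy h0 => ?_⟩
  exact h (a := ⟨x, hx⟩) (b := ⟨y, hy⟩) hxy (by simp [h0])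

/-- A line field on a compact convex set has a continuous section. -/
theorem exists_sign [NormedAddCommGroup E] [NormedSpace ℝ E] {K : Set E} {v : E → ι → ℝ}
    (hK : IsCompact K) (hconv : Convex ℝ K) (hv : IsLineField K v) :
    ∃ ε : E → ℤˣ, ∀ i, ContinuousOn (fun x => ((ε x : ℤ) : ℝ) * v x i) K := by
  rcases K.eq_empty_or_nonempty with rfl | ⟨x₀, hx₀⟩
  · exact ⟨fun _ => 1, fun i => continuousOn_empty _⟩
  obtain ⟨δ, hδ, hne⟩ := exists_inner_ne_zero hK hv
  obtain ⟨C, hC⟩ := hK.isBounded.subset_closedBall x₀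
  obtain ⟨N, hN⟩ := exists_nat_gt (C / δ)
  obtain ⟨k, hk⟩ := Function.ne_iff.mp (hv.1 x₀ hx₀)
  have hC0 : 0 ≤ C := by simpa using hC hx₀
  have hN0 : (0 : ℝ) < N := lt_of_le_of_lt (by positivity) hN
  -- The segment from x₀ to x is divided into N steps. As N > C / δ, each step is shorter than δ and
  -- consecutive lines are not orthogonal.
  set P : ℕ → E → E := fun m x => x₀ + ((m : ℝ) / N) • (x - x₀) with hP
  have hPc : ∀ m, Continuous (P m) := fun m => by simp only [hP]; fun_prop
  have hPK : ∀ m ≤ N, Set.MapsTo (P m) K K := by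
    intro m hm x hx
    exact hconv.add_smul_sub_mem hx₀ hx ⟨by positivity,
      (div_le_one hN0).mpr (by exact_mod_cast hm)⟩
  have hP0 : ∀ x, P 0 x = x₀ := fun x => by simp [hP]
  have hPN : ∀ x, P N x = x := fun x => by simp [hP, div_self hN0.ne']
  -- A multiple of v x₀ is transported along the segment by applying v ⊗ v at each successive point.
  -- The result at step m is c m x times v at P m x; it is continuous in x since only the products v
  -- i * v j enter.
  set c : ℕ → E → ℝ := fun m x => v x₀ k * ∏ l ∈ range m, ∑ i, v (P l x) i * v (P (l + 1) x) i with hc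
  have hcc : ∀ m ≤ N, ∀ j, ContinuousOn (fun x => c m x * v (P m x) j) K := by
    intro m
    induction m with
    | zero =>
      intro _ j
      have e : (fun x => c 0 x * v (P 0 x) j) = fun _ => v x₀ k * v x₀ j := by
        funext x
        simp [hc, hP0]
      rw [e]
      exact continuousOn_const
    | succ m ih =>
      intro hm j
      have e : (fun x => c (m + 1) x * v (P (m + 1) x) j) = fun x =>
          ∑ i, (c m x * v (P m x) i) * (v (P (m + 1) x) i * v (P (m + 1) x) j) := by
        funext x
        simp only [hc, Finset.prod_range_succ, Finset.mul_sum, Finset.sum_mul]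
        exact Finset.sum_congr rfl fun i _ => by ring
      rw [e]
      refine continuousOn_finsetSum _ fun i _ => (ih (by omega) i).mul ?_
      exact (hv.2 i j).comp (hPc (m + 1)).continuousOn (hPK (m + 1) hm)
  have hc0 : ∀ x ∈ K, c N x ≠ 0 := by
    intro x hx
    refine mul_ne_zero hk (Finset.prod_ne_zero_iff.mpr fun l hl => ?_)
    have hl := mem_range.mp hl
    refine hne _ (hPK l hl.le hx) _ (hPK (l + 1) hl hx) ?_
    have e : P l x - P (l + 1) x = (-(1 / (N : ℝ))) • (x - x₀) := by
      simp only [hP]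
      push_cast
      rw [add_sub_add_left_eq_sub, ← sub_smul]
      congr 1
      ring
    rw [dist_eq_norm, e, norm_smul, Real.norm_eq_abs, abs_neg, abs_of_pos (by positivity)]
    have h1 : ‖x - x₀‖ ≤ C := by simpa [dist_eq_norm] using hC hx
    rw [div_lt_iff₀ hδ] at hN
    rw [one_div, inv_mul_lt_iff₀ hN0]
    linarith
  have hcN : ∀ j, ContinuousOn (fun x => c N x * v x j) K := fun j => by
    simpa only [hPN] using hcc N le_rfl j
  -- The scalar c N itself need not be continuous, but its absolute value is, being the quotient of
  -- the lengths of c N • v and v. Hence the sign of c N is the required one.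
  have habs : ContinuousOn (fun x => |c N x|) K := by
    have h1 : ContinuousOn (fun x => √((∑ i, (c N x * v x i) * (c N x * v x i)) /
        ∑ i, v x i * v x i)) K := by
      refine (ContinuousOn.div ?_ ?_ fun x hx => (sum_sq_pos (hv.1 x hx)).ne').sqrt
      · exact continuousOn_finsetSum _ fun i _ => (hcN i).mul (hcN i)
      · exact continuousOn_finsetSum _ fun i _ => hv.2 i i
    refine h1.congr fun x hx => ?_
    have e : ∑ i, (c N x * v x i) * (c N x * v x i) = c N x ^ 2 * ∑ i, v x i * v x i := by
      rw [Finset.mul_sum]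
      exact Finset.sum_congr rfl fun i _ => by ring
    simp only
    rw [e, mul_div_assoc, div_self (sum_sq_pos (hv.1 x hx)).ne', mul_one, Real.sqrt_sq_eq_abs]
  refine ⟨fun x => if 0 < c N x then 1 else -1, fun i => ?_⟩
  refine ((hcN i).div habs fun x hx => abs_ne_zero.mpr (hc0 x hx)).congr fun x hx => ?_
  have hx0 := hc0 x hx
  simp only [Pi.div_apply]
  rcases lt_or_gt_of_ne hx0 with h | h
  · simp only [h.not_gt, if_false, abs_of_neg h, Units.val_neg, Units.val_one, Int.cast_neg,
      Int.cast_one]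
    field_simp
  · simp only [h, if_true, abs_of_pos h, Units.val_one, Int.cast_one]
    field_simp

end IsLineField

/-! ### First cohomology modulo two as holonomy of line fields -/

namespace AbstractSimplicialComplex

variable {V W : Type*} [Fintype V] [Fintype W]

/-- The closed simplex with the vertices `s`. -/
def faceSpace (s : Finset V) : Set (V → ℝ) := {y | y ∈ stdSimplex ℝ V ∧ ∀ i, y i ≠ 0 → i ∈ s}

theorem convex_faceSpace (s : Finset V) : Convex ℝ (faceSpace s) := by
  intro x hx y hy a b ha hb hab
  refine ⟨convex_stdSimplex ℝ V hx.1 hy.1 ha hb hab, fun i hi => ?_⟩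
  by_contra his
  have h1 : x i = 0 := by_contra fun h => his (hx.2 i h)
  have h2 : y i = 0 := by_contra fun h => his (hy.2 i h)
  exact hi (by simp [h1, h2])

theorem isClosed_faceSpace (s : Finset V) : IsClosed (faceSpace s) := by
  have e : faceSpace s = stdSimplex ℝ V ∩ ⋂ i, {y | y i ≠ 0 → i ∈ s} := by
    ext y
    simp [faceSpace]
  rw [e]
  refine (isClosed_stdSimplex ℝ V).inter (isClosed_iInter fun i => ?_)
  by_cases hi : i ∈ s
  · simp [hi]
  · simpa [hi] using isClosed_eq (continuous_apply i) continuous_const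

theorem isCompact_faceSpace (s : Finset V) : IsCompact (faceSpace s) :=
  (isCompact_stdSimplex ℝ V).of_isClosed_subset (isClosed_faceSpace s) fun _ h => h.1

theorem single_mem_faceSpace [DecidableEq V] {s : Finset V} {u : V} (hu : u ∈ s) :
    Pi.single u 1 ∈ faceSpace s := by
  refine ⟨single_mem_stdSimplex ℝ u, fun i hi => ?_⟩
  by_contra his
  exact hi (Pi.single_eq_of_ne (by rintro rfl; exact his hu) _)

theorem faceSpace_mono {s t : Finset V} (h : s ⊆ t) : faceSpace s ⊆ faceSpace t :=
  fun _ hy => ⟨hy.1, fun i hi => h (hy.2 i hi)⟩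

theorem faceSpace_subset_space (Δ : AbstractSimplicialComplex V) {s : Finset V} (hs : s ∈ Δ.faces) :
    faceSpace s ⊆ Δ.space :=
  fun _ hy => ⟨hy.1, s, hs, hy.2⟩

theorem exists_ne_zero_of_mem_stdSimplex {y : V → ℝ} (hy : y ∈ stdSimplex ℝ V) : ∃ i, y i ≠ 0 := by
  by_contra h
  push Not at h
  have := hy.2
  simp [h] at this

/-- A continuous family of functions on the faces is continuous on the complex. -/
theorem continuousOn_space (Δ : AbstractSimplicialComplex V) {X : Type*} [TopologicalSpace X]
    {f : (V → ℝ) → X} (hf : ∀ s ∈ Δ.faces, ContinuousOn f (faceSpace s)) : ContinuousOn f Δ.space := by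
  have e : Δ.space = ⋃ s : Δ.faces, faceSpace s.1 := by
    ext y
    simp only [Set.mem_iUnion]
    exact ⟨fun ⟨h, s, hs, h'⟩ => ⟨⟨s, hs⟩, h, h'⟩, fun ⟨s, h, h'⟩ => ⟨h, s.1, s.2, h'⟩⟩
  rw [e]
  exact (locallyFinite_of_finite _).continuousOn_iUnion (fun s => isClosed_faceSpace s.1)
    fun s => hf s.1 s.2

/-- A 1-cocycle with values in the group of signs. -/
def IsCocycle {V : Type*} [DecidableEq V] (Δ : AbstractSimplicialComplex V) (b : V → V → ℤˣ) : Prop :=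
  ∀ u v w, {u, v, w} ∈ Δ.faces → b u v * b v w = b u w

/-- Two cochains differ by a coboundary. -/
def Cohomologous {V : Type*} [DecidableEq V] (Δ : AbstractSimplicialComplex V)
    (b b' : V → V → ℤˣ) : Prop :=
  ∃ g : V → ℤˣ, ∀ u v, {u, v} ∈ Δ.faces → b u v * b' u v = g u * g v

theorem IsCocycle.self {V : Type*} [DecidableEq V] {Δ : AbstractSimplicialComplex V}
    {b : V → V → ℤˣ} (hb : Δ.IsCocycle b) (u : V) : b u u = 1 := by
  have := hb u u u (by simpa using Δ.singleton_mem u)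
  simpa using this.symm

theorem IsCocycle.symm {V : Type*} [DecidableEq V] {Δ : AbstractSimplicialComplex V}
    {b : V → V → ℤˣ} (hb : Δ.IsCocycle b) {u v : V} (h : {u, v} ∈ Δ.faces) : b v u = b u v := by
  have h1 := hb u v u (by
    have e : ({u, v, u} : Finset V) = {u, v} := by grind
    rwa [e])
  rw [hb.self, mul_eq_one_iff_eq_inv, Int.units_inv_eq_self] at h1
  exact h1.symm

/-- A vertex of the smallest face that contains `x`. -/
noncomputable def baseVertex [Nonempty V] (x : V → ℝ) : V := Classical.epsilon fun i => x i ≠ 0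

theorem baseVertex_ne_zero [Nonempty V] {x : V → ℝ} (hx : x ∈ stdSimplex ℝ V) :
    x (baseVertex x) ≠ 0 :=
  Classical.epsilon_spec (exists_ne_zero_of_mem_stdSimplex hx)

/-- The line field that is defined by a cocycle. -/
noncomputable def cocycleField [Nonempty V] (b : V → V → ℤˣ) (x : V → ℝ) (i : V) : ℝ :=
  ((b (baseVertex x) i : ℤ) : ℝ) * x i

theorem cocycleField_ne_zero [Nonempty V] (b : V → V → ℤˣ) {x : V → ℝ} (hx : x ∈ stdSimplex ℝ V) :
    cocycleField b x ≠ 0 := by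
  intro h
  have := congrFun h (baseVertex x)
  simp only [cocycleField, Pi.zero_apply, mul_eq_zero, Int.cast_eq_zero, Units.ne_zero, false_or] at this
  exact baseVertex_ne_zero hx this

variable [DecidableEq V]

/-- The cocycle condition allows the base vertex, which jumps from face to face, to be replaced by a
fixed vertex `k` at the cost of one sign. On a face the line is thus spanned by a linear vector
field. -/
theorem IsCocycle.mul_cocycleField [Nonempty V] {Δ : AbstractSimplicialComplex V} {b : V → V → ℤˣ}
    (hb : Δ.IsCocycle b) {s : Finset V} (hs : s ∈ Δ.faces) {x : V → ℝ} (hx : x ∈ faceSpace s) {k : V}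
    (hk : k ∈ s) (i : V) :
    ((b k (baseVertex x) : ℤ) : ℝ) * cocycleField b x i = ((b k i : ℤ) : ℝ) * x i := by
  by_cases hi : x i = 0
  · simp [cocycleField, hi]
  · have hface : {k, baseVertex x, i} ∈ Δ.faces := by
      refine Δ.mem_faces_of_subset hs (fun j hj => ?_) (by simp)
      simp only [mem_insert, mem_singleton] at hj
      rcases hj with rfl | rfl | rfl
      · exact hk
      · exact hx.2 _ (baseVertex_ne_zero hx.1)
      · exact hx.2 _ hi
    rw [cocycleField, ← mul_assoc, ← hb _ _ _ hface]
    push_cast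
    ring

theorem IsCocycle.isLineField [Nonempty V] {Δ : AbstractSimplicialComplex V} {b : V → V → ℤˣ}
    (hb : Δ.IsCocycle b) : IsLineField Δ.space (cocycleField b) := by
  refine ⟨fun x hx => cocycleField_ne_zero b hx.1, fun i j => ?_⟩
  refine Δ.continuousOn_space fun s hs => ?_
  obtain ⟨k, hk⟩ := Δ.nonempty_of_mem_faces hs
  have : ContinuousOn (fun x : V → ℝ => (((b k i : ℤ) : ℝ) * x i) * (((b k j : ℤ) : ℝ) * x j))
      (faceSpace s) := by fun_prop
  refine this.congr fun x hx => ?_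
  simp only
  rw [← hb.mul_cocycleField hs hx hk, ← hb.mul_cocycleField hs hx hk]
  rcases Int.units_eq_one_or (b k (baseVertex x)) with h | h <;> simp [h]

/-- The holonomy of a line field is a cocycle. -/
theorem exists_cocycle_of_isLineField (Δ : AbstractSimplicialComplex V) {v : (V → ℝ) → W → ℝ}
    (hv : IsLineField Δ.space v) :
    ∃ (b : V → V → ℤˣ) (ε : Finset V → (V → ℝ) → ℤˣ), Δ.IsCocycle b ∧
      (∀ s ∈ Δ.faces, ∀ i, ContinuousOn (fun x => ((ε s x : ℤ) : ℝ) * v x i) (faceSpace s)) ∧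
      ∀ s ∈ Δ.faces, ∀ u ∈ s, ∀ w ∈ s, b u w = ε s (Pi.single u 1) * ε s (Pi.single w 1) := by
  have hsec : ∀ s : Finset V, ∃ ε : (V → ℝ) → ℤˣ, s ∈ Δ.faces → ∀ i,
      ContinuousOn (fun x => ((ε x : ℤ) : ℝ) * v x i) (faceSpace s) := by
    intro s
    by_cases hs : s ∈ Δ.faces
    · have hsub := Δ.faceSpace_subset_space hs
      obtain ⟨ε, hε⟩ := IsLineField.exists_sign (isCompact_faceSpace s) (convex_faceSpace s)
        (v := v) ⟨fun x hx => hv.1 x (hsub hx), fun i j => (hv.2 i j).mono hsub⟩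
      exact ⟨ε, fun _ => hε⟩
    · exact ⟨fun _ => 1, fun h => absurd h hs⟩
  choose ε hε using hsec
  -- The holonomy along u w compares a continuous section on the edge at its two ends. By
  -- `sign_const` the section on any larger face gives the same product, so the products telescope
  -- in a triangle.
  set b : V → V → ℤˣ := fun u w => ε {u, w} (Pi.single u 1) * ε {u, w} (Pi.single w 1) with hb
  have hbs : ∀ s ∈ Δ.faces, ∀ u ∈ s, ∀ w ∈ s, b u w = ε s (Pi.single u 1) * ε s (Pi.single w 1) := by
    intro s hs u hu w hw
    have hsub : ({u, w} : Finset V) ⊆ s := by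
      intro i hi
      simp only [mem_insert, mem_singleton] at hi
      rcases hi with rfl | rfl <;> assumption
    have he := Δ.mem_faces_of_subset hs hsub (by simp)
    have hspace := Δ.faceSpace_subset_space he
    have := IsLineField.sign_const (convex_faceSpace {u, w}).isPreconnected (v := v) (v' := v)
      (fun x hx => hv.1 x (hspace hx)) (fun x hx => hv.1 x (hspace hx)) (η := fun _ => 1)
      (fun i j => by simpa using (hv.2 i j).mono hspace) (hε _ he)
      (fun i => (hε s hs i).mono (faceSpace_mono hsub))
      (single_mem_faceSpace (mem_insert_self u {w}))
      (single_mem_faceSpace (mem_insert_of_mem (mem_singleton_self w)))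
    simp only [one_mul] at this
    simp only [hb]
    have h1 := Int.units_mul_self (ε s (Pi.single u 1))
    have h2 := Int.units_mul_self (ε {u, w} (Pi.single w 1))
    calc _ = (ε {u, w} (Pi.single u 1) * ε s (Pi.single u 1)) * ε {u, w} (Pi.single w 1) *
          ε s (Pi.single u 1) := by
            rw [mul_right_comm, mul_assoc (ε {u, w} (Pi.single u 1)), h1, mul_one]
      _ = _ := by
        rw [this, mul_right_comm (ε {u, w} (Pi.single w 1)), h2, one_mul, mul_comm]
  refine ⟨b, ε, fun u w x hs => ?_, hε, hbs⟩
  rw [hbs _ hs u (by simp) w (by simp), hbs _ hs w (by simp) x (by simp),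
    hbs _ hs u (by simp) x (by simp), mul_assoc, ← mul_assoc (ε _ (Pi.single w 1)),
    Int.units_mul_self, one_mul]

/-- Line fields with cohomologous holonomy are isomorphic. -/
theorem exists_sign_of_cohomologous (Δ : AbstractSimplicialComplex V) {v v' : (V → ℝ) → W → ℝ}
    (hv : IsLineField Δ.space v) (hv' : IsLineField Δ.space v') {b b' : V → V → ℤˣ}
    {ε ε' : Finset V → (V → ℝ) → ℤˣ}
    (hε : ∀ s ∈ Δ.faces, ∀ i, ContinuousOn (fun x => ((ε s x : ℤ) : ℝ) * v x i) (faceSpace s))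
    (hε' : ∀ s ∈ Δ.faces, ∀ i, ContinuousOn (fun x => ((ε' s x : ℤ) : ℝ) * v' x i) (faceSpace s))
    (hb : ∀ s ∈ Δ.faces, ∀ u ∈ s, ∀ w ∈ s, b u w = ε s (Pi.single u 1) * ε s (Pi.single w 1))
    (hb' : ∀ s ∈ Δ.faces, ∀ u ∈ s, ∀ w ∈ s, b' u w = ε' s (Pi.single u 1) * ε' s (Pi.single w 1))
    (h : Δ.Cohomologous b b') :
    ∃ η : (V → ℝ) → ℤˣ, ∀ i j,
      ContinuousOn (fun x => ((η x : ℤ) : ℝ) * v x i * v' x j) Δ.space := by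
  rcases isEmpty_or_nonempty V with hV | hV
  · exact ⟨1, fun i j x hx => (IsEmpty.false (exists_ne_zero_of_mem_stdSimplex hx.1).choose).elim⟩
  obtain ⟨g, hg⟩ := h
  -- The isomorphism at the vertex u is prescribed by g u and is continued over the face s by
  -- comparing the sections of v and v'. It does not depend on u because the holonomies differ by
  -- the coboundary of g, nor on s because sections on a common face agree up to a constant sign.
  set τ : Finset V → V → (V → ℝ) → ℤˣ := fun s u y =>
    ε s y * ε' s y * (ε s (Pi.single u 1) * ε' s (Pi.single u 1) * g u) with hτ
  have sq := Int.units_mul_self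
  have hτu : ∀ s ∈ Δ.faces, ∀ u ∈ s, ∀ w ∈ s, ∀ y, τ s u y = τ s w y := by
    intro s hs u hu w hw y
    have h1 := hg u w (Δ.mem_faces_of_subset hs (by
      intro i hi
      simp only [mem_insert, mem_singleton] at hi
      rcases hi with rfl | rfl <;> assumption) (by simp))
    rw [hb s hs u hu w hw, hb' s hs u hu w hw] at h1
    simp only [hτ]
    congr 1
    have h2 : g u = ε s (Pi.single u 1) * ε s (Pi.single w 1) *
        (ε' s (Pi.single u 1) * ε' s (Pi.single w 1)) * g w := by
      rw [h1, mul_assoc, sq, mul_one]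
    rw [h2]
    calc _ = (ε s (Pi.single u 1) * ε s (Pi.single u 1)) * (ε' s (Pi.single u 1) * ε' s (Pi.single u 1)) *
          (ε s (Pi.single w 1) * ε' s (Pi.single w 1) * g w) := by ac_rfl
      _ = _ := by rw [sq, sq, one_mul, one_mul]
  have hτs : ∀ s ∈ Δ.faces, ∀ t ∈ Δ.faces, ∀ y ∈ faceSpace s, y ∈ faceSpace t → ∀ u, u ∈ s → u ∈ t →
      τ s u y = τ t u y := by
    intro s hs t ht y hys hyt u hus hut
    have hst : s ∩ t ∈ Δ.faces :=
      Δ.mem_faces_of_subset hs inter_subset_left ⟨u, mem_inter.mpr ⟨hus, hut⟩⟩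
    have hspace := Δ.faceSpace_subset_space hst
    have hy : y ∈ faceSpace (s ∩ t) := ⟨hys.1, fun i hi => mem_inter.mpr ⟨hys.2 i hi, hyt.2 i hi⟩⟩
    have hu := single_mem_faceSpace (mem_inter.mpr ⟨hus, hut⟩)
    have h1 := IsLineField.sign_const (convex_faceSpace (s ∩ t)).isPreconnected (v := v) (v' := v)
      (fun x hx => hv.1 x (hspace hx)) (fun x hx => hv.1 x (hspace hx)) (η := fun _ => 1)
      (fun i j => by simpa using (hv.2 i j).mono hspace)
      (fun i => (hε s hs i).mono (faceSpace_mono inter_subset_left))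
      (fun i => (hε t ht i).mono (faceSpace_mono inter_subset_right)) hy hu
    have h2 := IsLineField.sign_const (convex_faceSpace (s ∩ t)).isPreconnected (v := v') (v' := v')
      (fun x hx => hv'.1 x (hspace hx)) (fun x hx => hv'.1 x (hspace hx)) (η := fun _ => 1)
      (fun i j => by simpa using (hv'.2 i j).mono hspace)
      (fun i => (hε' s hs i).mono (faceSpace_mono inter_subset_left))
      (fun i => (hε' t ht i).mono (faceSpace_mono inter_subset_right)) hy hu
    simp only [one_mul] at h1 h2
    have h3 : ε s y = ε s (Pi.single u 1) * ε t (Pi.single u 1) * ε t y := by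
      rw [← h1, mul_assoc, sq, mul_one]
    have h4 : ε' s y = ε' s (Pi.single u 1) * ε' t (Pi.single u 1) * ε' t y := by
      rw [← h2, mul_assoc, sq, mul_one]
    simp only [hτ]
    rw [h3, h4]
    calc _ = (ε s (Pi.single u 1) * ε s (Pi.single u 1)) * (ε' s (Pi.single u 1) * ε' s (Pi.single u 1)) *
          (ε t y * ε' t y * (ε t (Pi.single u 1) * ε' t (Pi.single u 1) * g u)) := by ac_rfl
      _ = _ := by rw [sq, sq, one_mul, one_mul]
  have hface : ∀ y : V → ℝ, ∃ p : Finset V × V, y ∈ Δ.space →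
      p.1 ∈ Δ.faces ∧ y ∈ faceSpace p.1 ∧ y p.2 ≠ 0 := by
    intro y
    by_cases hy : y ∈ Δ.space
    · obtain ⟨hy, s, hs, hsupp⟩ := hy
      obtain ⟨i, hi⟩ := exists_ne_zero_of_mem_stdSimplex hy
      exact ⟨(s, i), fun _ => ⟨hs, ⟨hy, hsupp⟩, hi⟩⟩
    · exact ⟨(∅, hV.some), fun h => absurd h hy⟩
  choose p hp using hface
  refine ⟨fun y => τ (p y).1 (p y).2 y, fun i j => Δ.continuousOn_space fun s hs => ?_⟩
  obtain ⟨u, hu⟩ := Δ.nonempty_of_mem_faces hs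
  set a : ℤˣ := ε s (Pi.single u 1) * ε' s (Pi.single u 1) * g u with ha
  have : ContinuousOn (fun x => ((a : ℤ) : ℝ) * ((((ε s x : ℤ) : ℝ) * v x i) *
      (((ε' s x : ℤ) : ℝ) * v' x j))) (faceSpace s) :=
    continuousOn_const.mul ((hε s hs i).mul (hε' s hs j))
  refine this.congr fun y hy => ?_
  obtain ⟨h1, h2, h3⟩ := hp y (Δ.faceSpace_subset_space hs hy)
  have e : τ (p y).1 (p y).2 y = ε s y * ε' s y * a := by
    rw [hτs _ h1 s hs y h2 hy _ (h2.2 _ h3) (hy.2 _ h3), hτu s hs _ (hy.2 _ h3) u hu]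
  simp only [e]
  push_cast
  ring

/-- Cocycles with isomorphic line fields are cohomologous. -/
theorem IsCocycle.cohomologous [Nonempty V] {Δ : AbstractSimplicialComplex V} {b b' : V → V → ℤˣ}
    (hb : Δ.IsCocycle b) (hb' : Δ.IsCocycle b') {η : (V → ℝ) → ℤˣ}
    (hη : ∀ i j, ContinuousOn (fun x => ((η x : ℤ) : ℝ) * cocycleField b x i * cocycleField b' x j)
      Δ.space) : Δ.Cohomologous b b' := by
  -- The isomorphism at the vertices is the required 0-cochain. Along an edge from u, the fields are
  -- made continuous by b u and b' u at the base vertex, so `sign_const` equates the value at u,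
  -- where these signs are 1, with the value at w.
  refine ⟨fun u => η (Pi.single u 1), fun u w he => ?_⟩
  have hspace := Δ.faceSpace_subset_space he
  have hu : u ∈ ({u, w} : Finset V) := mem_insert_self u {w}
  have hbase : ∀ u : V, baseVertex (Pi.single u 1 : V → ℝ) = u := by
    intro u
    by_contra h
    exact baseVertex_ne_zero (single_mem_stdSimplex ℝ u) (Pi.single_eq_of_ne h _)
  have hc : ∀ {b : V → V → ℤˣ}, Δ.IsCocycle b → ∀ i, ContinuousOn
      (fun x => ((b u (baseVertex x) : ℤ) : ℝ) * cocycleField b x i) (faceSpace {u, w}) := by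
    intro b hb i
    have : ContinuousOn (fun x : V → ℝ => ((b u i : ℤ) : ℝ) * x i) (faceSpace {u, w}) := by fun_prop
    exact this.congr fun x hx => hb.mul_cocycleField he hx hu i
  have := IsLineField.sign_const (convex_faceSpace {u, w}).isPreconnected
    (v := cocycleField b) (v' := cocycleField b')
    (fun x hx => cocycleField_ne_zero b hx.1) (fun x hx => cocycleField_ne_zero b' hx.1)
    (fun i j => (hη i j).mono hspace) (ε := fun x => b u (baseVertex x))
    (ε' := fun x => b' u (baseVertex x)) (hc hb) (hc hb') (single_mem_faceSpace hu)
    (single_mem_faceSpace (mem_insert_of_mem (mem_singleton_self w)))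
  simp only [hbase, hb.self, hb'.self, mul_one] at this
  simp only
  rw [this, mul_comm (_ * _ * _), mul_assoc (η _), ← mul_assoc, Int.units_mul_self, one_mul]

/-- The first cohomology of a complex embeds into that of a homeomorphic complex. -/
theorem exists_cohomology_injection [DecidableEq W] [Nonempty W] (Δ : AbstractSimplicialComplex V)
    (Γ : AbstractSimplicialComplex W) (h : Δ.space ≃ₜ Γ.space) :
    ∃ Φ : (W → W → ℤˣ) → V → V → ℤˣ, (∀ b, Γ.IsCocycle b → Δ.IsCocycle (Φ b)) ∧
      ∀ b b', Γ.IsCocycle b → Γ.IsCocycle b' → Δ.Cohomologous (Φ b) (Φ b') →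
        Γ.Cohomologous b b' := by
  obtain ⟨f, g, hfc, hgc, hf, hg, hgf, hfg⟩ := h.exists_invOn
  -- Φ b is the holonomy of the field of b pulled back by f. An isomorphism between two pulled-back
  -- fields is pulled back along the inverse g and gives one between the original fields.
  have hfield : ∀ b, Γ.IsCocycle b → IsLineField Δ.space fun x => cocycleField b (f x) :=
    fun b hb => ⟨fun x hx => hb.isLineField.1 _ (hf hx), fun i j => (hb.isLineField.2 i j).comp hfc hf⟩
  have key : ∀ b : W → W → ℤˣ, ∃ (c : V → V → ℤˣ) (ε : Finset V → (V → ℝ) → ℤˣ), Γ.IsCocycle b →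
      Δ.IsCocycle c ∧
      (∀ s ∈ Δ.faces, ∀ i,
        ContinuousOn (fun x => ((ε s x : ℤ) : ℝ) * cocycleField b (f x) i) (faceSpace s)) ∧
      ∀ s ∈ Δ.faces, ∀ u ∈ s, ∀ w ∈ s, c u w = ε s (Pi.single u 1) * ε s (Pi.single w 1) := by
    intro b
    by_cases hb : Γ.IsCocycle b
    · obtain ⟨c, ε, h⟩ := Δ.exists_cocycle_of_isLineField (hfield b hb)
      exact ⟨c, ε, fun _ => h⟩
    · exact ⟨1, 1, fun h => absurd h hb⟩
  choose Φ ε hΦ using key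
  refine ⟨Φ, fun b hb => (hΦ b hb).1, fun b b' hb hb' hcoh => ?_⟩
  obtain ⟨-, h1, h2⟩ := hΦ b hb
  obtain ⟨-, h1', h2'⟩ := hΦ b' hb'
  obtain ⟨η, hη⟩ := Δ.exists_sign_of_cohomologous (hfield b hb) (hfield b' hb') h1 h1' h2 h2' hcoh
  refine hb.cohomologous hb' (η := fun y => η (g y)) fun i j => ?_
  refine ((hη i j).comp hgc hg).congr fun y hy => ?_
  simp only [Function.comp_apply, hfg hy]

end AbstractSimplicialComplex

/-! ### Connectedness after removal of finitely many points -/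

namespace NonorientableSurface

variable {h : ℕ}

theorem norm_eq_one_of_crossCapGluing {z w : UnitDisc} (hzw : crossCapGluing h z w) :
    ‖(z : ℂ)‖ = 1 ∧ ‖(w : ℂ)‖ = 1 := by
  obtain ⟨j, t, -, hz, hw⟩ := hzw
  have key : ∀ a : ℝ, ‖Complex.exp (2 * Real.pi * Complex.I * (a : ℂ))‖ = 1 := by
    intro a
    rw [show 2 * Real.pi * Complex.I * (a : ℂ) = ((2 * Real.pi * a : ℝ) : ℂ) * Complex.I by
      push_cast; ring]
    exact Complex.norm_exp_ofReal_mul_I _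
  constructor
  · rw [hz]
    exact_mod_cast key ((2 * (j : ℕ) + t) / (2 * h))
  · rw [hw]
    exact_mod_cast key ((2 * (j : ℕ) + 1 + t) / (2 * h))

/-- The gluing relates only boundary points, so the map that sends the whole boundary to 1 and fixes
the open disc descends to the quotient and separates interior points. -/
theorem eq_of_mk_eq {z w : UnitDisc} (hz : ‖(z : ℂ)‖ < 1) (hw : ‖(w : ℂ)‖ < 1)
    (hzw : Quot.mk (crossCapGluing h) z = Quot.mk (crossCapGluing h) w) : z = w := by
  classical
  let φ : NonorientableSurface h → ℂ := Quot.lift (fun z => if ‖(z : ℂ)‖ < 1 then (z : ℂ) else 1) (by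
    intro z w hzw
    obtain ⟨h1, h2⟩ := norm_eq_one_of_crossCapGluing hzw
    simp [h1, h2])
  have := congrArg φ hzw
  simp only [φ, hz, hw, if_true] at this
  exact Subtype.ext this

/-- The complement of a finite set is connected. -/
theorem isPreconnected_compl_finite [T1Space (NonorientableSurface h)]
    {F : Set (NonorientableSurface h)} (hF : F.Finite) : IsPreconnected Fᶜ := by
  set p : ℂ → UnitDisc := fun x => ⟨(Homeomorph.unitBall x : ℂ),
    Metric.ball_subset_closedBall (Homeomorph.unitBall x).2⟩ with hp
  have hpc : Continuous p := by
    refine Continuous.subtype_mk ?_ _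
    exact continuous_subtype_val.comp Homeomorph.unitBall.continuous
  have hnorm : ∀ x, ‖(p x : ℂ)‖ < 1 := fun x =>
    mem_ball_zero_iff.mp (Homeomorph.unitBall x).2
  set φ : ℂ → NonorientableSurface h := fun x => Quot.mk _ (p x) with hφ
  have hφc : Continuous φ := continuous_quot_mk.comp hpc
  have hinj : Function.Injective φ := by
    intro x y hxy
    have h1 := congrArg Subtype.val (eq_of_mk_eq (hnorm x) (hnorm y) hxy)
    exact Homeomorph.unitBall.injective (Subtype.ext h1)
  -- The open disc is a copy of the plane, which stays connected without finitely many points. Its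
  -- image is dense in the complement of F, so the complement lies between a connected set and its
  -- closure.
  have hcon : IsPreconnected (φ '' (φ ⁻¹' F)ᶜ) := by
    refine IsPreconnected.image ?_ φ hφc.continuousOn
    have hrank : 1 < Module.rank ℝ ℂ := by rw [Complex.rank_real_complex]; norm_num
    exact ((hF.preimage hinj.injOn).countable.isConnected_compl_of_one_lt_rank hrank).isPreconnected
  refine hcon.subset_closure ?_ ?_
  · rintro - ⟨x, hx, rfl⟩
    exact hx
  · intro y hy
    obtain ⟨z, rfl⟩ := Quot.exists_rep y
    rw [mem_closure_iff]
    intro U hU hzU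
    have hO : IsOpen (Quot.mk (crossCapGluing h) ⁻¹' (U ∩ Fᶜ)) :=
      (hU.inter hF.isClosed.isOpen_compl).preimage continuous_quot_mk
    obtain ⟨O, hOo, hOe⟩ := isOpen_induced_iff.mp hO
    have hzO : (z : ℂ) ∈ O := by
      have : z ∈ (Subtype.val ⁻¹' O : Set UnitDisc) := by
        rw [hOe]
        exact ⟨hzU, hy⟩
      exact this
    have hzc : (z : ℂ) ∈ closure (Metric.ball (0 : ℂ) 1) := by
      rw [closure_ball _ one_ne_zero]
      exact z.2
    obtain ⟨w, hwO, hwb⟩ := mem_closure_iff.mp hzc O hOo hzO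
    obtain ⟨x, hx⟩ := Homeomorph.unitBall.surjective (⟨w, hwb⟩ : Metric.ball (0 : ℂ) 1)
    have hpx : (p x : ℂ) = w := by simp only [hp, hx]
    have hmem : p x ∈ (Subtype.val ⁻¹' O : Set UnitDisc) := by
      change (p x : ℂ) ∈ O
      rwa [hpx]
    rw [hOe] at hmem
    exact ⟨φ x, hmem.1, x, hmem.2, rfl⟩

end NonorientableSurface

namespace AbstractSimplicialComplex

variable {V : Type*} [Fintype V] {Δ : AbstractSimplicialComplex V} {h : ℕ}

/-- Points of the quotient are closed because it is homeomorphic to a subspace of a Euclidean space;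
no separation argument for the gluing is needed. -/
theorem isPreconnected_space_diff (f : Δ.space ≃ₜ NonorientableSurface h) {F : Set (V → ℝ)}
    (hF : F.Finite) : IsPreconnected (Δ.space \ F) := by
  have : T1Space (NonorientableSurface h) := t1Space_of_injective_of_continuous f.symm.injective
    f.symm.continuous
  have hfin : (f.symm ⁻¹' (Subtype.val ⁻¹' F)).Finite :=
    (hF.preimage Subtype.val_injective.injOn).preimage f.symm.injective.injOn
  have h1 := (NonorientableSurface.isPreconnected_compl_finite hfin).image
    (fun y => (f.symm y : V → ℝ)) (continuous_subtype_val.comp f.symm.continuous).continuousOn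
  convert h1 using 1
  ext x
  constructor
  · rintro ⟨hx, hxF⟩
    refine ⟨f ⟨x, hx⟩, ?_, by simp⟩
    simpa using hxF
  · rintro ⟨y, hy, rfl⟩
    exact ⟨(f.symm y).2, hy⟩

variable [DecidableEq V]

/-- In a connected complex, functions that are constant along edges are constant. -/
theorem eq_of_edge_eq (hΔ : IsPreconnected Δ.space) {α : Type*} {g : V → α}
    (hg : ∀ u v, {u, v} ∈ Δ.faces → g u = g v) (u v : V) : g u = g v := by
  classical
  by_contra hne
  -- The indicator of a level set of g, extended linearly, is constant with value 0 or 1 on every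
  -- face. On a connected complex it would take the value 1/2 if g were not constant.
  set χ : V → ℝ := fun w => if g w = g u then 1 else 0 with hχ
  have hc : Continuous fun x : V → ℝ => ∑ w, x w * χ w := by fun_prop
  have hval : ∀ w : V, ∑ i, (Pi.single w 1 : V → ℝ) i * χ i = χ w := by
    intro w
    simp [Pi.single_apply]
  have hmem : ∀ w : V, (Pi.single w 1 : V → ℝ) ∈ Δ.space := fun w =>
    Δ.faceSpace_subset_space (Δ.singleton_mem w) (single_mem_faceSpace (mem_singleton_self w))
  obtain ⟨x, hx, hx2⟩ := hΔ.intermediate_value (hmem v) (hmem u) hc.continuousOn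
    (show (1 / 2 : ℝ) ∈ _ by
      rw [hval, hval]
      simp only [hχ, Ne.symm hne, if_false, if_true]
      constructor <;> norm_num)
  obtain ⟨hx1, s, hs, hsupp⟩ := hx
  obtain ⟨k, hk⟩ := exists_ne_zero_of_mem_stdSimplex hx1
  have hconst : ∀ w, x w * χ w = x w * χ k := by
    intro w
    by_cases hw : x w = 0
    · simp [hw]
    · have := hg w k (Δ.mem_faces_of_subset hs (by
        intro i hi
        simp only [mem_insert, mem_singleton] at hi
        rcases hi with rfl | rfl
        · exact hsupp _ hw
        · exact hsupp _ hk) (by simp))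
      simp only [hχ, this]
  simp only at hx2
  rw [Finset.sum_congr rfl fun w _ => hconst w, ← Finset.sum_mul, hx1.2, one_mul] at hx2
  simp only [hχ] at hx2
  split_ifs at hx2 <;> norm_num at hx2

theorem exists_pair_of_not_single {x : V → ℝ} (hx : x ∈ stdSimplex ℝ V)
    (hne : ∀ u, x ≠ Pi.single u 1) : ∃ u v, u ≠ v ∧ x u ≠ 0 ∧ x v ≠ 0 := by
  obtain ⟨u, hu⟩ := exists_ne_zero_of_mem_stdSimplex hx
  by_contra hcon
  push Not at hcon
  have hz : ∀ v, v ≠ u → x v = 0 := fun v hv => hcon u v hv.symm hu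
  refine hne u (funext fun v => ?_)
  by_cases hv : v = u
  · subst hv
    rw [Pi.single_eq_same, ← hx.2]
    exact (Finset.sum_eq_single v (fun i _ hi => hz i hi) (by simp)).symm
  · rw [hz v hv, Pi.single_eq_of_ne hv]

/-- If the complement of the vertices is connected, then any two triangles are connected by a chain
of triangles with common edges. -/
theorem triangle_iff_of_edge_iff (hΔ : ∀ s ∈ Δ.faces, s.card ≤ 3) (hc : Δ.IsClosedAtEdges)
    (hcon : IsPreconnected (Δ.space \ Set.range fun u : V => (Pi.single u 1 : V → ℝ)))
    {S : Finset V → Prop}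
    (hS : ∀ s ∈ Δ.faces, ∀ t ∈ Δ.faces, s.card = 3 → t.card = 3 → ∀ u v, u ≠ v → u ∈ s → v ∈ s →
      u ∈ t → v ∈ t → (S s ↔ S t)) {s t : Finset V} (hs : s ∈ Δ.faces) (ht : t ∈ Δ.faces)
    (hs3 : s.card = 3) (ht3 : t.card = 3) (hSs : S s) : S t := by
  classical
  by_contra hSt
  -- A and B are the closed unions of the triangles with and without the property S. They cover the
  -- complement of the vertices, so by connectedness they meet at a point that is not a vertex,
  -- hence at a point whose support contains an edge common to a triangle of each kind.
  set A : Set (V → ℝ) := ⋃ r ∈ {r : Finset V | r ∈ Δ.faces ∧ r.card = 3 ∧ S r}, faceSpace r with hA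
  set B : Set (V → ℝ) := ⋃ r ∈ {r : Finset V | r ∈ Δ.faces ∧ r.card = 3 ∧ ¬ S r}, faceSpace r with hB
  have hAc : IsClosed A := (Set.toFinite _).isClosed_biUnion fun r _ => isClosed_faceSpace r
  have hBc : IsClosed B := (Set.toFinite _).isClosed_biUnion fun r _ => isClosed_faceSpace r
  have hbary : ∀ r : Finset V, r ∈ Δ.faces → r.card = 3 → ∃ x ∈ faceSpace r,
      x ∈ Δ.space \ Set.range fun u : V => (Pi.single u 1 : V → ℝ) := by
    intro r hr hr3
    set x : V → ℝ := fun i => if i ∈ r then 1 / 3 else 0 with hx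
    have hxr : x ∈ faceSpace r := by
      refine ⟨⟨fun i => by simp only [hx]; split_ifs <;> norm_num, ?_⟩, fun i hi => ?_⟩
      · simp [hx, Finset.sum_ite_mem, hr3]
      · by_contra h
        exact hi (by simp [hx, h])
    refine ⟨x, hxr, Δ.faceSpace_subset_space hr hxr, ?_⟩
    rintro ⟨u, hu⟩
    have := congrFun hu u
    simp only [Pi.single_eq_same, hx] at this
    split_ifs at this <;> norm_num at this
  have hcover : (Δ.space \ Set.range fun u : V => (Pi.single u 1 : V → ℝ)) ⊆ A ∪ B := by
    rintro x ⟨hx, hxv⟩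
    obtain ⟨u, v, huv, hu, hv⟩ := exists_pair_of_not_single hx.1 fun u h => hxv ⟨u, h.symm⟩
    have h0 := hx.1.1
    have hr : ∃ r ∈ Δ.faces, r.card = 3 ∧ x ∈ faceSpace r := by
      rcases mem_star_cases Δ hΔ huv hx (lt_of_le_of_ne (h0 u) hu.symm)
        (lt_of_le_of_ne (h0 v) hv.symm) with ⟨m, hmu, hmv, hm, hzero, -⟩ | ⟨hzero, -⟩
      · refine ⟨_, hm, Finset.card_eq_three.mpr ⟨u, v, m, huv, hmu.symm, hmv.symm, rfl⟩, hx.1,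
          fun i hi => ?_⟩
        by_contra hcon
        simp only [mem_insert, mem_singleton, not_or] at hcon
        exact hi (hzero i hcon.1 hcon.2.1 hcon.2.2)
      · obtain ⟨hx1, r, hr, hsupp⟩ := hx
        have he : {u, v} ∈ Δ.faces := Δ.mem_faces_of_subset hr (by
          intro i hi
          simp only [mem_insert, mem_singleton] at hi
          rcases hi with rfl | rfl
          · exact hsupp _ hu
          · exact hsupp _ hv) (by simp)
        obtain ⟨w, x', -, hwu, hwv, -, -, hlink⟩ := hc u v huv he
        refine ⟨{u, v, w}, (hlink w hwu hwv).mpr (Or.inl rfl),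
          Finset.card_eq_three.mpr ⟨u, v, w, huv, hwu.symm, hwv.symm, rfl⟩, hx1, fun i hi => ?_⟩
        by_contra hcon
        simp only [mem_insert, mem_singleton, not_or] at hcon
        exact hi (hzero i hcon.1 hcon.2.1)
    obtain ⟨r, hr, hr3, hxr⟩ := hr
    by_cases hSr : S r
    · exact Or.inl (Set.mem_biUnion (show r ∈ {r | _} from ⟨hr, hr3, hSr⟩) hxr)
    · exact Or.inr (Set.mem_biUnion (show r ∈ {r | _} from ⟨hr, hr3, hSr⟩) hxr)
  obtain ⟨x, ⟨hx, hxv⟩, hxA, hxB⟩ := isPreconnected_closed_iff.mp hcon A B hAc hBc hcover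
    (by
      obtain ⟨x, hxs, hx⟩ := hbary s hs hs3
      exact ⟨x, hx, Set.mem_biUnion (show s ∈ {r | _} from ⟨hs, hs3, hSs⟩) hxs⟩)
    (by
      obtain ⟨x, hxt, hx⟩ := hbary t ht ht3
      exact ⟨x, hx, Set.mem_biUnion (show t ∈ {r | _} from ⟨ht, ht3, hSt⟩) hxt⟩)
  simp only [hA, hB, Set.mem_iUnion, exists_prop] at hxA hxB
  obtain ⟨r, ⟨hr, hr3, hSr⟩, hxr⟩ := hxA
  obtain ⟨r', ⟨hr', hr3', hSr'⟩, hxr'⟩ := hxB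
  obtain ⟨u, v, huv, hu, hv⟩ := exists_pair_of_not_single hx.1 fun u h => hxv ⟨u, h.symm⟩
  exact hSr' ((hS r hr r' hr' hr3 hr3' u v huv (hxr.2 u hu) (hxr.2 v hv) (hxr'.2 u hu)
    (hxr'.2 v hv)).mp hSr)

end AbstractSimplicialComplex

/-! ### Six independent cocycles on the ten-vertex complex -/

namespace FacetList

theorem mem_faces_tenVertexComplex {s : Finset (Fin 10)} (hs : s.Nonempty) :
    s ∈ tenVertexComplex.faces ↔ ∃ t ∈ triangles, ∀ i ∈ s, (i : ℕ) ∈ t :=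
  ⟨fun h => h.2, fun h => ⟨hs, h⟩⟩

set_option synthInstance.maxHeartbeats 200000 in
set_option synthInstance.maxSize 1000 in
theorem isClosedAtEdges_tenVertexComplex : tenVertexComplex.IsClosedAtEdges := by
  have key : ∀ u v : Fin 10, u ≠ v → (∃ t ∈ triangles, (u : ℕ) ∈ t ∧ (v : ℕ) ∈ t) →
      ∃ w x : Fin 10, w ≠ x ∧ ∀ z : Fin 10,
        (z ≠ u ∧ z ≠ v ∧ ∃ t ∈ triangles, (u : ℕ) ∈ t ∧ (v : ℕ) ∈ t ∧ (z : ℕ) ∈ t) ↔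
          z = w ∨ z = x := by
    decide +kernel
  intro u v huv he
  obtain ⟨w, x, hwx, h⟩ := key u v huv (by
    obtain ⟨-, t, ht, h⟩ := he
    exact ⟨t, ht, h u (by simp), h v (by simp)⟩)
  obtain ⟨hwu, hwv, -⟩ := (h w).mpr (Or.inl rfl)
  obtain ⟨hxu, hxv, -⟩ := (h x).mpr (Or.inr rfl)
  refine ⟨w, x, hwx, hwu, hwv, hxu, hxv, fun z hzu hzv => ?_⟩
  rw [← h z, mem_faces_tenVertexComplex (by simp)]
  simp [hzu, hzv]

/-- The edges that are crossed by six curves, which are dual to the cycles `0 1 m` for the vertices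
`m` in `cycleVertex`. -/
def crossedEdges : Fin 6 → List (ℕ × ℕ) :=
  ![[(1, 2), (2, 4), (2, 9), (3, 6), (4, 5), (4, 7), (5, 6), (6, 9)],
    [(0, 3), (2, 7), (3, 5), (3, 8), (4, 5), (4, 7), (5, 6), (7, 8)],
    [(0, 4), (3, 6), (3, 9), (4, 6), (4, 8), (4, 9), (5, 6)],
    [(1, 5), (2, 7), (2, 8), (4, 7), (5, 7), (5, 8), (5, 9)],
    [(1, 8), (2, 7), (2, 8), (4, 5), (4, 6), (4, 7), (5, 8), (6, 8)],
    [(1, 9), (2, 9), (3, 6), (4, 5), (5, 6), (5, 7), (5, 9), (6, 9)]]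

/-- The third vertices of the cycles `0 1 m`. -/
def cycleVertex : Fin 6 → Fin 10 := ![2, 3, 4, 5, 8, 9]

/-- The cocycle that counts the crossings with the curve `j`. -/
def crossing (j : Fin 6) (u v : Fin 10) : ℤˣ :=
  if (min (u : ℕ) v, max (u : ℕ) v) ∈ crossedEdges j then -1 else 1

/-- A closed curve in general position crosses the boundary of each triangle an even number of
times. -/
theorem isCocycle_crossing (j : Fin 6) : tenVertexComplex.IsCocycle (crossing j) := by
  have key : ∀ j, ∀ t ∈ triangles, ∀ u : Fin 10, (u : ℕ) ∈ t → ∀ v : Fin 10, (v : ℕ) ∈ t →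
      ∀ w : Fin 10, (w : ℕ) ∈ t → crossing j u v * crossing j v w = crossing j u w := by
    decide +kernel
  rintro u v w ⟨-, t, ht, h⟩
  exact key j t ht u (h u (by simp)) v (h v (by simp)) w (h w (by simp))

/-- The product of the cocycles in `J`. -/
def crossingProd (J : Fin 6 → Bool) (u v : Fin 10) : ℤˣ :=
  ∏ j, if J j then crossing j u v else 1

theorem isCocycle_crossingProd (J : Fin 6 → Bool) : tenVertexComplex.IsCocycle (crossingProd J) := by
  intro u v w h
  simp only [crossingProd]
  rw [← Finset.prod_mul_distrib]
  refine Finset.prod_congr rfl fun j _ => ?_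
  split_ifs
  · exact isCocycle_crossing j u v w h
  · exact one_mul 1

/-- The six curves and the six cycles through the edge 0 1 are dual with respect to the intersection
pairing modulo two. This makes the 64 products of crossing cocycles pairwise non-cohomologous. -/
theorem crossing_cycle : ∀ i j : Fin 6, crossing j 0 1 * crossing j 1 (cycleVertex i) *
    crossing j 0 (cycleVertex i) = if j = i then -1 else 1 := by
  decide +kernel

theorem crossingProd_cycle (J : Fin 6 → Bool) (i : Fin 6) :
    crossingProd J 0 1 * crossingProd J 1 (cycleVertex i) * crossingProd J 0 (cycleVertex i) =
      if J i then -1 else 1 := by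
  simp only [crossingProd]
  rw [← Finset.prod_mul_distrib, ← Finset.prod_mul_distrib, Finset.prod_eq_single i]
  · split_ifs
    · rw [crossing_cycle, if_pos rfl]
    · rfl
  · intro j _ hj
    split_ifs
    · rw [crossing_cycle, if_neg hj]
    · rfl
  · simp

/-- A coboundary has product 1 around a cycle, so cohomologous products have the same value on each
of the six cycles, and these values determine `J`. -/
theorem eq_of_cohomologous_crossingProd {J J' : Fin 6 → Bool}
    (h : tenVertexComplex.Cohomologous (crossingProd J) (crossingProd J')) : J = J' := by
  obtain ⟨g, hg⟩ := h
  have hedge : ∀ i, (∃ t ∈ triangles, 0 ∈ t ∧ 1 ∈ t) ∧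
      (∃ t ∈ triangles, 1 ∈ t ∧ (cycleVertex i : ℕ) ∈ t) ∧
      ∃ t ∈ triangles, 0 ∈ t ∧ (cycleVertex i : ℕ) ∈ t := by decide +kernel
  funext i
  obtain ⟨h1, h2, h3⟩ := hedge i
  have e1 := hg 0 1 ((mem_faces_tenVertexComplex (by simp)).mpr (by simpa using h1))
  have e2 := hg 1 (cycleVertex i) ((mem_faces_tenVertexComplex (by simp)).mpr (by simpa using h2))
  have e3 := hg 0 (cycleVertex i) ((mem_faces_tenVertexComplex (by simp)).mpr (by simpa using h3))
  have key : (if J i then (-1 : ℤˣ) else 1) * (if J' i then -1 else 1) = 1 := by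
    rw [← crossingProd_cycle J, ← crossingProd_cycle J']
    calc _ = (crossingProd J 0 1 * crossingProd J' 0 1) *
          (crossingProd J 1 (cycleVertex i) * crossingProd J' 1 (cycleVertex i)) *
          (crossingProd J 0 (cycleVertex i) * crossingProd J' 0 (cycleVertex i)) := by ac_rfl
      _ = (g 0 * g 0) * (g 1 * g 1) * (g (cycleVertex i) * g (cycleVertex i)) := by
        rw [e1, e2, e3]; ac_rfl
      _ = 1 := by simp only [Int.units_mul_self, one_mul]
  cases hJ : J i <;> cases hJ' : J' i <;> simp [hJ, hJ'] at key ⊢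

end FacetList

/-! ### Rank counting modulo two and the lower bound -/

namespace AbstractSimplicialComplex

section

variable {V : Type*}

/-- The additive form of a sign. -/
def signExponent (x : ℤˣ) : ZMod 2 := if x = 1 then 0 else 1

theorem signExponent_mul (x y : ℤˣ) : signExponent (x * y) = signExponent x + signExponent y := by
  revert x y
  decide

theorem signExponent_injective : Function.Injective signExponent := by
  intro x y
  revert x y
  decide

theorem signExponent_surjective : Function.Surjective signExponent := by
  decide

/-- The function on sets of two vertices that corresponds to a symmetric function `b`. -/
noncomputable def toEdge (b : V → V → ℤˣ) (s : Finset V) : ZMod 2 :=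
  open Classical in if ∃ u ∈ s, ∃ v ∈ s, b u v = -1 then 1 else 0

theorem IsCocycle.toEdge_pair [DecidableEq V] {Δ : AbstractSimplicialComplex V}
    {b : V → V → ℤˣ} (hb : Δ.IsCocycle b) {u v : V} (he : {u, v} ∈ Δ.faces) : toEdge b {u, v} = signExponent (b u v) := by
  have h1 := hb.self u
  have h2 := hb.self v
  have h3 := hb.symm he
  have h4 : (1 : ℤˣ) ≠ -1 := by decide
  unfold toEdge signExponent
  simp only [mem_insert, mem_singleton, exists_eq_or_imp, exists_eq_left, h1, h2, h3, h4, false_or,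
    or_false, or_self]
  rcases Int.units_eq_one_or (b u v) with h | h <;> simp [h, h4.symm]

end

variable {V : Type*} [Fintype V]

/-- The edges of a complex. -/
abbrev Edge (Δ : AbstractSimplicialComplex V) : Type _ := {e : Finset V // e ∈ Δ.faces ∧ e.card = 2}

/-- The triangles of a complex. -/
abbrev Triangle (Δ : AbstractSimplicialComplex V) : Type _ :=
  {t : Finset V // t ∈ Δ.faces ∧ t.card = 3}

noncomputable instance (Δ : AbstractSimplicialComplex V) : Fintype Δ.Edge := Fintype.ofFinite _

noncomputable instance (Δ : AbstractSimplicialComplex V) : Fintype Δ.Triangle := Fintype.ofFinite _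

theorem card_edges_le {Δ : AbstractSimplicialComplex V} :
    Fintype.card Δ.Edge ≤ (Fintype.card V).choose 2 := by
  classical
  rw [← Finset.card_univ (α := V), ← Finset.card_powersetCard, ← Finset.card_univ (α := Δ.Edge),
    ← Finset.card_map (Function.Embedding.subtype _)]
  refine Finset.card_le_card fun s hs => ?_
  obtain ⟨e, -, rfl⟩ := Finset.mem_map.mp hs
  exact Finset.mem_powersetCard.mpr ⟨Finset.subset_univ _, e.2.2⟩

variable [DecidableEq V]

/-- The matrix of the coboundary of functions on the vertices modulo two. -/
def vertexMatrix (Δ : AbstractSimplicialComplex V) : Matrix Δ.Edge V (ZMod 2) :=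
  fun e v => if v ∈ e.1 then 1 else 0

/-- The matrix of the coboundary of functions on the edges modulo two. -/
def edgeMatrix (Δ : AbstractSimplicialComplex V) : Matrix Δ.Triangle Δ.Edge (ZMod 2) :=
  fun t e => if e.1 ⊆ t.1 then 1 else 0

variable {Δ : AbstractSimplicialComplex V}

theorem vertexMatrix_mulVec (g : V → ZMod 2) {u v : V} (huv : u ≠ v) (e : Δ.Edge)
    (he : e.1 = {u, v}) : (Δ.vertexMatrix.mulVec g) e = g u + g v := by
  simp only [Matrix.mulVec, dotProduct, vertexMatrix, ite_mul, one_mul, zero_mul, he]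
  rw [Finset.sum_ite_mem, Finset.univ_inter, Finset.sum_pair huv]

theorem edgeMatrix_mulVec (φ : Finset V → ZMod 2) {u v w : V} (huv : u ≠ v) (huw : u ≠ w)
    (hvw : v ≠ w) (t : Δ.Triangle) (ht : t.1 = {u, v, w}) :
    (Δ.edgeMatrix.mulVec fun e => φ e.1) t = φ {u, v} + φ {u, w} + φ {v, w} := by
  simp only [Matrix.mulVec, dotProduct, edgeMatrix, ite_mul, one_mul, zero_mul]
  rw [← Finset.sum_filter]
  have hface : ∀ s : Finset V, s ⊆ {u, v, w} → s.Nonempty → s ∈ Δ.faces := fun s hs hne =>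
    Δ.mem_faces_of_subset t.2.1 (ht ▸ hs) hne
  let e1 : Δ.Edge := ⟨{u, v}, hface _ (by grind) (by simp), Finset.card_pair huv⟩
  let e2 : Δ.Edge := ⟨{u, w}, hface _ (by grind) (by simp), Finset.card_pair huw⟩
  let e3 : Δ.Edge := ⟨{v, w}, hface _ (by grind) (by simp), Finset.card_pair hvw⟩
  have h12 : e1 ≠ e2 := fun h => by
    have := congrArg Subtype.val h
    have : v ∈ ({u, w} : Finset V) := by rw [← show ({u, v} : Finset V) = {u, w} from this]; simp
    grind
  have h13 : e1 ≠ e3 := fun h => by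
    have := congrArg Subtype.val h
    have : u ∈ ({v, w} : Finset V) := by rw [← show ({u, v} : Finset V) = {v, w} from this]; simp
    grind
  have h23 : e2 ≠ e3 := fun h => by
    have := congrArg Subtype.val h
    have : u ∈ ({v, w} : Finset V) := by rw [← show ({u, w} : Finset V) = {v, w} from this]; simp
    grind
  have hfilter : (univ.filter fun e : Δ.Edge => e.1 ⊆ t.1) = {e1, e2, e3} := by
    ext e
    simp only [mem_filter, mem_univ, true_and, mem_insert, mem_singleton, Subtype.ext_iff, e1, e2, e3]
    rw [ht]
    constructor
    · intro h
      obtain ⟨a, b, hab, he⟩ := Finset.card_eq_two.mp e.2.2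
      rw [he] at h ⊢
      have ha : a ∈ ({u, v, w} : Finset V) := h (by simp)
      have hb : b ∈ ({u, v, w} : Finset V) := h (by simp)
      simp only [mem_insert, mem_singleton] at ha hb
      rcases ha with rfl | rfl | rfl <;> rcases hb with rfl | rfl | rfl <;>
        first | exact absurd rfl hab | simp [Finset.pair_comm]
    · rintro (h | h | h) <;> rw [h] <;> grind
  rw [hfilter, Finset.sum_insert (by simp [h12, h13]), Finset.sum_pair h23, add_assoc]

theorem IsCocycle.edgeMatrix_mulVec_toEdge {b : V → V → ℤˣ} (hb : Δ.IsCocycle b) :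
    Δ.edgeMatrix.mulVec (fun e => toEdge b e.1) = 0 := by
  funext t
  obtain ⟨u, v, w, huv, huw, hvw, ht⟩ := Finset.card_eq_three.mp t.2.2
  have hface : ∀ s : Finset V, s ⊆ {u, v, w} → s.Nonempty → s ∈ Δ.faces := fun s hs hne =>
    Δ.mem_faces_of_subset t.2.1 (ht ▸ hs) hne
  rw [edgeMatrix_mulVec (toEdge b) huv huw hvw t ht, hb.toEdge_pair (hface _ (by grind) (by simp)),
    hb.toEdge_pair (hface _ (by grind) (by simp)), hb.toEdge_pair (hface _ (by grind) (by simp)),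
    ← hb u v w (ht ▸ t.2.1), signExponent_mul, Pi.zero_apply]
  generalize signExponent (b u v) = x
  generalize signExponent (b v w) = y
  revert x y
  decide

theorem IsCocycle.cohomologous_of_toEdge {b b' : V → V → ℤˣ} (hb : Δ.IsCocycle b)
    (hb' : Δ.IsCocycle b') {g : V → ZMod 2}
    (h : ∀ e : Δ.Edge, toEdge b e.1 + toEdge b' e.1 = (Δ.vertexMatrix.mulVec g) e) :
    Δ.Cohomologous b b' := by
  choose g' hg' using fun v => signExponent_surjective (g v)
  refine ⟨g', fun u v he => ?_⟩
  by_cases huv : u = v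
  · subst huv
    rw [hb.self, hb'.self, one_mul, Int.units_mul_self]
  · apply signExponent_injective
    have := h ⟨{u, v}, he, Finset.card_pair huv⟩
    rw [vertexMatrix_mulVec g huv _ rfl, hb.toEdge_pair he, hb'.toEdge_pair he] at this
    rw [signExponent_mul, signExponent_mul, this, hg', hg']

theorem finrank_ker_le_one_of_const {α : Type*} [Fintype α] {β : Type*} [Fintype β]
    (M : Matrix β α (ZMod 2)) (h : ∀ g : α → ZMod 2, M.mulVec g = 0 → ∀ a b, g a = g b) :
    Module.finrank (ZMod 2) (LinearMap.ker M.mulVecLin) ≤ 1 := by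
  by_cases h0 : ∃ g : LinearMap.ker M.mulVecLin, g ≠ 0
  · obtain ⟨g, hg⟩ := h0
    refine finrank_le_one g fun f => ?_
    obtain ⟨a, ha⟩ : ∃ a, g.1 a ≠ 0 := by
      by_contra hcon
      push Not at hcon
      exact hg (Subtype.ext (funext hcon))
    refine ⟨f.1 a, Subtype.ext (funext fun b => ?_)⟩
    have h1 : g.1 b = 1 := by
      rw [h g.1 g.2 b a]
      generalize g.1 a = x at ha
      revert x
      decide
    simp only [SetLike.val_smul, Pi.smul_apply, smul_eq_mul, h1, mul_one]
    exact h f.1 f.2 a b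
  · push Not at h0
    have : Subsingleton (LinearMap.ker M.mulVecLin) := ⟨fun a b => (h0 a).trans (h0 b).symm⟩
    rw [Module.finrank_zero_of_subsingleton]
    exact zero_le_one

theorem card_le_rank_add_one_of_const {α : Type*} [Fintype α] {β : Type*} [Fintype β]
    (M : Matrix β α (ZMod 2)) (h : ∀ g : α → ZMod 2, M.mulVec g = 0 → ∀ a b, g a = g b) :
    Fintype.card α ≤ M.rank + 1 := by
  have h1 := finrank_ker_le_one_of_const M h
  have h2 := LinearMap.finrank_range_add_finrank_ker M.mulVecLin
  rw [Module.finrank_fintype_fun_eq_card] at h2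
  unfold Matrix.rank
  omega

/-- A function in the kernel agrees at the ends of every edge, hence is constant by connectedness.
-/
theorem card_vertices_le_rank (hΔ : IsPreconnected Δ.space) :
    Fintype.card V ≤ Δ.vertexMatrix.rank + 1 := by
  refine card_le_rank_add_one_of_const _ fun g hg => eq_of_edge_eq hΔ fun u v he => ?_
  by_cases huv : u = v
  · rw [huv]
  · have := congrFun hg ⟨{u, v}, he, Finset.card_pair huv⟩
    rw [vertexMatrix_mulVec g huv _ rfl, Pi.zero_apply] at this
    generalize g u = x at this ⊢
    generalize g v = y at this ⊢
    revert x y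
    decide

/-- The two triangles at an edge. -/
theorem IsClosedAtEdges.exists_triangles (hc : Δ.IsClosedAtEdges) (e : Δ.Edge) :
    ∃ s t : Δ.Triangle, s ≠ t ∧ (univ.filter fun r : Δ.Triangle => e.1 ⊆ r.1) = {s, t} := by
  obtain ⟨u, v, huv, he⟩ := Finset.card_eq_two.mp e.2.2
  obtain ⟨w, x, hwx, hwu, hwv, hxu, hxv, hlink⟩ := hc u v huv (he ▸ e.2.1)
  refine ⟨⟨{u, v, w}, (hlink w hwu hwv).mpr (Or.inl rfl),
      Finset.card_eq_three.mpr ⟨u, v, w, huv, hwu.symm, hwv.symm, rfl⟩⟩,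
    ⟨{u, v, x}, (hlink x hxu hxv).mpr (Or.inr rfl),
      Finset.card_eq_three.mpr ⟨u, v, x, huv, hxu.symm, hxv.symm, rfl⟩⟩, fun h => ?_, ?_⟩
  · have h1 : ({u, v, w} : Finset V) = {u, v, x} := congrArg Subtype.val h
    have h2 : w ∈ ({u, v, x} : Finset V) := by rw [← h1]; simp
    simp [hwu, hwv, hwx] at h2
  · ext r
    simp only [mem_filter, mem_univ, true_and, mem_insert, mem_singleton, Subtype.ext_iff]
    rw [he]
    constructor
    · intro h
      have hcard : (r.1 \ {u, v}).card = 1 := by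
        rw [Finset.card_sdiff_of_subset h, r.2.2, Finset.card_pair huv]
      obtain ⟨z, hz⟩ := Finset.card_eq_one.mp hcard
      have hz' : z ∈ r.1 \ {u, v} := by rw [hz]; simp
      simp only [mem_sdiff, mem_insert, mem_singleton, not_or] at hz'
      have hr : r.1 = {u, v, z} := by
        rw [← Finset.union_sdiff_of_subset h, hz]
        ext i
        simp
      rcases (hlink z hz'.2.1 hz'.2.2).mp (hr ▸ r.2.1) with rfl | rfl
      · exact Or.inl hr
      · exact Or.inr hr
    · rintro (h | h) <;> rw [h] <;> grind

/-- The kernel of the transpose consists of the 2-cycles modulo two. A cycle has the same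
coefficient on the two triangles at an edge, and triangles are linked through edges because the
space without its vertices is connected; so the cycle is constant. -/
theorem card_triangles_le_rank (h3 : ∀ s ∈ Δ.faces, s.card ≤ 3) (hc : Δ.IsClosedAtEdges)
    (hcon : IsPreconnected (Δ.space \ Set.range fun u : V => (Pi.single u 1 : V → ℝ))) :
    Fintype.card Δ.Triangle ≤ Δ.edgeMatrix.rank + 1 := by
  rw [← Matrix.rank_transpose]
  refine card_le_rank_add_one_of_const _ fun z hz => ?_
  have hadj : ∀ (e : Δ.Edge) (s t : Δ.Triangle), e.1 ⊆ s.1 → e.1 ⊆ t.1 → z s = z t := by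
    intro e s t hs ht
    obtain ⟨a, b, hab, hfilter⟩ := hc.exists_triangles e
    have hs' : s ∈ ({a, b} : Finset Δ.Triangle) := by rw [← hfilter]; simpa using hs
    have ht' : t ∈ ({a, b} : Finset Δ.Triangle) := by rw [← hfilter]; simpa using ht
    have h0 := congrFun hz e
    simp only [Matrix.mulVec, dotProduct, Matrix.transpose_apply, edgeMatrix, ite_mul, one_mul, zero_mul,
      Pi.zero_apply] at h0
    rw [← Finset.sum_filter, hfilter, Finset.sum_pair hab] at h0
    have hz2 : z a = z b := by
      generalize z a = x at h0 ⊢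
      generalize z b = y at h0 ⊢
      revert x y
      decide
    simp only [mem_insert, mem_singleton] at hs' ht'
    rcases hs' with rfl | rfl <;> rcases ht' with rfl | rfl <;> simp [hz2]
  intro s t
  have key := triangle_iff_of_edge_iff h3 hc hcon
    (S := fun r => ∃ hr : r ∈ Δ.faces ∧ r.card = 3, z ⟨r, hr⟩ = z s) (by
      intro r hr r' hr' hr3 hr3' u v huv hu hv hu' hv'
      have hsub : ∀ r : Finset V, u ∈ r → v ∈ r → ({u, v} : Finset V) ⊆ r := by
        intro r hu hv i hi
        simp only [mem_insert, mem_singleton] at hi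
        rcases hi with rfl | rfl <;> assumption
      have h := hadj ⟨{u, v}, Δ.mem_faces_of_subset hr (hsub r hu hv) (by simp), Finset.card_pair huv⟩
        ⟨r, hr, hr3⟩ ⟨r', hr', hr3'⟩ (hsub r hu hv) (hsub r' hu' hv')
      constructor
      · rintro ⟨_, h'⟩
        exact ⟨⟨hr', hr3'⟩, h ▸ h'⟩
      · rintro ⟨_, h'⟩
        exact ⟨⟨hr, hr3⟩, h ▸ h'⟩) s.2.1 t.2.1 s.2.2 t.2.2 ⟨s.2, rfl⟩
  obtain ⟨_, h⟩ := key
  exact h.symm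

/-- Incident pairs of a triangle and an edge are counted in two ways. -/
theorem three_mul_card_triangles (hc : Δ.IsClosedAtEdges) :
    Fintype.card Δ.Triangle * 3 = Fintype.card Δ.Edge * 2 := by
  classical
  refine Finset.card_mul_eq_card_mul (fun (t : Δ.Triangle) (e : Δ.Edge) => e.1 ⊆ t.1)
    (s := univ) (t := univ) (fun t _ => ?_) (fun e _ => ?_)
  · have h1 : ((univ.filter fun e : Δ.Edge => e.1 ⊆ t.1).map (Function.Embedding.subtype _)) =
        t.1.powersetCard 2 := by
      ext s
      simp only [mem_map, mem_filter, mem_univ, true_and, Function.Embedding.coe_subtype,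
        mem_powersetCard]
      constructor
      · rintro ⟨e, he, rfl⟩
        exact ⟨he, e.2.2⟩
      · rintro ⟨hs, hs2⟩
        exact ⟨⟨s, Δ.mem_faces_of_subset t.2.1 hs (Finset.card_pos.mp (by omega)), hs2⟩, hs, rfl⟩
    rw [Finset.bipartiteAbove, ← Finset.card_map, h1, Finset.card_powersetCard, t.2.2]
    rfl
  · obtain ⟨a, b, hab, hfilter⟩ := hc.exists_triangles e
    rw [Finset.bipartiteBelow, hfilter, Finset.card_pair hab]

/-- Pairwise non-cohomologous cocycles bound the first Betti number from below. -/
theorem rank_add_rank_le {k : ℕ} (b : (Fin k → Bool) → V → V → ℤˣ)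
    (hb : ∀ J, Δ.IsCocycle (b J)) (hinj : ∀ J J', Δ.Cohomologous (b J) (b J') → J = J') :
    k + Δ.vertexMatrix.rank + Δ.edgeMatrix.rank ≤ Fintype.card Δ.Edge := by
  have hcomp : ∀ g : V → ZMod 2, Δ.edgeMatrix.mulVec (Δ.vertexMatrix.mulVec g) = 0 := by
    intro g
    funext t
    obtain ⟨u, v, w, huv, huw, hvw, ht⟩ := Finset.card_eq_three.mp t.2.2
    have e : Δ.vertexMatrix.mulVec g = fun e : Δ.Edge => ∑ v ∈ e.1, g v := by
      funext e
      simp [Matrix.mulVec, dotProduct, vertexMatrix, Finset.sum_ite_mem]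
    rw [e, edgeMatrix_mulVec (fun s => ∑ v ∈ s, g v) huv huw hvw t ht, Finset.sum_pair huv,
      Finset.sum_pair huw, Finset.sum_pair hvw, Pi.zero_apply]
    generalize g u = x
    generalize g v = y
    generalize g w = z
    revert x y z
    decide
  set R := LinearMap.range Δ.vertexMatrix.mulVecLin with hR
  set Z := LinearMap.ker Δ.edgeMatrix.mulVecLin with hZ
  -- The cosets of the coboundaries R through the given cocycles are disjoint subsets of the
  -- cocycles Z. Counting elements over the field with two elements gives k + dim R ≤ dim Z.
  let φ : (Fin k → Bool) × R → Z := fun p => ⟨(fun e => toEdge (b p.1) e.1) + p.2.1, by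
    obtain ⟨g, hg⟩ := p.2.2
    rw [hZ, LinearMap.mem_ker, map_add, Matrix.mulVecLin_apply, (hb p.1).edgeMatrix_mulVec_toEdge,
      ← hg, Matrix.mulVecLin_apply, Matrix.mulVecLin_apply, hcomp, add_zero]⟩
  have hφ : Function.Injective φ := by
    rintro ⟨J, y⟩ ⟨J', y'⟩ h
    have h1 : (fun e : Δ.Edge => toEdge (b J) e.1) + y.1 = (fun e => toEdge (b J') e.1) + y'.1 :=
      congrArg Subtype.val h
    obtain ⟨g, hg⟩ := (y - y').2
    have hJ : J = J' := by
      refine hinj J J' ((hb J).cohomologous_of_toEdge (hb J') (g := g) fun e => ?_)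
      have h2 := congrFun h1 e
      have h3 := congrFun hg e
      simp only [Pi.add_apply] at h2
      simp only [Matrix.mulVecLin_apply, Submodule.coe_sub, Pi.sub_apply] at h3
      rw [h3]
      have key : ∀ p q r s : ZMod 2, p + r = q + s → p + q = r - s := by decide
      exact key _ _ _ _ h2
    subst hJ
    have h2 : y = y' := Subtype.ext (add_left_cancel h1)
    rw [h2]
  have hcard := Nat.card_le_card_of_injective φ hφ
  rw [Nat.card_prod, Nat.card_eq_fintype_card (α := Fin k → Bool), Fintype.card_fun,
    Fintype.card_bool, Fintype.card_fin, Module.natCard_eq_pow_finrank (K := ZMod 2) (V := R),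
    Module.natCard_eq_pow_finrank (K := ZMod 2) (V := Z), Nat.card_zmod, ← pow_add] at hcard
  have hle : k + Δ.vertexMatrix.rank ≤
      Module.finrank (ZMod 2) (LinearMap.ker Δ.edgeMatrix.mulVecLin) :=
    (Nat.pow_le_pow_iff_right (by norm_num)).mp hcard
  have hrn := LinearMap.finrank_range_add_finrank_ker Δ.edgeMatrix.mulVecLin
  rw [Module.finrank_fintype_fun_eq_card] at hrn
  change Δ.edgeMatrix.rank + _ = _ at hrn
  omega

/-- A triangulation of the non-orientable surface of genus six has at least ten vertices. -/
theorem ten_le_of_triangulates {n : ℕ} {Δ : AbstractSimplicialComplex (Fin n)}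
    (hΔ : Δ.Triangulates (NonorientableSurface 6)) : 10 ≤ n := by
  obtain ⟨⟨h3, -⟩, ⟨f⟩⟩ := hΔ
  obtain ⟨f₀⟩ := FacetList.nonempty_homeomorph_tenVertexComplex
  have h : Δ.space ≃ₜ FacetList.tenVertexComplex.space := f.trans f₀.symm
  have hc : Δ.IsClosedAtEdges := isClosedAtEdges_of_homeomorph h3
    FacetList.isTwoDimensional_tenVertexComplex.1 FacetList.isClosedAtEdges_tenVertexComplex h
  obtain ⟨Φ, hΦ, hΦinj⟩ := Δ.exists_cohomology_injection FacetList.tenVertexComplex h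
  have h1 := rank_add_rank_le (fun J => Φ (FacetList.crossingProd J))
    (fun J => hΦ _ (FacetList.isCocycle_crossingProd J)) (fun J J' hJ =>
      FacetList.eq_of_cohomologous_crossingProd (hΦinj _ _ (FacetList.isCocycle_crossingProd J)
        (FacetList.isCocycle_crossingProd J') hJ))
  have h2 : Fintype.card (Fin n) ≤ Δ.vertexMatrix.rank + 1 :=
    card_vertices_le_rank (by simpa using isPreconnected_space_diff f Set.finite_empty)
  have h4 := card_triangles_le_rank h3 hc (isPreconnected_space_diff f (Set.finite_range _))
  have h5 := three_mul_card_triangles hc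
  have h6 := card_edges_le (Δ := Δ)
  rw [Fintype.card_fin] at h2 h6
  by_contra hn
  -- The rank inequalities give n + t + 4 ≤ e for the numbers t of triangles and e of edges. With 3t
  -- = 2e this is e ≥ 3n + 12, more than the number of pairs of vertices when n ≤ 9.
  have h7 : n.choose 2 < 3 * n + 12 := by
    have : n ≤ 9 := by omega
    interval_cases n <;> decide
  omega

end AbstractSimplicialComplex

theorem theorem7 :
    -- 10 is the minimal number of vertices of a triangulation of `N_6`
    IsLeast {n : ℕ | ∃ Δ : AbstractSimplicialComplex (Fin n),
      Δ.Triangulates (NonorientableSurface 6)} 10 ∧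
    -- some 10-vertex triangulation has a polyhedral immersion with 2-fold rotational symmetry
    (∃ Δ : AbstractSimplicialComplex (Fin 10), Δ.Triangulates (NonorientableSurface 6) ∧
      ∃ ψ : Fin 10 → EuclideanSpace ℝ (Fin 3),
        Δ.IsPolyhedralImmersion ψ ∧ Δ.HasRotationalSymmetry ψ 2) ∧
    -- 10 is the minimal number of vertices of a polyhedrally immersed triangulation of `N_6`
    IsLeast {n : ℕ | ∃ Δ : AbstractSimplicialComplex (Fin n),
      Δ.Triangulates (NonorientableSurface 6) ∧
      ∃ ψ : Fin n → EuclideanSpace ℝ (Fin 3), Δ.IsPolyhedralImmersion ψ} 10 := by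
  open FacetList in
  refine ⟨⟨⟨tenVertexComplex, triangulates_tenVertexComplex⟩, ?_⟩,
    ⟨tenVertexComplex, triangulates_tenVertexComplex, position, isPolyhedralImmersion_position,
      hasRotationalSymmetry_position⟩,
    ⟨tenVertexComplex, triangulates_tenVertexComplex, position, isPolyhedralImmersion_position⟩, ?_⟩
  · rintro n ⟨Δ, hΔ⟩
    exact AbstractSimplicialComplex.ten_le_of_triangulates hΔ
  · rintro n ⟨Δ, hΔ, -⟩
    exact AbstractSimplicialComplex.ten_le_of_triangulates hΔ
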